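/- An $\infty$-category is a simplicial set with fillers for all inner horns (a quasicategory). For a simplicial set $J$ write $J^\triangleright=J\star\Delta[0]$; a map $\bar p:J^\triangleright\to\mathcal C$ into an $\infty$-category is a colimit diagram if, for $p=\bar p|_J$, the map of slices $\mathcal C_{\bar p/}\to\mathcal C_{p/}$ is a trivial fibration. Let $\mathcal K$ be an $\infty$-category and $F:\mathcal K\to\mathcal K$ an endofunctor. The $\infty$-category of lax $F$-algebras is the pullback $\mathcal K^{\mathrm{lax}}(F)=\mathcal K\times_{\mathcal K\times\mathcal K}\mathcal K^{\{1\leftarrow0\to2\}}$ of $(F,\mathrm{id}):\mathcal K\to\mathcal K\times\mathcal K$ and of the evaluation of spans at $(1,2)$. Its objects are the spans $FB\xleftarrow{\,r\,}E\xrightarrow{\,a\,}B$ in $\mathcal K$. Let $u:\mathcal K^{\mathrm{lax}}(F)\to\mathcal K^{\Delta[1]}$ be the forgetful functor to the arrow $\infty$-category, sending $FB\leftarrow E\to B$ to $E\to B$, let $\rho:\mathcal K^{\mathrm{lax}}(F)\to\mathcal K^{\Delta[1]}$ be the functor sending it to $E\to FB$, and let $\mathrm{ev}_0,\mathrm{ev}_1:\mathcal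 K^{\Delta[1]}\to\mathcal K$ be the source and target functors. **Proposition.** Let $J$ be a simplicial set. (1) The functor $u$ reflects those colimits that are preserved by $\mathrm{ev}_0$: if $\bar p:J^\triangleright\to\mathcal K^{\mathrm{lax}}(F)$ is such that $u\bar p$ is a colimit diagram in $\mathcal K^{\Delta[1]}$ and $\mathrm{ev}_0u\bar p$ is a colimit diagram in $\mathcal K$, then $\bar p$ is a colimit diagram. (2) Let $p:J\to\mathcal K^{\mathrm{lax}}(F)$ be a diagram of lax $F$-algebras $FB_j\leftarrow E_j\to B_j$, and let $\bar c:J^\triangleright\to\mathcal K^{\Delta[1]}$ be a colimit diagram extending $up$, with vertex $E_\infty\to B_\infty$, such that $\mathrm{ev}_0\bar c$ exhibits $E_\infty$ as a colimit of the $E_j$ in $\mathcal K$. Then there is an essentially unique map $E_\infty\to FB_\infty$ induced by the cocone of maps $E_j\to FB_j\to FB_\infty$; precisely, the simplicial set of maps $\bar r:J^\triangleright\to\mathcal K^{\Delta[1]}$ with $\bar r|_J=\rho p$, $\mathrm{ev}_0\bar r=\mathrm{ev}_0\bar c$ and $\mathrm{ev}_1\bar r=F\,\mathrm{ev}_1\bar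 c$ is a contractible Kan complex. For every such $\bar r$ there is a unique $\bar p:J^\triangleright\to\mathcal K^{\mathrm{lax}}(F)$ with $u\bar p=\bar c$ and $\rho\bar p=\bar r$. It extends $p$, has the lax $F$-algebra $FB_\infty\leftarrow E_\infty\to B_\infty$ as its vertex, and is a colimit diagram, so that $FB_\infty\leftarrow E_\infty\to B_\infty$ is a colimit of $p$ in $\mathcal K^{\mathrm{lax}}(F)$. -/

import Mathlib

open CategoryTheory MonoidalCategory CartesianMonoidalCategory MonoidalClosed Simplicial

universe u

noncomputable section

namespace InftyCat

/-! ## Joins of simplicial sets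

A map `X ⟶ S ⋆ T` is the same thing as a map `cut : X ⟶ Δ[1]` together with a map to `S` from the
fibre of `cut` over the vertex `0`, and a map to `T` from the fibre of `cut` over the vertex `1`.
For `X = Δ[n]`, a map `cut` amounts to a decomposition of `[n]` as an initial segment `[i]` followed
by a final segment `[j]`, `i + j = n - 1`, `i, j ≥ -1`, so that the `n`-simplices of `S ⋆ T` below
are the elements of `S_n ⊔ T_n ⊔ ∐_{i + j = n - 1} S_i × T_j`. -/

/-- The fibre of `χ : X ⟶ Δ[1]` over the vertex `ε`. -/
def cutFiber {X : SSet.{u}} (χ : X ⟶ Δ[1]) (ε : Fin 2) : X.Subcomplex :=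
  (SSet.stdSimplex.face {ε}).preimage χ

/-- The map induced by `φ : Y ⟶ X` on the fibres over the vertices of `Δ[1]`. -/
def cutFiberMap {X Y : SSet.{u}} (φ : Y ⟶ X) (χ : X ⟶ Δ[1]) (ε : Fin 2) :
    (cutFiber (φ ≫ χ) ε : SSet.{u}) ⟶ cutFiber χ ε where
  app U := ↾fun x => ⟨φ.app U x.1, x.2⟩
  naturality U V f := by
    ext x
    apply Subtype.ext
    exact NatTrans.naturality_apply φ f x.1

/-- The data of a map from `X` to the join of `S` and `T`. -/
structure JoinMap (X S T : SSet.{u}) where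
  cut : X ⟶ Δ[1]
  left : (cutFiber cut 0 : SSet.{u}) ⟶ S
  right : (cutFiber cut 1 : SSet.{u}) ⟶ T

namespace JoinMap

variable {X Y S T S' T' : SSet.{u}}

lemma ext' {a b : JoinMap X S T} (h : a.cut = b.cut)
    (hl : ∀ (U : SimplexCategoryᵒᵖ) (x : X.obj U) (h₁ : x ∈ (cutFiber a.cut 0).obj U)
      (h₂ : x ∈ (cutFiber b.cut 0).obj U), a.left.app U ⟨x, h₁⟩ = b.left.app U ⟨x, h₂⟩)
    (hr : ∀ (U : SimplexCategoryᵒᵖ) (x : X.obj U) (h₁ : x ∈ (cutFiber a.cut 1).obj U)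
      (h₂ : x ∈ (cutFiber b.cut 1).obj U), a.right.app U ⟨x, h₁⟩ = b.right.app U ⟨x, h₂⟩) :
    a = b := by
  obtain ⟨χ, l, r⟩ := a
  obtain ⟨χ', l', r'⟩ := b
  obtain rfl : χ = χ' := h
  obtain rfl : l = l' := by
    ext U x
    exact hl U x.1 x.2 x.2
  obtain rfl : r = r' := by
    ext U x
    exact hr U x.1 x.2 x.2
  rfl

/-- Precomposition with a map `Y ⟶ X`. -/
def precomp (φ : Y ⟶ X) (a : JoinMap X S T) : JoinMap Y S T where
  cut := φ ≫ a.cut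
  left := cutFiberMap φ a.cut 0 ≫ a.left
  right := cutFiberMap φ a.cut 1 ≫ a.right

lemma precomp_id (a : JoinMap X S T) : a.precomp (𝟙 X) = a :=
  ext' (Category.id_comp _) (fun _ _ _ _ => rfl) (fun _ _ _ _ => rfl)

lemma precomp_comp {Z : SSet.{u}} (a : JoinMap X S T) (ψ : Z ⟶ Y) (φ : Y ⟶ X) :
    a.precomp (ψ ≫ φ) = (a.precomp φ).precomp ψ :=
  ext' (Category.assoc _ _ _) (fun _ _ _ _ => rfl) (fun _ _ _ _ => rfl)

/-- Postcomposition with the join of two maps. -/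
def postcomp (f : S ⟶ S') (g : T ⟶ T') (a : JoinMap X S T) : JoinMap X S' T' where
  cut := a.cut
  left := a.left ≫ f
  right := a.right ≫ g

end JoinMap

/-- The join `S ⋆ T` of simplicial sets. -/
def join (S T : SSet.{u}) : SSet.{u} where
  obj U := JoinMap (SSet.stdSimplex.obj U.unop) S T
  map f := ↾fun a => a.precomp (SSet.stdSimplex.map f.unop)
  map_id U := by
    ext a
    exact (congrArg (fun φ => a.precomp φ) (SSet.stdSimplex.map_id U.unop)).trans a.precomp_id
  map_comp f g := by
    ext a
    exact (congrArg (fun φ => a.precomp φ) (SSet.stdSimplex.map_comp g.unop f.unop)).trans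
      (a.precomp_comp _ _)

/-- Functoriality of the join in both variables. -/
def joinMap {S S' T T' : SSet.{u}} (f : S ⟶ S') (g : T ⟶ T') : join S T ⟶ join S' T' where
  app _ := ↾fun a => a.postcomp f g
  naturality _ _ _ := rfl

/-- The constant map at a vertex of `Δ[1]`. -/
def constCut (X : SSet.{u}) (ε : Fin 2) : X ⟶ Δ[1] :=
  SSet.const (SSet.stdSimplex.obj₀Equiv.symm ε)

lemma notMem_cutFiber_constCut {X : SSet.{u}} {ε ε' : Fin 2} (hε : ε ≠ ε')
    {U : SimplexCategoryᵒᵖ} (x : X.obj U) : x ∉ (cutFiber (constCut X ε) ε').obj U := by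
  intro h
  induction U using Opposite.rec with
  | op U =>
    induction U using SimplexCategory.rec with
    | _ n =>
      have h' := (SSet.stdSimplex.mem_face_iff _ _).1 h 0
      exact hε (Finset.mem_singleton.1 h')

/-- The map to anything from the empty fibre of a constant cut. -/
def fromEmptyFiber (X Y : SSet.{u}) {ε ε' : Fin 2} (hε : ε ≠ ε') :
    (cutFiber (constCut X ε) ε' : SSet.{u}) ⟶ Y where
  app U := ↾fun x => (notMem_cutFiber_constCut hε x.1 x.2).elim
  naturality U V f := by
    ext x
    exact (notMem_cutFiber_constCut hε x.1 x.2).elim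

/-- The inclusion `S ⟶ S ⋆ T`. -/
def joinInl (S T : SSet.{u}) : S ⟶ join S T where
  app U := ↾fun s =>
    { cut := constCut _ 0
      left := (cutFiber _ 0).ι ≫ SSet.yonedaEquiv.symm s
      right := fromEmptyFiber _ _ (by decide) }
  naturality U V f := by
    ext s
    refine JoinMap.ext' rfl ?_ ?_
    · intro W x h₁ h₂
      exact (Functor.map_comp_apply S f (SSet.stdSimplex.objEquiv x).op s).symm
    · intro W x h₁ h₂
      exact (notMem_cutFiber_constCut (by decide) x h₁).elim

/-- The inclusion `T ⟶ S ⋆ T`. -/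
def joinInr (S T : SSet.{u}) : T ⟶ join S T where
  app U := ↾fun t =>
    { cut := constCut _ 1
      left := fromEmptyFiber _ _ (by decide)
      right := (cutFiber _ 1).ι ≫ SSet.yonedaEquiv.symm t }
  naturality U V f := by
    ext t
    refine JoinMap.ext' rfl ?_ ?_
    · intro W x h₁ h₂
      exact (notMem_cutFiber_constCut (by decide) x h₁).elim
    · intro W x h₁ h₂
      exact (Functor.map_comp_apply T f (SSet.stdSimplex.objEquiv x).op t).symm

/-! ## Colimit cocones -/

/-- The right cone `J^▷ = J ⋆ Δ[0]`. -/
abbrev rightCone (J : SSet.{u}) : SSet.{u} := join J Δ[0]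

/-- The inclusion `J ⟶ J^▷`. -/
abbrev coneIncl (J : SSet.{u}) : J ⟶ rightCone J := joinInl J Δ[0]

/-- A map `pbar : J^▷ ⟶ C` is a colimit diagram (a colimit of its restriction `p` to `J`) if the map
of slices `C_{pbar/} ⟶ C_{p/}` is a trivial fibration: it has the right lifting property with
respect to all monomorphisms `i : A ⟶ B`. Here the maps `B ⟶ C_{p/}` are the maps `J ⋆ B ⟶ C` which
restrict to `p` on `J` (which holds for `f` below, because of its compatibility with `g`), and
the maps `A ⟶ C_{pbar/}` are the maps `J^▷ ⋆ A ⟶ C` which restrict to `pbar` on `J^▷`. -/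
def IsColimitCone {J C : SSet.{u}} (pbar : rightCone J ⟶ C) : Prop :=
  ∀ ⦃A B : SSet.{u}⦄ (i : A ⟶ B) [Mono i]
    (f : join J B ⟶ C) (g : join (rightCone J) A ⟶ C),
    joinInl (rightCone J) A ≫ g = pbar →
    joinMap (𝟙 J) i ≫ f = joinMap (coneIncl J) (𝟙 A) ≫ g →
    ∃ h : join (rightCone J) B ⟶ C,
      joinMap (coneIncl J) (𝟙 B) ≫ h = f ∧ joinMap (𝟙 (rightCone J)) i ≫ h = g

/-! ## Functor categories -/

/-- Evaluation `K^A ⟶ K` at a vertex of `A`. -/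
def evalAt {A : SSet.{u}} (v : A _⦋0⦌) (K : SSet.{u}) : (ihom A).obj K ⟶ K :=
  lift (SSet.const v) (𝟙 _) ≫ (ihom.ev A).app K

/-- The arrow category `K^{Δ[1]}`. -/
abbrev Arr (K : SSet.{u}) : SSet.{u} := (ihom (Δ[1] : SSet.{u})).obj K

/-- The source of an arrow. -/
abbrev source (K : SSet.{u}) : Arr K ⟶ K := evalAt (SSet.stdSimplex.obj₀Equiv.symm 0) K

/-- The target of an arrow. -/
abbrev target (K : SSet.{u}) : Arr K ⟶ K := evalAt (SSet.stdSimplex.obj₀Equiv.symm 1) K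

/-- The category of spans `K^{1 ← 0 → 2}`. -/
abbrev Span (K : SSet.{u}) : SSet.{u} := (ihom (Λ[2, 0] : SSet.{u})).obj K

/-- The vertex `1` of the horn `1 ← 0 → 2`. -/
def spanVertex₁ : (Λ[2, 0] : SSet.{u}) _⦋0⦌ :=
  SSet.horn₂₀.ι₀₁.app _ (SSet.stdSimplex.obj₀Equiv.symm 1)

/-- The vertex `2` of the horn `1 ← 0 → 2`. -/
def spanVertex₂ : (Λ[2, 0] : SSet.{u}) _⦋0⦌ :=
  SSet.horn₂₀.ι₀₂.app _ (SSet.stdSimplex.obj₀Equiv.symm 1)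

/-! ## Lax algebras of an endofunctor -/

/-- The category of lax `F`-algebras `F B ← E → B`, as the pullback of
`(F, id) : K ⟶ K × K` and of the evaluation `K^{1 ← 0 → 2} ⟶ K × K` at the vertices `1` and `2`. -/
def LaxAlg {K : SSet.{u}} (F : K ⟶ K) : SSet.{u} :=
  Limits.pullback (lift F (𝟙 K)) (lift (evalAt spanVertex₁ K) (evalAt spanVertex₂ K))

/-- The underlying span of a lax `F`-algebra. -/
def toSpan {K : SSet.{u}} (F : K ⟶ K) : LaxAlg F ⟶ Span K :=
  Limits.pullback.snd _ _

/-- The functor sending a lax `F`-algebra `F B ← E → B` to its lax action `E → B`. -/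
def forget {K : SSet.{u}} (F : K ⟶ K) : LaxAlg F ⟶ Arr K :=
  toSpan F ≫ (MonoidalClosed.pre SSet.horn₂₀.ι₀₂).app K

/-- The functor sending a lax `F`-algebra `F B ← E → B` to its resolution `E → F B`. -/
def resolution {K : SSet.{u}} (F : K ⟶ K) : LaxAlg F ⟶ Arr K :=
  toSpan F ≫ (MonoidalClosed.pre SSet.horn₂₀.ι₀₁).app K

/-! ## The space of induced maps -/

/-- The fibre of a map of simplicial sets over a vertex. -/
def fiberOver {X Y : SSet.{u}} (f : X ⟶ Y) (y : Y _⦋0⦌) : X.Subcomplex :=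
  (SSet.Subcomplex.ofSimplex y).preimage f

/-- A map of simplicial sets, as a vertex of the internal hom. -/
def homVertex {A X : SSet.{u}} (f : A ⟶ X) : ((ihom A).obj X) _⦋0⦌ :=
  SSet.yonedaEquiv (MonoidalClosed.curry (fst A Δ[0] ≫ f))

/-- Let `p` be a diagram of lax `F`-algebras `F B_j ← E_j → B_j`, and `c` a cocone under the diagram
of arrows `E_j → B_j`, with vertex `E_∞ → B_∞`. This is the simplicial set of all maps of cocones,
from the cocone `E_j → E_∞` to the cocone `F B_j → F B_∞`, which restrict to the resolutions
`E_j → F B_j` on the given diagram: the maps `E_∞ → F B_∞` induced by the cocone of maps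
`E_j → F B_j → F B_∞`, with all coherence data. -/
def inducedMaps {K : SSet.{u}} (F : K ⟶ K) {J : SSet.{u}} (p : J ⟶ LaxAlg F)
    (c : rightCone J ⟶ Arr K) : ((ihom (rightCone J)).obj (Arr K)).Subcomplex :=
  fiberOver ((MonoidalClosed.pre (coneIncl J)).app (Arr K)) (homVertex (p ≫ resolution F)) ⊓
    fiberOver ((ihom (rightCone J)).map (source K)) (homVertex (c ≫ source K)) ⊓
    fiberOver ((ihom (rightCone J)).map (target K)) (homVertex (c ≫ target K ≫ F))

/-- A simplicial set is a contractible Kan complex if it has the extension property for all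
boundary inclusions `∂Δ[n] ⟶ Δ[n]`, `n ≥ 0` (for `n = 0` this says that it is nonempty). -/
def IsContractible (X : SSet.{u}) : Prop :=
  ∀ (n : ℕ) (σ : (∂Δ[n] : SSet.{u}) ⟶ X), ∃ τ : Δ[n] ⟶ X, ∂Δ[n].ι ≫ τ = σ

end InftyCat

end

noncomputable section

namespace InftyCat

/-! ## Gluing maps of simplicial sets -/

section Glue

variable {X L P Q : SSet.{u}}

/-! A map into `LaxAlg F` is a pair of maps to `Arr K` with a common source, the target of the
second being `F` applied to the target of the first (`exists_laxAlg_lift`, `laxAlg_hom_ext`). Once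
the `forget` component of an extension problem is known, only the `resolution` component is missing:
a map `X ⟶ Arr K` with prescribed source and target, given on a subcomplex `X₀`. By adjunction
(`exists_arr_extension`) this means extending a map to `K` from `X₀ ⊗ Δ[1] ∪ X ⊗ ∂Δ[1]` to `X ⊗
Δ[1]`. It is possible because the map is a colimit cone over the end `0`, and natural
transformations out of a colimit cone are determined, up to contractible choice, by their
restriction to the diagram.

For the reflection of colimits, `X = J^▷ ⋆ B` and `X₀ = J ⋆ B ∪ J^▷ ⋆ A`
(`exists_cylinder_extension`). For the contractibility of the space of induced maps, `X = J^▷ ⊗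
Δ[n]` and `X₀ = J ⊗ Δ[n] ∪ J^▷ ⊗ ∂Δ[n]` (`exists_prism_extension`). In both cases the cylinder is
covered by two parts. One is filled with inner horns only. The extension over the other is reduced,
through retractions, to extensions over joins `J^▷ ⋆ T` whose first factor lies over the end `0`,
where the definition of a colimit cone applies, and to further inner horns.

The inner horns all come from `hasLiftingProperty_relBase`. Given `χ : X ⟶ Δ[1]`, consider the part
of `X ⊗ Δ[1]` whose second coordinate is at least `χ`; maps to the total space of an inner fibration
extend to it from the union of the region `χ = 0`, the end `1`, and whatever lies over `X₀`. For a
simplex and its boundary this is an explicit filtration of a prism (`hasLiftingProperty_prismBase`).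
The general case follows since maps out of such parts are represented by simplicial sets `piObj`, so
that the statement becomes a right lifting property against monomorphisms, which can be tested on
boundary inclusions.

A consequence is `exists_joinUnion_extension`: maps to a quasicategory extend from `S₀ ⋆ T ∪ S ⋆ T₀`
to `S ⋆ T` when `S` deforms into `S₀`. It handles every step but the last of a filtration of `J^▷ ⊗
Δ[n + 1]`; the last step is the universal property of the cone over the vertex `0`
(`exists_cylBase_extension`). -/

/-- Maps which are compatible on a jointly surjective pair glue. -/
lemma exists_glue (α : P ⟶ X) (β : Q ⟶ X) (f : P ⟶ L) (g : Q ⟶ L)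
    (hcov : ∀ (U : SimplexCategoryᵒᵖ) (x : X.obj U),
      (∃ p, α.app U p = x) ∨ ∃ q, β.app U q = x)
    (hα : ∀ (U : SimplexCategoryᵒᵖ) (p p' : P.obj U), α.app U p = α.app U p' →
      f.app U p = f.app U p')
    (hβ : ∀ (U : SimplexCategoryᵒᵖ) (q q' : Q.obj U), β.app U q = β.app U q' →
      g.app U q = g.app U q')
    (hαβ : ∀ (U : SimplexCategoryᵒᵖ) (p : P.obj U) (q : Q.obj U), α.app U p = β.app U q →
      f.app U p = g.app U q) :
    ∃ m : X ⟶ L, α ≫ m = f ∧ β ≫ m = g := by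
  classical
  have key : ∀ (U : SimplexCategoryᵒᵖ) (x : X.obj U), ∃ y : L.obj U,
      (∀ p, α.app U p = x → f.app U p = y) ∧ (∀ q, β.app U q = x → g.app U q = y) := by
    intro U x
    obtain ⟨p, rfl⟩ | ⟨q, rfl⟩ := hcov U x
    · exact ⟨f.app U p, fun p' h => hα U _ _ h, fun q h => (hαβ U _ _ h.symm).symm⟩
    · exact ⟨g.app U q, fun p h => hαβ U _ _ h, fun q' h => hβ U _ _ h⟩
  choose m hm₁ hm₂ using key
  refine ⟨{ app U := ↾(m U), naturality := ?_ }, ?_, ?_⟩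
  · intro U V i
    ext x
    change m V (X.map i x) = L.map i (m U x)
    obtain ⟨p, rfl⟩ | ⟨q, rfl⟩ := hcov U x
    · rw [← hm₁ U _ p rfl, ← hm₁ V _ (P.map i p) (NatTrans.naturality_apply α i p)]
      exact NatTrans.naturality_apply f i p
    · rw [← hm₂ U _ q rfl, ← hm₂ V _ (Q.map i q) (NatTrans.naturality_apply β i q)]
      exact NatTrans.naturality_apply g i q
  · ext U p
    exact (hm₁ U _ p rfl).symm
  · ext U q
    exact (hm₂ U _ q rfl).symm

/-- Maps which are defined on two subcomplexes and agree on the intersection glue. -/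
lemma exists_glue_sup (S T : X.Subcomplex) (f : (S : SSet.{u}) ⟶ L) (g : (T : SSet.{u}) ⟶ L)
    (h : ∀ (U : SimplexCategoryᵒᵖ) (x : X.obj U) (hS : x ∈ S.obj U) (hT : x ∈ T.obj U),
      f.app U ⟨x, hS⟩ = g.app U ⟨x, hT⟩) :
    ∃ m : (S ⊔ T : X.Subcomplex).toSSet ⟶ L,
      SSet.Subcomplex.homOfLE le_sup_left ≫ m = f ∧
        SSet.Subcomplex.homOfLE le_sup_right ≫ m = g := by
  refine exists_glue _ _ f g ?_ ?_ ?_ ?_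
  · rintro U ⟨x, hx | hx⟩
    · exact Or.inl ⟨⟨x, hx⟩, rfl⟩
    · exact Or.inr ⟨⟨x, hx⟩, rfl⟩
  · rintro U ⟨p, hp⟩ ⟨p', hp'⟩ h
    obtain rfl : p = p' := congrArg Subtype.val h
    rfl
  · rintro U ⟨p, hp⟩ ⟨p', hp'⟩ h
    obtain rfl : p = p' := congrArg Subtype.val h
    rfl
  · rintro U ⟨p, hp⟩ ⟨p', hp'⟩ h'
    obtain rfl : p = p' := congrArg Subtype.val h'
    exact h U p hp hp'

/-- A map factors through a monomorphism when its range does. -/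
lemma exists_factor (i : P ⟶ Q) [Mono i] (f : X ⟶ Q)
    (h : ∀ (U : SimplexCategoryᵒᵖ) (x : X.obj U), f.app U x ∈ (SSet.Subcomplex.range i).obj U) :
    ∃ g : X ⟶ P, g ≫ i = f := by
  refine ⟨SSet.Subcomplex.lift f ?_ ≫ inv (SSet.Subcomplex.toRange i), ?_⟩
  · rintro U _ ⟨x, rfl⟩
    exact h U x
  · have : inv (SSet.Subcomplex.toRange i) ≫ i = (SSet.Subcomplex.range i).ι := by
      rw [IsIso.inv_comp_eq, SSet.Subcomplex.toRange_ι]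
    rw [Category.assoc, this]
    rfl

lemma app_injective_of_mono (i : P ⟶ Q) [Mono i] (U : SimplexCategoryᵒᵖ) :
    Function.Injective (i.app U) :=
  (mono_iff_injective _).1 inferInstance

end Glue

/-! ## Vertices of simplices of `Δ[1]` -/

/-- The value of a simplex of a standard simplex at a vertex. -/
abbrev vx {n : ℕ} {U : SimplexCategoryᵒᵖ} (c : (Δ[n] : SSet.{u}).obj U)
    (i : Fin (U.unop.len + 1)) : Fin (n + 1) :=
  SSet.stdSimplex.asOrderHom c i

lemma vx_ext {n : ℕ} {U : SimplexCategoryᵒᵖ} {c d : (Δ[n] : SSet.{u}).obj U}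
    (h : ∀ i, vx c i = vx d i) : c = d := by
  induction U using Opposite.rec with
  | op U =>
    induction U using SimplexCategory.rec with
    | _ n => exact SSet.stdSimplex.ext _ _ h

lemma vx_map {n : ℕ} {U V : SimplexCategoryᵒᵖ} (f : U ⟶ V) (c : (Δ[n] : SSet.{u}).obj U)
    (i : Fin (V.unop.len + 1)) :
    vx ((Δ[n] : SSet.{u}).map f c) i = vx c (f.unop.toOrderHom i) := rfl

lemma vx_mono {n : ℕ} {U : SimplexCategoryᵒᵖ} (c : (Δ[n] : SSet.{u}).obj U)
    {i j : Fin (U.unop.len + 1)} (h : i ≤ j) : vx c i ≤ vx c j :=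
  (SSet.stdSimplex.asOrderHom c).monotone h

/-- Construct a simplex of a standard simplex from its vertices. -/
def vxMk {n : ℕ} {U : SimplexCategoryᵒᵖ} (v : Fin (U.unop.len + 1) → Fin (n + 1))
    (hv : Monotone v) : (Δ[n] : SSet.{u}).obj U :=
  SSet.stdSimplex.objMk ⟨v, hv⟩

lemma mem_face_singleton {n : ℕ} {U : SimplexCategoryᵒᵖ} (c : (Δ[n] : SSet.{u}).obj U)
    (ε : Fin (n + 1)) :
    c ∈ (SSet.stdSimplex.face {ε}).obj U ↔ ∀ i, vx c i = ε := by
  induction U using Opposite.rec with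
  | op U =>
    induction U using SimplexCategory.rec with
    | _ n =>
      rw [SSet.stdSimplex.mem_face_iff]
      simp only [Finset.mem_singleton]
      rfl

lemma mem_cutFiber {X : SSet.{u}} (χ : X ⟶ Δ[1]) (ε : Fin 2) {U : SimplexCategoryᵒᵖ}
    (x : X.obj U) : x ∈ (cutFiber χ ε).obj U ↔ ∀ i, vx (χ.app U x) i = ε :=
  mem_face_singleton _ _

lemma mem_boundary_one {U : SimplexCategoryᵒᵖ} (c : (Δ[1] : SSet.{u}).obj U) :
    c ∈ (∂Δ[1] : (Δ[1] : SSet.{u}).Subcomplex).obj U ↔ (∀ i, vx c i = 0) ∨ ∀ i, vx c i = 1 := by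
  induction U using Opposite.rec with
  | op U =>
    induction U using SimplexCategory.rec with
    | _ n =>
      rw [SSet.mem_boundary_iff_notMem_range]
      constructor
      · rintro ⟨j, hj⟩
        fin_cases j
        · exact Or.inr fun i => by
            have : c i ≠ 0 := fun h => hj ⟨i, h⟩
            change c i = 1
            lia
        · exact Or.inl fun i => by
            have : c i ≠ 1 := fun h => hj ⟨i, h⟩
            change c i = 0
            lia
      · rintro (h | h)
        · refine ⟨1, ?_⟩
          rintro ⟨i, hi⟩
          exact absurd ((h i).symm.trans hi) (by decide)
        · refine ⟨0, ?_⟩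
          rintro ⟨i, hi⟩
          exact absurd ((h i).symm.trans hi) (by decide)

/-- The vertex of a simplex. -/
def vertexHom (U : SimplexCategoryᵒᵖ) (i : Fin (U.unop.len + 1)) :
    U ⟶ Opposite.op ⦋0⦌ :=
  (SimplexCategory.const ⦋0⦌ U.unop i).op

/-- Naturality for the inclusion of a vertex. It reduces questions about maps to `Δ[n]` to
`0`-simplices, where every cut is either `0` or `1`. -/
lemma vx_vertex {X : SSet.{u}} {n : ℕ} (χ : X ⟶ Δ[n]) {U : SimplexCategoryᵒᵖ} (x : X.obj U)
    (i : Fin (U.unop.len + 1)) :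
    vx (χ.app U x) i = vx (χ.app _ (X.map (vertexHom U i) x)) 0 := by
  rw [NatTrans.naturality_apply]
  rfl

/-- Maps to a standard simplex are determined by their values on vertices. -/
lemma hom_ext_vx {X : SSet.{u}} {n : ℕ} {χ χ' : X ⟶ Δ[n]}
    (h : ∀ x : X _⦋0⦌, vx (χ.app _ x) 0 = vx (χ'.app _ x) 0) : χ = χ' := by
  ext U x
  exact vx_ext fun i => (vx_vertex χ x i).trans ((h _).trans (vx_vertex χ' x i).symm)

/-- Construct a map to a standard simplex from a monotone map on vertices. -/
def homOfVx {X : SSet.{u}} {k : ℕ} (v : X _⦋0⦌ → Fin (k + 1))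
    (hv : ∀ (U : SimplexCategoryᵒᵖ) (x : X.obj U) (i j : Fin (U.unop.len + 1)), i ≤ j →
      v (X.map (vertexHom U i) x) ≤ v (X.map (vertexHom U j) x)) : X ⟶ Δ[k] where
  app U := ↾fun x => vxMk (fun i => v (X.map (vertexHom U i) x)) fun i j h => hv U x i j h
  naturality U V f := by
    ext x
    refine vx_ext fun i => ?_
    change v (X.map (vertexHom V i) (X.map f x)) = v (X.map (vertexHom U _) x)
    rw [← Functor.map_comp_apply]
    rfl

lemma vx_homOfVx {X : SSet.{u}} {k : ℕ} (v : X _⦋0⦌ → Fin (k + 1)) (hv) {U : SimplexCategoryᵒᵖ} (x : X.obj U)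
    (i : Fin (U.unop.len + 1)) :
    vx ((homOfVx v hv).app U x) i = v (X.map (vertexHom U i) x) := rfl

/-! ## The universal property of the join -/

section Join

variable {X Y S T S' T' : SSet.{u}}

/-- The tautological simplex. -/
def idSimplex (U : SimplexCategoryᵒᵖ) : (SSet.stdSimplex.{u}.obj U.unop).obj U :=
  SSet.stdSimplex.objEquiv.symm (𝟙 _)

lemma map_idSimplex {U V : SimplexCategoryᵒᵖ} (f : U ⟶ V) :
    (SSet.stdSimplex.map f.unop).app V (idSimplex.{u} V) =
      (SSet.stdSimplex.obj U.unop).map f (idSimplex U) := by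
  apply SSet.stdSimplex.objEquiv.injective
  exact (Category.id_comp f.unop).trans (Category.comp_id f.unop).symm

/-- Yoneda: a simplex of a representable is the image of the tautological one under the map that it
classifies. Components of a `JoinMap` at arbitrary simplices can thus be read off from the faces and
degeneracies of the corresponding simplex of the join. -/
lemma map_app_idSimplex {U V : SimplexCategoryᵒᵖ} (x : (SSet.stdSimplex.{u}.obj U.unop).obj V) :
    (SSet.stdSimplex.map (SSet.stdSimplex.objEquiv x)).app V (idSimplex.{u} V) = x := by
  apply SSet.stdSimplex.objEquiv.injective
  exact Category.id_comp (SSet.stdSimplex.objEquiv x)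

/-- The canonical map from a join to `Δ[1]`. -/
def joinCut (S T : SSet.{u}) : join S T ⟶ Δ[1] where
  app U := ↾fun a => SSet.yonedaEquiv (JoinMap.cut a)
  naturality U V f := by
    ext a
    exact (SSet.yonedaEquiv_naturality f.unop (JoinMap.cut a)).symm

/-- The component in the first variable of a simplex of a join. -/
def joinLeft (S T : SSet.{u}) : (cutFiber (joinCut S T) 0 : SSet.{u}) ⟶ S where
  app U := ↾fun z => (JoinMap.left z.1).app U ⟨idSimplex U, z.2⟩
  naturality U V f := by
    ext z
    refine Eq.trans ?_ (NatTrans.naturality_apply (JoinMap.left z.1) f ⟨idSimplex U, z.2⟩)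
    exact congrArg ((JoinMap.left z.1).app V) (Subtype.ext (map_idSimplex f))

/-- The component in the second variable of a simplex of a join. -/
def joinRight (S T : SSet.{u}) : (cutFiber (joinCut S T) 1 : SSet.{u}) ⟶ T where
  app U := ↾fun z => (JoinMap.right z.1).app U ⟨idSimplex U, z.2⟩
  naturality U V f := by
    ext z
    refine Eq.trans ?_ (NatTrans.naturality_apply (JoinMap.right z.1) f ⟨idSimplex U, z.2⟩)
    exact congrArg ((JoinMap.right z.1).app V) (Subtype.ext (map_idSimplex f))

lemma joinLeft_congr {U : SimplexCategoryᵒᵖ} {a b : (join S T).obj U} (e : a = b)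
    (ha : a ∈ (cutFiber (joinCut S T) 0).obj U) (hb : b ∈ (cutFiber (joinCut S T) 0).obj U) :
    (joinLeft S T).app U ⟨a, ha⟩ = (joinLeft S T).app U ⟨b, hb⟩ := by
  subst e
  rfl

lemma joinRight_congr {U : SimplexCategoryᵒᵖ} {a b : (join S T).obj U} (e : a = b)
    (ha : a ∈ (cutFiber (joinCut S T) 1).obj U) (hb : b ∈ (cutFiber (joinCut S T) 1).obj U) :
    (joinRight S T).app U ⟨a, ha⟩ = (joinRight S T).app U ⟨b, hb⟩ := by
  subst e
  rfl

lemma cutFiber_disjoint (χ : X ⟶ Δ[1]) {U : SimplexCategoryᵒᵖ} {x : X.obj U}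
    (h₀ : x ∈ (cutFiber χ 0).obj U) (h₁ : x ∈ (cutFiber χ 1).obj U) : False :=
  absurd (((mem_cutFiber _ _ _).1 h₀ 0).symm.trans ((mem_cutFiber _ _ _).1 h₁ 0)) zero_ne_one

/-- Two simplices of a join are equal if they have the same components. -/
lemma join_ext {U : SimplexCategoryᵒᵖ} {a b : (join S T).obj U}
    (hc : (joinCut S T).app U a = (joinCut S T).app U b)
    (hl : ∀ (V : SimplexCategoryᵒᵖ) (f : U ⟶ V)
      (ha : (join S T).map f a ∈ (cutFiber (joinCut S T) 0).obj V)
      (hb : (join S T).map f b ∈ (cutFiber (joinCut S T) 0).obj V),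
      (joinLeft S T).app V ⟨_, ha⟩ = (joinLeft S T).app V ⟨_, hb⟩)
    (hr : ∀ (V : SimplexCategoryᵒᵖ) (f : U ⟶ V)
      (ha : (join S T).map f a ∈ (cutFiber (joinCut S T) 1).obj V)
      (hb : (join S T).map f b ∈ (cutFiber (joinCut S T) 1).obj V),
      (joinRight S T).app V ⟨_, ha⟩ = (joinRight S T).app V ⟨_, hb⟩) :
    a = b := by
  refine JoinMap.ext' (SSet.yonedaEquiv.injective hc) ?_ ?_
  · intro V x h₁ h₂
    obtain ⟨y, hy⟩ : ∃ y, y = (SSet.stdSimplex.map (SSet.stdSimplex.objEquiv x)).app V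
      (idSimplex.{u} V) := ⟨_, rfl⟩
    obtain rfl : y = x := hy.trans (map_app_idSimplex x)
    have h₁' := h₁
    have h₂' := h₂
    rw [hy] at h₁' h₂'
    have := hl V (SSet.stdSimplex.objEquiv y).op h₁' h₂'
    refine Eq.trans ?_ (this.trans ?_)
    · exact congrArg ((JoinMap.left a).app V) (Subtype.ext hy)
    · exact congrArg ((JoinMap.left b).app V) (Subtype.ext hy.symm)
  · intro V x h₁ h₂
    obtain ⟨y, hy⟩ : ∃ y, y = (SSet.stdSimplex.map (SSet.stdSimplex.objEquiv x)).app V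
      (idSimplex.{u} V) := ⟨_, rfl⟩
    obtain rfl : y = x := hy.trans (map_app_idSimplex x)
    have h₁' := h₁
    have h₂' := h₂
    rw [hy] at h₁' h₂'
    have := hr V (SSet.stdSimplex.objEquiv y).op h₁' h₂'
    refine Eq.trans ?_ (this.trans ?_)
    · exact congrArg ((JoinMap.right a).app V) (Subtype.ext hy)
    · exact congrArg ((JoinMap.right b).app V) (Subtype.ext hy.symm)

/-- The map to a join with given components. -/
def joinLift (χ : X ⟶ Δ[1]) (l : (cutFiber χ 0 : SSet.{u}) ⟶ S)
    (r : (cutFiber χ 1 : SSet.{u}) ⟶ T) : X ⟶ join S T where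
  app U := ↾fun x => (⟨χ, l, r⟩ : JoinMap X S T).precomp
    (SSet.yonedaEquiv (n := U.unop).symm x)
  naturality U V f := by
    ext x
    refine Eq.trans ?_ (JoinMap.precomp_comp _ _ _)
    exact congrArg (fun φ => (⟨χ, l, r⟩ : JoinMap X S T).precomp φ)
      (SSet.yonedaEquiv_symm_naturality_left f.unop x).symm

lemma yonedaEquiv_symm_app_idSimplex {U : SimplexCategoryᵒᵖ} (x : X.obj U) :
    (SSet.yonedaEquiv (n := U.unop).symm x).app U (idSimplex U) = x :=
  (SSet.yonedaEquiv (n := U.unop)).apply_symm_apply x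

@[simp]
lemma joinLift_cut (χ : X ⟶ Δ[1]) (l : (cutFiber χ 0 : SSet.{u}) ⟶ S)
    (r : (cutFiber χ 1 : SSet.{u}) ⟶ T) : joinLift χ l r ≫ joinCut S T = χ := by
  ext U x
  exact congrArg (χ.app U) (yonedaEquiv_symm_app_idSimplex x)

lemma joinLift_left (χ : X ⟶ Δ[1]) (l : (cutFiber χ 0 : SSet.{u}) ⟶ S)
    (r : (cutFiber χ 1 : SSet.{u}) ⟶ T) {U : SimplexCategoryᵒᵖ} (x : X.obj U)
    (h : x ∈ (cutFiber χ 0).obj U)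
    (h' : (joinLift χ l r).app U x ∈ (cutFiber (joinCut S T) 0).obj U) :
    (joinLeft S T).app U ⟨_, h'⟩ = l.app U ⟨x, h⟩ :=
  congrArg (l.app U) (Subtype.ext (yonedaEquiv_symm_app_idSimplex x))

lemma joinLift_right (χ : X ⟶ Δ[1]) (l : (cutFiber χ 0 : SSet.{u}) ⟶ S)
    (r : (cutFiber χ 1 : SSet.{u}) ⟶ T) {U : SimplexCategoryᵒᵖ} (x : X.obj U)
    (h : x ∈ (cutFiber χ 1).obj U)
    (h' : (joinLift χ l r).app U x ∈ (cutFiber (joinCut S T) 1).obj U) :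
    (joinRight S T).app U ⟨_, h'⟩ = r.app U ⟨x, h⟩ :=
  congrArg (r.app U) (Subtype.ext (yonedaEquiv_symm_app_idSimplex x))

lemma joinLift_mem (χ : X ⟶ Δ[1]) (l : (cutFiber χ 0 : SSet.{u}) ⟶ S)
    (r : (cutFiber χ 1 : SSet.{u}) ⟶ T) {U : SimplexCategoryᵒᵖ} (x : X.obj U) (ε : Fin 2) :
    (joinLift χ l r).app U x ∈ (cutFiber (joinCut S T) ε).obj U ↔ x ∈ (cutFiber χ ε).obj U := by
  conv_rhs => rw [← joinLift_cut χ l r]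
  rfl

@[simp]
lemma joinMap_cut (f : S ⟶ S') (g : T ⟶ T') : joinMap f g ≫ joinCut S' T' = joinCut S T := rfl

lemma joinMap_mem (f : S ⟶ S') (g : T ⟶ T') {U : SimplexCategoryᵒᵖ} (z : (join S T).obj U)
    (ε : Fin 2) : (joinMap f g).app U z ∈ (cutFiber (joinCut S' T') ε).obj U ↔
      z ∈ (cutFiber (joinCut S T) ε).obj U := Iff.rfl

lemma joinMap_left (f : S ⟶ S') (g : T ⟶ T') {U : SimplexCategoryᵒᵖ} (z : (join S T).obj U)
    (h : z ∈ (cutFiber (joinCut S T) 0).obj U)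
    (h' : (joinMap f g).app U z ∈ (cutFiber (joinCut S' T') 0).obj U) :
    (joinLeft S' T').app U ⟨_, h'⟩ = f.app U ((joinLeft S T).app U ⟨z, h⟩) := rfl

lemma joinMap_right (f : S ⟶ S') (g : T ⟶ T') {U : SimplexCategoryᵒᵖ} (z : (join S T).obj U)
    (h : z ∈ (cutFiber (joinCut S T) 1).obj U)
    (h' : (joinMap f g).app U z ∈ (cutFiber (joinCut S' T') 1).obj U) :
    (joinRight S' T').app U ⟨_, h'⟩ = g.app U ((joinRight S T).app U ⟨z, h⟩) := rfl

lemma joinInl_mem {U : SimplexCategoryᵒᵖ} (s : S.obj U) :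
    (joinInl S T).app U s ∈ (cutFiber (joinCut S T) 0).obj U :=
  (mem_cutFiber _ _ _).2 fun _ => rfl

lemma joinInl_left {U : SimplexCategoryᵒᵖ} (s : S.obj U)
    (h' : (joinInl S T).app U s ∈ (cutFiber (joinCut S T) 0).obj U) :
    (joinLeft S T).app U ⟨_, h'⟩ = s :=
  yonedaEquiv_symm_app_idSimplex s

lemma joinInl_naturality (f : S ⟶ S') (g : T ⟶ T') :
    joinInl S T ≫ joinMap f g = f ≫ joinInl S' T' := by
  ext U s
  refine JoinMap.ext' rfl ?_ ?_
  · intro V x h₁ h₂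
    exact NatTrans.naturality_apply f (SSet.stdSimplex.objEquiv x).op s
  · intro V x h₁ h₂
    exact (notMem_cutFiber_constCut (by decide) x h₁).elim

lemma subcomplex_map_mem (A : X.Subcomplex) {U V : SimplexCategoryᵒᵖ} (f : U ⟶ V) {z : X.obj U}
    (h : z ∈ A.obj U) : X.map f z ∈ A.obj V :=
  A.map f h

lemma subcomplex_hom_map {A : X.Subcomplex} (φ : (A : SSet.{u}) ⟶ S) {U V : SimplexCategoryᵒᵖ}
    (f : U ⟶ V) (z : X.obj U) (h : z ∈ A.obj U) (h' : X.map f z ∈ A.obj V) :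
    φ.app V ⟨_, h'⟩ = S.map f (φ.app U ⟨z, h⟩) :=
  NatTrans.naturality_apply φ f ⟨z, h⟩

lemma joinLeft_map {U V : SimplexCategoryᵒᵖ} (f : U ⟶ V) (z : (join S T).obj U)
    (h : z ∈ (cutFiber (joinCut S T) 0).obj U)
    (h' : (join S T).map f z ∈ (cutFiber (joinCut S T) 0).obj V) :
    (joinLeft S T).app V ⟨_, h'⟩ = S.map f ((joinLeft S T).app U ⟨z, h⟩) :=
  subcomplex_hom_map (joinLeft S T) f z h h'

lemma joinRight_map {U V : SimplexCategoryᵒᵖ} (f : U ⟶ V) (z : (join S T).obj U)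
    (h : z ∈ (cutFiber (joinCut S T) 1).obj U)
    (h' : (join S T).map f z ∈ (cutFiber (joinCut S T) 1).obj V) :
    (joinRight S T).app V ⟨_, h'⟩ = T.map f ((joinRight S T).app U ⟨z, h⟩) :=
  subcomplex_hom_map (joinRight S T) f z h h'

lemma JoinMap.left_app_eq {U V : SimplexCategoryᵒᵖ} (a : (join S T).obj U)
    (x : (SSet.stdSimplex.{u}.obj U.unop).obj V) (h : x ∈ (cutFiber (JoinMap.cut a) 0).obj V) :
    ∃ h', (JoinMap.left a).app V ⟨x, h⟩ =
      (joinLeft S T).app V ⟨(join S T).map (SSet.stdSimplex.objEquiv x).op a, h'⟩ := by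
  obtain ⟨y, hy⟩ : ∃ y, y = (SSet.stdSimplex.map (SSet.stdSimplex.objEquiv x)).app V
    (idSimplex.{u} V) := ⟨_, rfl⟩
  obtain rfl : y = x := hy.trans (map_app_idSimplex x)
  have h' := h
  rw [hy] at h'
  exact ⟨h', congrArg ((JoinMap.left a).app V) (Subtype.ext hy)⟩

lemma JoinMap.right_app_eq {U V : SimplexCategoryᵒᵖ} (a : (join S T).obj U)
    (x : (SSet.stdSimplex.{u}.obj U.unop).obj V) (h : x ∈ (cutFiber (JoinMap.cut a) 1).obj V) :
    ∃ h', (JoinMap.right a).app V ⟨x, h⟩ =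
      (joinRight S T).app V ⟨(join S T).map (SSet.stdSimplex.objEquiv x).op a, h'⟩ := by
  obtain ⟨y, hy⟩ : ∃ y, y = (SSet.stdSimplex.map (SSet.stdSimplex.objEquiv x)).app V
    (idSimplex.{u} V) := ⟨_, rfl⟩
  obtain rfl : y = x := hy.trans (map_app_idSimplex x)
  have h' := h
  rw [hy] at h'
  exact ⟨h', congrArg ((JoinMap.right a).app V) (Subtype.ext hy)⟩

attribute [irreducible] joinLeft joinRight joinLift joinCut

end Join

/-! ## Ranges of maps between joins -/

section JoinRange

variable {X Y S T S' T' : SSet.{u}}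

/-- A simplex of a join is a cut with two component maps, so it lifts as soon as each component map
factors through the corresponding monomorphism. All later membership proofs for subjoins check the
two components separately in this way. -/
lemma mem_range_joinMap (f : S ⟶ S') (g : T ⟶ T') [Mono f] [Mono g] {U : SimplexCategoryᵒᵖ}
    (z : (join S' T').obj U)
    (hl : ∀ (V : SimplexCategoryᵒᵖ) (φ : U ⟶ V)
      (h : (join S' T').map φ z ∈ (cutFiber (joinCut S' T') 0).obj V),
      (joinLeft S' T').app V ⟨_, h⟩ ∈ (SSet.Subcomplex.range f).obj V)
    (hr : ∀ (V : SimplexCategoryᵒᵖ) (φ : U ⟶ V)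
      (h : (join S' T').map φ z ∈ (cutFiber (joinCut S' T') 1).obj V),
      (joinRight S' T').app V ⟨_, h⟩ ∈ (SSet.Subcomplex.range g).obj V) :
    z ∈ (SSet.Subcomplex.range (joinMap f g)).obj U := by
  obtain ⟨l, hl'⟩ := exists_factor f (JoinMap.left z) (by
    rintro V ⟨x, hx⟩
    obtain ⟨h', e⟩ := JoinMap.left_app_eq z x hx
    rw [e]
    exact hl V _ h')
  obtain ⟨r, hr'⟩ := exists_factor g (JoinMap.right z) (by
    rintro V ⟨x, hx⟩
    obtain ⟨h', e⟩ := JoinMap.right_app_eq z x hx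
    rw [e]
    exact hr V _ h')
  refine ⟨(⟨JoinMap.cut z, l, r⟩ : JoinMap _ S T), JoinMap.ext' rfl ?_ ?_⟩
  · intro V x h₁ h₂
    exact ConcreteCategory.congr_hom (NatTrans.congr_app hl' V) ⟨x, h₁⟩
  · intro V x h₁ h₂
    exact ConcreteCategory.congr_hom (NatTrans.congr_app hr' V) ⟨x, h₁⟩

lemma mono_of_app_injective {f : X ⟶ Y}
    (h : ∀ U, Function.Injective (f.app U)) : Mono f := by
  rw [NatTrans.mono_iff_mono_app]
  exact fun U => (mono_iff_injective _).2 (h U)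

instance mono_joinMap (f : S ⟶ S') (g : T ⟶ T') [Mono f] [Mono g] : Mono (joinMap f g) :=
  mono_of_app_injective fun U a b e => by
    obtain ⟨χ, l, r⟩ := a
    obtain ⟨χ', l', r'⟩ := b
    obtain rfl : χ = χ' := congrArg JoinMap.cut e
    have e' : (⟨χ, l ≫ f, r ≫ g⟩ : JoinMap _ S' T') = ⟨χ, l' ≫ f, r' ≫ g⟩ := e
    simp only [JoinMap.mk.injEq, heq_eq_eq, true_and] at e'
    rw [cancel_mono, cancel_mono] at e'
    rw [e'.1, e'.2]

instance mono_joinInl : Mono (joinInl S T) :=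
  mono_of_app_injective fun _ a b e =>
    (joinInl_left a (joinInl_mem a)).symm.trans
      ((joinLeft_congr e _ _).trans (joinInl_left b (joinInl_mem b)))

lemma joinInl_joinLeft {U : SimplexCategoryᵒᵖ} (z : (join S T).obj U)
    (h : z ∈ (cutFiber (joinCut S T) 0).obj U) :
    (joinInl S T).app U ((joinLeft S T).app U ⟨z, h⟩) = z := by
  obtain ⟨s, hs⟩ : ∃ s, s = (joinLeft S T).app U ⟨z, h⟩ := ⟨_, rfl⟩
  rw [← hs]
  have hcut : (joinCut S T).app U ((joinInl S T).app U s) = (joinCut S T).app U z :=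
    vx_ext fun i => (((mem_cutFiber _ _ _).1 (joinInl_mem s) i)).trans
      ((mem_cutFiber _ _ _).1 h i).symm
  refine join_ext hcut ?_ ?_
  · intro V f ha hb
    rw [joinLeft_map f _ (joinInl_mem s), joinLeft_map f z h, joinInl_left, hs]
  · intro V f ha hb
    exact (cutFiber_disjoint _ (subcomplex_map_mem _ f h) hb).elim

end JoinRange

/-! ## Initial and final parts of simplices -/

section Parts

variable {X S T : SSet.{u}}

/-- The endomorphism of `[n]` which collapses the vertices before `i`. -/
def tailHom (U : SimplexCategoryᵒᵖ) (i : Fin (U.unop.len + 1)) : U ⟶ U :=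
  Quiver.Hom.op (SimplexCategory.Hom.mk ⟨fun j => max j i, fun _ _ h => max_le_max_right i h⟩)

/-- The endomorphism of `[n]` which collapses the vertices after `i`. -/
def headHom (U : SimplexCategoryᵒᵖ) (i : Fin (U.unop.len + 1)) : U ⟶ U :=
  Quiver.Hom.op (SimplexCategory.Hom.mk ⟨fun j => min j i, fun _ _ h => min_le_min_right i h⟩)

lemma tailHom_vertexHom (U : SimplexCategoryᵒᵖ) {i j : Fin (U.unop.len + 1)} (h : i ≤ j) :
    tailHom U i ≫ vertexHom U j = vertexHom U j := by
  apply Quiver.Hom.unop_inj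
  ext k
  exact congrArg Fin.val (max_eq_left h)

lemma headHom_vertexHom (U : SimplexCategoryᵒᵖ) {i j : Fin (U.unop.len + 1)} (h : j ≤ i) :
    headHom U i ≫ vertexHom U j = vertexHom U j := by
  apply Quiver.Hom.unop_inj
  ext k
  exact congrArg Fin.val (min_eq_left h)

lemma fin_two_le_one (a : Fin 2) : a ≤ 1 := by lia

/-- A monotone sequence in `{0, 1}` stays at `1` once it gets there. The operator `tailHom` replaces
the final face starting at `i` by a degenerate simplex of the original dimension, so vertices keep
their indices. -/
lemma map_tailHom_mem (χ : X ⟶ Δ[1]) {U : SimplexCategoryᵒᵖ} (x : X.obj U)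
    {i : Fin (U.unop.len + 1)} (h : vx (χ.app U x) i = 1) :
    X.map (tailHom U i) x ∈ (cutFiber χ 1).obj U := by
  rw [mem_cutFiber]
  intro j
  rw [NatTrans.naturality_apply, vx_map]
  refine le_antisymm (fin_two_le_one _) (h.symm.le.trans (vx_mono _ ?_))
  exact le_max_right _ _

lemma map_headHom_mem (χ : X ⟶ Δ[1]) {U : SimplexCategoryᵒᵖ} (x : X.obj U)
    {i : Fin (U.unop.len + 1)} (h : vx (χ.app U x) i = 0) :
    X.map (headHom U i) x ∈ (cutFiber χ 0).obj U := by
  rw [mem_cutFiber]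
  intro j
  rw [NatTrans.naturality_apply, vx_map]
  refine le_antisymm ((vx_mono _ ?_).trans h.le) (Fin.zero_le _)
  exact min_le_right _ _

open Classical in
/-- The map from a join to `Δ[1]` which is `0` on the first factor and given on the second. -/
def zeroExt (S : SSet.{u}) (b : T ⟶ Δ[1]) : join S T ⟶ Δ[1] :=
  homOfVx (fun z => if h : z ∈ (cutFiber (joinCut S T) 1).obj _ then
      vx (b.app _ ((joinRight S T).app _ ⟨z, h⟩)) 0 else 0) (by
    intro U x i j hij
    dsimp only
    by_cases hi : (join S T).map (vertexHom U i) x ∈ (cutFiber (joinCut S T) 1).obj _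
    · have hxi : vx ((joinCut S T).app U x) i = 1 :=
        (vx_vertex _ _ _).trans ((mem_cutFiber _ _ _).1 hi 0)
      -- From the vertex `i` on, all vertices lie in one simplex of `T`, so monotonicity is
      -- inherited from `b` on that simplex.
      have key : ∀ k, i ≤ k →
          ∃ hk : (join S T).map (vertexHom U k) x ∈ (cutFiber (joinCut S T) 1).obj _,
          vx (b.app _ ((joinRight S T).app _ ⟨_, hk⟩)) 0 =
          vx ((joinRight S T ≫ b).app _ ⟨_, map_tailHom_mem (joinCut S T) x hxi⟩) k := by
        intro k hk
        have hk' : (join S T).map (vertexHom U k) x =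
            (join S T).map (vertexHom U k) ((join S T).map (tailHom U i) x) := by
          rw [← Functor.map_comp_apply, tailHom_vertexHom U hk]
        have hm := subcomplex_map_mem (cutFiber (joinCut S T) 1) (vertexHom U k)
          (map_tailHom_mem (joinCut S T) x hxi)
        refine ⟨hk' ▸ hm, ?_⟩
        rw [joinRight_congr hk' _ hm]
        exact (vx_vertex (joinRight S T ≫ b)
          ⟨_, map_tailHom_mem (joinCut S T) x hxi⟩ k).symm
      obtain ⟨h₁, e₁⟩ := key i le_rfl
      obtain ⟨h₂, e₂⟩ := key j hij
      rw [dif_pos h₁, dif_pos h₂, e₁, e₂]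
      exact vx_mono _ hij
    · rw [dif_neg hi]
      exact Fin.zero_le _)

open Classical in
/-- The map from a join to `Δ[1]` which is given on the first factor and `1` on the second. -/
def oneExt (b : S ⟶ Δ[1]) (T : SSet.{u}) : join S T ⟶ Δ[1] :=
  homOfVx (fun z => if h : z ∈ (cutFiber (joinCut S T) 0).obj _ then
      vx (b.app _ ((joinLeft S T).app _ ⟨z, h⟩)) 0 else 1) (by
    intro U x i j hij
    dsimp only
    by_cases hj : (join S T).map (vertexHom U j) x ∈ (cutFiber (joinCut S T) 0).obj _
    · have hxj : vx ((joinCut S T).app U x) j = 0 :=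
        (vx_vertex _ _ _).trans ((mem_cutFiber _ _ _).1 hj 0)
      -- Dually, all vertices up to `j` lie in one simplex of `S`.
      have key : ∀ k, k ≤ j →
          ∃ hk : (join S T).map (vertexHom U k) x ∈ (cutFiber (joinCut S T) 0).obj _,
          vx (b.app _ ((joinLeft S T).app _ ⟨_, hk⟩)) 0 =
          vx ((joinLeft S T ≫ b).app _ ⟨_, map_headHom_mem (joinCut S T) x hxj⟩) k := by
        intro k hk
        have hk' : (join S T).map (vertexHom U k) x =
            (join S T).map (vertexHom U k) ((join S T).map (headHom U j) x) := by
          rw [← Functor.map_comp_apply, headHom_vertexHom U hk]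
        have hm := subcomplex_map_mem (cutFiber (joinCut S T) 0) (vertexHom U k)
          (map_headHom_mem (joinCut S T) x hxj)
        refine ⟨hk' ▸ hm, ?_⟩
        rw [joinLeft_congr hk' _ hm]
        exact (vx_vertex (joinLeft S T ≫ b)
          ⟨_, map_headHom_mem (joinCut S T) x hxj⟩ k).symm
      obtain ⟨h₁, e₁⟩ := key i hij
      obtain ⟨h₂, e₂⟩ := key j le_rfl
      rw [dif_pos h₁, dif_pos h₂, e₁, e₂]
      exact vx_mono _ hij
    · rw [dif_neg hj]
      exact fin_two_le_one _)

lemma zeroExt_app (b : T ⟶ Δ[1]) {U : SimplexCategoryᵒᵖ} (z : (join S T).obj U)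
    (h : z ∈ (cutFiber (joinCut S T) 1).obj U) :
    (zeroExt S b).app U z = b.app U ((joinRight S T).app U ⟨z, h⟩) := by
  refine vx_ext fun i => ?_
  have hm := subcomplex_map_mem (cutFiber (joinCut S T) 1) (vertexHom U i) h
  refine (vx_homOfVx _ _ _ _).trans ((dif_pos hm).trans ?_)
  refine Eq.trans ?_ (vx_vertex (joinRight S T ≫ b) ⟨z, h⟩ i).symm
  rfl

lemma oneExt_app (b : S ⟶ Δ[1]) {U : SimplexCategoryᵒᵖ} (z : (join S T).obj U)
    (h : z ∈ (cutFiber (joinCut S T) 0).obj U) :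
    (oneExt b T).app U z = b.app U ((joinLeft S T).app U ⟨z, h⟩) := by
  refine vx_ext fun i => ?_
  have hm := subcomplex_map_mem (cutFiber (joinCut S T) 0) (vertexHom U i) h
  refine (vx_homOfVx _ _ _ _).trans ((dif_pos hm).trans ?_)
  refine Eq.trans ?_ (vx_vertex (joinLeft S T ≫ b) ⟨z, h⟩ i).symm
  rfl

lemma vx_zeroExt (b : T ⟶ Δ[1]) {U : SimplexCategoryᵒᵖ} (z : (join S T).obj U)
    {i : Fin (U.unop.len + 1)} (h : vx ((joinCut S T).app U z) i = 0) :
    vx ((zeroExt S b).app U z) i = 0 := by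
  refine (vx_homOfVx _ _ _ _).trans (dif_neg fun h' => ?_)
  refine absurd (h.symm.trans ((vx_vertex _ _ _).trans ((mem_cutFiber _ _ _).1 h' 0))) zero_ne_one

lemma vx_oneExt (b : S ⟶ Δ[1]) {U : SimplexCategoryᵒᵖ} (z : (join S T).obj U)
    {i : Fin (U.unop.len + 1)} (h : vx ((joinCut S T).app U z) i = 1) :
    vx ((oneExt b T).app U z) i = 1 := by
  refine (vx_homOfVx _ _ _ _).trans (dif_neg fun h' => ?_)
  refine absurd (((vx_vertex _ _ _).trans ((mem_cutFiber _ _ _).1 h' 0)).symm.trans h) zero_ne_one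

end Parts

/-! ## Extending maps over prisms -/

section Prism

lemma mem_boundary_vx {n : ℕ} {U : SimplexCategoryᵒᵖ} (c : (Δ[n] : SSet.{u}).obj U) :
    c ∈ (∂Δ[n] : (Δ[n] : SSet.{u}).Subcomplex).obj U ↔ ∃ j, ∀ i, vx c i ≠ j := by
  induction U using Opposite.rec with
  | op U =>
    induction U using SimplexCategory.rec with
    | _ m =>
      rw [SSet.mem_boundary_iff_notMem_range]
      exact exists_congr fun j => ⟨fun h i e => h ⟨i, e⟩, fun h ⟨i, e⟩ => h i e⟩

lemma mem_horn_vx {n : ℕ} (k : Fin (n + 1)) {U : SimplexCategoryᵒᵖ}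
    (c : (Δ[n] : SSet.{u}).obj U) :
    c ∈ (Λ[n, k] : (Δ[n] : SSet.{u}).Subcomplex).obj U ↔ ∃ j, j ≠ k ∧ ∀ i, vx c i ≠ j := by
  induction U using Opposite.rec with
  | op U =>
    induction U using SimplexCategory.rec with
    | _ m =>
      rw [SSet.mem_horn_iff_notMem_range]
      exact exists_congr fun j => ⟨fun ⟨hj, h⟩ => ⟨hj, fun i e => h ⟨i, e⟩⟩,
        fun ⟨hj, h⟩ => ⟨hj, fun ⟨i, e⟩ => h i e⟩⟩

/-- The part of `Δ[1] ⊗ Δ[1]` below or on the diagonal. -/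
def lePart : (Δ[1] ⊗ Δ[1] : SSet.{u}).Subcomplex where
  obj _ := {z | ∀ i, vx z.1 i ≤ vx z.2 i}
  map f _ hz i := hz (f.unop.toOrderHom i)

/-- The simplices of `Δ[1] ⊗ Δ[1]` whose first component is constant at `0` or whose second
component is constant at `1`. -/
def leEdges : (Δ[1] ⊗ Δ[1] : SSet.{u}).Subcomplex where
  obj _ := {z | (∀ i, vx z.1 i = 0) ∨ ∀ i, vx z.2 i = 1}
  map f _ hz := hz.imp (fun h i => h (f.unop.toOrderHom i)) (fun h i => h (f.unop.toOrderHom i))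

lemma leEdges_le : leEdges.{u} ≤ lePart := by
  rintro U z (h | h) i
  · exact (h i).le.trans (Fin.zero_le _)
  · exact (fin_two_le_one _).trans (h i).symm.le

/-- The pullback to `X ⊗ Δ[1]` of a subcomplex of `Δ[1] ⊗ Δ[1]`. -/
def relPart {X : SSet.{u}} (R : (Δ[1] ⊗ Δ[1] : SSet.{u}).Subcomplex) (χ : X ⟶ Δ[1]) :
    (X ⊗ Δ[1]).Subcomplex :=
  R.preimage (χ ▷ Δ[1])

lemma mem_relPart {X : SSet.{u}} (R : (Δ[1] ⊗ Δ[1] : SSet.{u}).Subcomplex) (χ : X ⟶ Δ[1])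
    {U : SimplexCategoryᵒᵖ} (z : (X ⊗ Δ[1]).obj U) :
    z ∈ (relPart R χ).obj U ↔ (⟨χ.app U z.1, z.2⟩ : (Δ[1] ⊗ Δ[1] : SSet.{u}).obj U) ∈ R.obj U :=
  Iff.rfl

variable {n : ℕ}

/-- A map `Δ[n] ⟶ Δ[1]` is a monotone map `[n] → [1]`, hence a threshold: `p` is the first vertex
with value `1`. -/
lemma vx_hom_stdSimplex (χ : (Δ[n] : SSet.{u}) ⟶ Δ[1]) :
    ∃ p : ℕ, ∀ (U : SimplexCategoryᵒᵖ) (x : (Δ[n] : SSet.{u}).obj U) (i),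
      vx (χ.app U x) i = 0 ↔ (vx x i : ℕ) < p := by
  classical
  let c : Fin (n + 1) → Fin 2 := fun j => vx (χ.app _ (SSet.stdSimplex.obj₀Equiv.symm j)) 0
  have hc : ∀ (U : SimplexCategoryᵒᵖ) (x : (Δ[n] : SSet.{u}).obj U) (i),
      vx (χ.app U x) i = c (vx x i) := by
    intro U x i
    rw [vx_vertex]
    refine congrArg (fun y => vx (χ.app _ y) 0) ?_
    exact vx_ext fun _ => rfl
  have hmono : Monotone c := by
    intro i j hij
    have h := vx_mono (χ.app (Opposite.op ⦋n⦌) (vxMk (U := Opposite.op ⦋n⦌) id monotone_id)) hij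
    rw [hc, hc] at h
    exact h
  by_cases hall : ∀ j, c j = 0
  -- No vertex has value `1`, so the threshold is put beyond the last vertex. The case `p > n` has
  -- to be treated apart when prisms are filled.
  · exact ⟨n + 1, fun U x i => by rw [hc]; simpa [hall] using (vx x i).2⟩
  · push Not at hall
    have hex : ∃ m : ℕ, ∃ h : m < n + 1, c ⟨m, h⟩ ≠ 0 := ⟨hall.choose.1, hall.choose.2,
      hall.choose_spec⟩
    refine ⟨Nat.find hex, fun U x i => ?_⟩
    rw [hc]
    constructor
    · intro h
      by_contra hlt
      obtain ⟨hm, hne⟩ := Nat.find_spec hex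
      exact hne (le_antisymm ((hmono (Fin.mk_le_of_le_val (not_lt.1 hlt))).trans h.le)
        (Fin.zero_le _))
    · intro h
      by_contra hne
      exact Nat.find_min hex h ⟨(vx x i).2, hne⟩

/-- The part of the prism which is filled before adding cells. -/
def prismBase (χ : (Δ[n] : SSet.{u}) ⟶ Δ[1]) : (Δ[n] ⊗ Δ[1] : SSet.{u}).Subcomplex :=
  relPart leEdges χ ⊔ (relPart lePart χ ⊓ (∂Δ[n]).prod ⊤)

/-- A filtration of the prism. -/
def prismFilt (χ : (Δ[n] : SSet.{u}) ⟶ Δ[1]) (a : ℕ) : (Δ[n] ⊗ Δ[1] : SSet.{u}).Subcomplex where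
  obj U := {z | z ∈ (prismBase χ).obj U ∨
    (z ∈ (relPart lePart χ).obj U ∧ ∀ i, vx z.2 i = 0 → (vx z.1 i : ℕ) < a)}
  map f _ hz := hz.imp (fun h => (prismBase χ).map f h)
    (fun h => ⟨(relPart lePart χ).map f h.1, fun i => h.2 (f.unop.toOrderHom i)⟩)

/-- The cells of a prism. -/
def prismCell (a : ℕ) (ha : a ≤ n) : (Δ[n + 1] : SSet.{u}) ⟶ Δ[n] ⊗ Δ[1] where
  app U := ↾fun y =>
    ⟨vxMk (fun i => if h : (vx y i : ℕ) ≤ a then ⟨vx y i, by lia⟩ else ⟨(vx y i : ℕ) - 1, by lia⟩)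
      (by
        intro i j hij
        have := vx_mono y hij
        dsimp only
        split_ifs <;> simp only [Fin.le_def] at this ⊢ <;> lia),
    vxMk (fun i => if (vx y i : ℕ) ≤ a then 0 else 1)
      (by
        intro i j hij
        have := vx_mono y hij
        dsimp only
        split_ifs <;> simp only [Fin.le_def] at this ⊢ <;> lia)⟩
  naturality U V f := rfl

lemma vx_prismCell_fst (a : ℕ) (ha : a ≤ n) {U : SimplexCategoryᵒᵖ}
    (y : (Δ[n + 1] : SSet.{u}).obj U) (i) :
    (vx ((prismCell a ha).app U y).1 i : ℕ) =
      if (vx y i : ℕ) ≤ a then (vx y i : ℕ) else (vx y i : ℕ) - 1 := by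
  change ((if h : (vx y i : ℕ) ≤ a then ⟨vx y i, by lia⟩ else ⟨(vx y i : ℕ) - 1, by lia⟩ :
    Fin (n + 1)) : ℕ) = _
  split_ifs <;> rfl

lemma vx_prismCell_snd (a : ℕ) (ha : a ≤ n) {U : SimplexCategoryᵒᵖ}
    (y : (Δ[n + 1] : SSet.{u}).obj U) (i) :
    vx ((prismCell a ha).app U y).2 i = if (vx y i : ℕ) ≤ a then 0 else 1 := rfl

lemma prismCell_injective (a : ℕ) (ha : a ≤ n) (U : SimplexCategoryᵒᵖ) :
    Function.Injective ((prismCell.{u} a ha).app U) := by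
  intro y y' h
  refine vx_ext fun i => ?_
  have h₁ := vx_prismCell_fst a ha y i
  have h₂ := vx_prismCell_snd a ha y i
  rw [h] at h₁ h₂
  rw [vx_prismCell_fst] at h₁
  rw [vx_prismCell_snd] at h₂
  apply Fin.ext
  split_ifs at h₁ h₂ <;> lia

variable (χ : (Δ[n] : SSet.{u}) ⟶ Δ[1]) {p : ℕ}
  (hp : ∀ (U : SimplexCategoryᵒᵖ) (x : (Δ[n] : SSet.{u}).obj U) (i),
    vx (χ.app U x) i = 0 ↔ (vx x i : ℕ) < p)

include hp in
lemma prismCell_mem (a : ℕ) (ha : a ≤ n) (hap : a < p) {U : SimplexCategoryᵒᵖ}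
    (y : (Δ[n + 1] : SSet.{u}).obj U) :
    (prismCell a ha).app U y ∈ (relPart lePart χ).obj U ∧
      ∀ i, vx ((prismCell a ha).app U y).2 i = 0 →
        (vx ((prismCell a ha).app U y).1 i : ℕ) < a + 1 := by
  refine ⟨fun i => ?_, fun i => ?_⟩
  · change vx (χ.app U ((prismCell a ha).app U y).1) i ≤ vx ((prismCell a ha).app U y).2 i
    have h₁ := vx_prismCell_fst a ha y i
    have h₂ := vx_prismCell_snd a ha y i
    by_cases h : (vx y i : ℕ) ≤ a
    · rw [(hp U _ i).2 (by rw [h₁, if_pos h]; lia)]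
      exact Fin.zero_le _
    · rw [h₂, if_neg h]
      exact fin_two_le_one _
  · rw [vx_prismCell_fst, vx_prismCell_snd]
    split_ifs with h
    · intro _
      lia
    · intro h'
      exact absurd h' (by decide)

-- The cell has the vertices `(0,0), …, (a,0), (a,1), …, (n,1)`. Omitting `(a,0)` leaves a face of
-- the previous stage, and omitting a vertex other than `(a,0)` and `(a,1)` leaves a face over
-- `∂Δ[n]`. The face opposite `(a,1)`, which is vertex `a + 1`, is the only new one: it still
-- contains `(a,0)` and surjects onto `Δ[n]`, and `p ≤ n` keeps it out of the region `χ = 0`.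
include hp in
lemma prismCell_mem_filt (a : ℕ) (ha : a ≤ n) (hap : a < p) (hpn : p ≤ n)
    {U : SimplexCategoryᵒᵖ} (y : (Δ[n + 1] : SSet.{u}).obj U) :
    (prismCell a ha).app U y ∈ (prismFilt χ a).obj U ↔
      y ∈ (Λ[n + 1, ⟨a + 1, by lia⟩] : (Δ[n + 1] : SSet.{u}).Subcomplex).obj U := by
  rw [mem_horn_vx]
  have h₁ := vx_prismCell_fst a ha y
  have h₂ := vx_prismCell_snd a ha y
  constructor
  · rintro (((h | h) | ⟨-, h, -⟩) | ⟨-, h⟩)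
    · refine ⟨⟨n + 1, by lia⟩, by simp only [ne_eq, Fin.mk.injEq]; lia, fun i e => ?_⟩
      have hi : (vx ((prismCell a ha).app U y).1 i : ℕ) < p := (hp U _ i).1 (h i)
      rw [h₁, e] at hi
      simp only at hi
      split_ifs at hi <;> lia
    · refine ⟨⟨0, by lia⟩, by simp, fun i e => ?_⟩
      have hi : vx ((prismCell a ha).app U y).2 i = 1 := h i
      rw [h₂, e] at hi
      simp at hi
    · obtain ⟨j, hj⟩ := (mem_boundary_vx _).1 h
      -- The first coordinate of the cell repeats `a`, so vertices of `Δ[n]` beyond `a` are shifted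
      -- by one.
      refine ⟨⟨if (j : ℕ) ≤ a then j else j + 1, by split_ifs <;> lia⟩, ?_, fun i e => ?_⟩
      · simp only [ne_eq, Fin.mk.injEq]
        split_ifs <;> lia
      · apply hj i
        apply Fin.ext
        rw [h₁, e]
        dsimp only
        split_ifs <;> lia
    · refine ⟨⟨a, by lia⟩, by simp, fun i e => ?_⟩
      have hi := h i (by rw [h₂, e]; simp)
      rw [h₁, e] at hi
      simp at hi
  · rintro ⟨j, hj, h⟩
    have hj' : (j : ℕ) ≠ a + 1 := fun e => hj (Fin.ext e)
    have h' : ∀ i, (vx y i : ℕ) ≠ j := fun i e => h i (Fin.ext e)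
    by_cases hja : (j : ℕ) = a
    · refine Or.inr ⟨(prismCell_mem χ hp a ha hap y).1, fun i hi => ?_⟩
      have := (prismCell_mem χ hp a ha hap y).2 i hi
      have h'' := h' i
      rw [h₂] at hi
      rw [h₁] at this ⊢
      split_ifs at hi this ⊢
      · lia
      · exact absurd hi (by decide)
    · refine Or.inl (Or.inr ⟨(prismCell_mem χ hp a ha hap y).1, ?_, trivial⟩)
      refine (mem_boundary_vx _).2 ⟨⟨if (j : ℕ) ≤ a then j else j - 1, by split_ifs <;> lia⟩,
        fun i e => ?_⟩
      have e' := congrArg Fin.val e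
      rw [h₁] at e'
      have h'' := h' i
      dsimp only at e'
      split_ifs at e' <;> lia

/-- A new simplex has a vertex `(a,0)`. By monotonicity, vertices with first coordinate below `a`
have height `0`; those with first coordinate above `a` have height `1`, since height `0` is allowed
only up to `a`. Such a simplex lies in the cell. -/
lemma mem_prismFilt_succ (a : ℕ) (ha : a ≤ n) {U : SimplexCategoryᵒᵖ}
    (z : (Δ[n] ⊗ Δ[1] : SSet.{u}).obj U) (hz : z ∈ (prismFilt χ (a + 1)).obj U) :
    z ∈ (prismFilt χ a).obj U ∨ ∃ y, (prismCell a ha).app U y = z := by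
  rcases hz with hz | ⟨hz, hlt⟩
  · exact Or.inl (Or.inl hz)
  by_cases hb : z.1 ∈ (∂Δ[n] : (Δ[n] : SSet.{u}).Subcomplex).obj U
  · exact Or.inl (Or.inl (Or.inr ⟨hz, hb, trivial⟩))
  by_cases hlt' : ∀ i, vx z.2 i = 0 → (vx z.1 i : ℕ) < a
  · exact Or.inl (Or.inr ⟨hz, hlt'⟩)
  refine Or.inr ?_
  push Not at hlt'
  obtain ⟨k, hk₀, hk⟩ := hlt'
  have hk' : (vx z.1 k : ℕ) = a := by have := hlt k hk₀; lia
  have hlow : ∀ i, (vx z.1 i : ℕ) < a → vx z.2 i = 0 := by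
    intro i hi
    have hik : i ≤ k := by
      by_contra h
      have := vx_mono z.1 (not_le.1 h).le
      lia
    exact le_antisymm ((vx_mono z.2 hik).trans hk₀.le) (Fin.zero_le _)
  have hhigh : ∀ i, a < (vx z.1 i : ℕ) → vx z.2 i = 1 := by
    intro i hi
    by_contra h
    have := hlt i (by lia)
    lia
  -- On the cell, the sum of the two coordinates is the index of the vertex, which inverts
  -- `prismCell`.
  obtain ⟨y, hy⟩ : ∃ y : (Δ[n + 1] : SSet.{u}).obj U,
      ∀ i, (vx y i : ℕ) = (vx z.1 i : ℕ) + (vx z.2 i : ℕ) := by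
    refine ⟨vxMk (fun i => ⟨(vx z.1 i : ℕ) + (vx z.2 i : ℕ), by lia⟩) ?_, fun i => rfl⟩
    intro i j hij
    have h₁ : (vx z.1 i : ℕ) ≤ vx z.1 j := vx_mono z.1 hij
    have h₂ : (vx z.2 i : ℕ) ≤ vx z.2 j := vx_mono z.2 hij
    exact Fin.mk_le_mk.2 (add_le_add h₁ h₂)
  refine ⟨y, Prod.ext (vx_ext fun i => Fin.ext ?_) (vx_ext fun i => ?_)⟩
  · rw [vx_prismCell_fst]
    have h₁ := hlow i
    have h₂ := hhigh i
    have h₃ := hy i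
    split_ifs <;> lia
  · rw [vx_prismCell_snd]
    have h₁ := hlow i
    have h₂ := hhigh i
    have h₃ := hy i
    split_ifs <;> lia

lemma prismFilt_mono {a b : ℕ} (h : a ≤ b) : prismFilt χ a ≤ prismFilt χ b :=
  fun _ _ hz => hz.imp id fun hz => ⟨hz.1, fun i hi => (hz.2 i hi).trans_le h⟩

-- Each stage is the pushout of the previous one along a single horn, which is inner because `0 < a
-- + 1 < n + 1`; a lift is found on the cell and glued.
include hp in
lemma hasLiftingProperty_prismFilt_succ {L L' : SSet.{u}} (q : L ⟶ L') [SSet.InnerFibration q]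
    (a : ℕ) (hap : a < p) (hpn : p ≤ n) :
    HasLiftingProperty
      (SSet.Subcomplex.homOfLE (prismFilt_mono χ (Nat.le_succ a))) q where
  sq_hasLift := by
    intro t k sq
    have ha : a ≤ n := by lia
    let i : Fin (n + 2) := ⟨a + 1, by lia⟩
    have hi₀ : 0 < i := Fin.lt_def.2 (by simp [i])
    have hin : i < Fin.last (n + 1) := Fin.mk_lt_mk.2 (by lia)
    have hhorn := SSet.innerAnodyneExtensions.horn_ι.{u} hi₀ hin q (SSet.mem_innerFibrations q)
    let τ : (Δ[n + 1] : SSet.{u}) ⟶ (prismFilt χ (a + 1) : SSet.{u}) :=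
      SSet.Subcomplex.lift (prismCell a ha) (by
        rintro U _ ⟨y, rfl⟩
        exact Or.inr (prismCell_mem χ hp a ha hap y))
    let τ' : (Λ[n + 1, i] : SSet.{u}) ⟶ (prismFilt χ a : SSet.{u}) :=
      SSet.Subcomplex.lift (Λ[n + 1, i].ι ≫ prismCell a ha) (by
        rintro U _ ⟨⟨y, hy⟩, rfl⟩
        exact (prismCell_mem_filt χ hp a ha hap hpn y).2 hy)
    have sq' : CommSq (τ' ≫ t) (Λ[n + 1, i].ι) q (τ ≫ k) := ⟨by
      rw [Category.assoc, sq.w]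
      rfl⟩
    obtain ⟨g, hg₁, hg₂⟩ : ∃ g, (Λ[n + 1, i].ι) ≫ g = τ' ≫ t ∧ g ≫ q = τ ≫ k :=
      ⟨sq'.lift, sq'.fac_left, sq'.fac_right⟩
    have hcov : ∀ (U : SimplexCategoryᵒᵖ) (x : (prismFilt χ (a + 1) : SSet.{u}).obj U),
        (∃ z, (SSet.Subcomplex.homOfLE (prismFilt_mono χ (Nat.le_succ a))).app U z = x) ∨
          ∃ y, τ.app U y = x := by
      rintro U ⟨z, hz⟩
      rcases mem_prismFilt_succ χ a ha z hz with h | ⟨y, hy⟩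
      · exact Or.inl ⟨⟨z, h⟩, rfl⟩
      · exact Or.inr ⟨y, Subtype.ext hy⟩
    obtain ⟨m, hm₁, hm₂⟩ := exists_glue
      (SSet.Subcomplex.homOfLE (prismFilt_mono χ (Nat.le_succ a))) τ t g hcov (by
        rintro U ⟨z, hz⟩ ⟨z', hz'⟩ h
        obtain rfl : z = z' := congrArg Subtype.val h
        rfl) (by
        intro U y y' h
        rw [prismCell_injective a ha U (congrArg Subtype.val h)]) (by
        rintro U ⟨z, hz⟩ y h
        have hy : (prismCell a ha).app U y = z := (congrArg Subtype.val h).symm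
        have hy' := (prismCell_mem_filt χ hp a ha hap hpn y).1 (by rw [hy]; exact hz)
        subst hy
        exact (ConcreteCategory.congr_hom (NatTrans.congr_app hg₁ U) ⟨y, hy'⟩).symm)
    refine ⟨⟨m, hm₁, ?_⟩⟩
    ext U x
    obtain ⟨z, rfl⟩ | ⟨y, rfl⟩ := hcov U x
    · have e₁ := ConcreteCategory.congr_hom (NatTrans.congr_app hm₁ U) z
      have e₂ := ConcreteCategory.congr_hom (NatTrans.congr_app sq.w U) z
      exact (congrArg (q.app U) e₁).trans e₂
    · have e₁ := ConcreteCategory.congr_hom (NatTrans.congr_app hm₂ U) y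
      have e₂ := ConcreteCategory.congr_hom (NatTrans.congr_app hg₂ U) y
      exact (congrArg (q.app U) e₁).trans e₂

lemma prismBase_le : prismBase χ ≤ relPart lePart χ :=
  sup_le (fun _ _ h => leEdges_le _ h) inf_le_left

/-- The filtration starts at the base and reaches the whole part after `p` steps: a vertex of height
`0` satisfies `χ = 0`, so its first coordinate is below `p`. -/
lemma hasLiftingProperty_prismBase {L L' : SSet.{u}} (q : L ⟶ L') [SSet.InnerFibration q] :
    HasLiftingProperty (SSet.Subcomplex.homOfLE (prismBase_le χ)) q := by
  obtain ⟨p, hp⟩ := vx_hom_stdSimplex χ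
  have hle : ∀ a, prismBase χ ≤ prismFilt χ a := fun a U z hz => Or.inl hz
  by_cases hpn : p ≤ n
  · have key : ∀ a ≤ p, HasLiftingProperty (SSet.Subcomplex.homOfLE (hle a)) q := by
      intro a
      induction a with
      | zero =>
        intro _
        have : IsIso (SSet.Subcomplex.homOfLE (hle 0)) := by
          have e : prismFilt χ 0 = prismBase χ := by
            refine le_antisymm ?_ (hle 0)
            rintro U z (h | ⟨-, h⟩)
            · exact h
            -- At stage `0` no vertex of height `0` is allowed, so the simplex lies in the end `1`.
            · exact Or.inl (Or.inr fun i => by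
                by_contra h'
                exact absurd (h i (by change ¬ vx z.2 i = 1 at h'; lia)) (by lia))
          exact ⟨SSet.Subcomplex.homOfLE e.le, rfl, rfl⟩
        infer_instance
      | succ a ih =>
        intro h
        have := ih (by lia)
        have := hasLiftingProperty_prismFilt_succ χ hp q a (by lia) hpn
        exact (inferInstance : HasLiftingProperty (SSet.Subcomplex.homOfLE (hle a) ≫
          SSet.Subcomplex.homOfLE (prismFilt_mono χ (Nat.le_succ a))) q)
    have e : prismFilt χ p = relPart lePart χ := by
      refine le_antisymm ?_ ?_
      · rintro U z (h | ⟨h, -⟩)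
        · exact prismBase_le χ _ h
        · exact h
      · intro U z h
        refine Or.inr ⟨h, fun i hi => (hp U _ i).1 ?_⟩
        have := h i
        exact le_antisymm (this.trans hi.le) (Fin.zero_le _)
    have h₁ := key p le_rfl
    have : IsIso (SSet.Subcomplex.homOfLE e.le) := ⟨SSet.Subcomplex.homOfLE e.ge, rfl, rfl⟩
    exact (inferInstance : HasLiftingProperty (SSet.Subcomplex.homOfLE (hle p) ≫
      SSet.Subcomplex.homOfLE e.le) q)
  -- Here `χ` is constant at `0`, and there is nothing to fill.
  · have e : relPart lePart χ ≤ prismBase χ := fun U z _ =>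
      Or.inl (Or.inl fun i => (hp U _ i).2 (by have := (vx z.1 i).2; lia))
    have : IsIso (SSet.Subcomplex.homOfLE (prismBase_le χ)) :=
      ⟨SSet.Subcomplex.homOfLE e, rfl, rfl⟩
    infer_instance

end Prism

/-! ## Extending maps over families of prisms -/

section Pi

variable {X Y : SSet.{u}} (R : (Δ[1] ⊗ Δ[1] : SSet.{u}).Subcomplex) {L : SSet.{u}}

/-- The map induced on the subcomplexes `relPart`. -/
def relMap (φ : Y ⟶ X) (χ : X ⟶ Δ[1]) :
    (relPart R (φ ≫ χ) : SSet.{u}) ⟶ relPart R χ :=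
  SSet.Subcomplex.lift ((relPart R (φ ≫ χ)).ι ≫ φ ▷ Δ[1]) (by
    rintro U _ ⟨z, rfl⟩
    exact z.2)

/-- A map to `Δ[1]`, and a map from the corresponding subcomplex. -/
structure PiData (X L : SSet.{u}) where
  cut : X ⟶ Δ[1]
  map : (relPart R cut : SSet.{u}) ⟶ L

variable {R}

lemma PiData.ext' {a b : PiData R X L} (h : a.cut = b.cut)
    (hl : ∀ (U : SimplexCategoryᵒᵖ) (x : (X ⊗ Δ[1]).obj U) (h₁ : x ∈ (relPart R a.cut).obj U)
      (h₂ : x ∈ (relPart R b.cut).obj U), a.map.app U ⟨x, h₁⟩ = b.map.app U ⟨x, h₂⟩) :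
    a = b := by
  obtain ⟨χ, l⟩ := a
  obtain ⟨χ', l'⟩ := b
  obtain rfl : χ = χ' := h
  obtain rfl : l = l' := by
    ext U x
    exact hl U x.1 x.2 x.2
  rfl

/-- Precomposition with a map. -/
def PiData.precomp (φ : Y ⟶ X) (a : PiData R X L) : PiData R Y L where
  cut := φ ≫ a.cut
  map := relMap R φ a.cut ≫ a.map

lemma PiData.precomp_id (a : PiData R X L) : a.precomp (𝟙 X) = a :=
  PiData.ext' (Category.id_comp _) (fun _ _ _ _ => rfl)

lemma PiData.precomp_comp {Z : SSet.{u}} (a : PiData R X L) (ψ : Z ⟶ Y) (φ : Y ⟶ X) :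
    a.precomp (ψ ≫ φ) = (a.precomp φ).precomp ψ :=
  PiData.ext' (Category.assoc _ _ _) (fun _ _ _ _ => rfl)

variable (R L)

/-- The simplicial set which classifies the maps to `L` from the subcomplexes `relPart R χ`. -/
def piObj : SSet.{u} where
  obj U := PiData R (SSet.stdSimplex.obj U.unop) L
  map f := ↾fun a => a.precomp (SSet.stdSimplex.map f.unop)
  map_id U := by
    ext a
    exact (congrArg (fun φ => a.precomp φ) (SSet.stdSimplex.map_id U.unop)).trans a.precomp_id
  map_comp f g := by
    ext a
    exact (congrArg (fun φ => a.precomp φ) (SSet.stdSimplex.map_comp g.unop f.unop)).trans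
      (a.precomp_comp _ _)

/-- The structure map to `Δ[1]`. -/
def piCut : piObj R L ⟶ Δ[1] where
  app U := ↾fun a => SSet.yonedaEquiv (PiData.cut a)
  naturality U V f := by
    ext a
    exact (SSet.yonedaEquiv_naturality f.unop (PiData.cut a)).symm

/-- The universal map. -/
def piEval : (relPart R (piCut R L) : SSet.{u}) ⟶ L where
  app U := ↾fun z => (PiData.map z.1.1).app U ⟨⟨idSimplex U, z.1.2⟩, z.2⟩
  naturality U V f := by
    ext z
    refine Eq.trans ?_ (NatTrans.naturality_apply (PiData.map z.1.1) f
      ⟨⟨idSimplex U, z.1.2⟩, z.2⟩)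
    exact congrArg ((PiData.map z.1.1).app V) (Subtype.ext (Prod.ext (map_idSimplex f) rfl))

variable {R L}

/-- The map classified by a map to `piObj R L`. -/
def piUncurry (m : X ⟶ piObj R L) {χ : X ⟶ Δ[1]} (h : m ≫ piCut R L = χ) :
    (relPart R χ : SSet.{u}) ⟶ L :=
  SSet.Subcomplex.homOfLE (by subst h; exact le_rfl) ≫ relMap R m (piCut R L) ≫ piEval R L

/-- The map to `piObj R L` which classifies a given map. -/
def piLift (χ : X ⟶ Δ[1]) (l : (relPart R χ : SSet.{u}) ⟶ L) : X ⟶ piObj R L where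
  app U := ↾fun x => (⟨χ, l⟩ : PiData R X L).precomp (SSet.yonedaEquiv (n := U.unop).symm x)
  naturality U V f := by
    ext x
    refine Eq.trans ?_ (PiData.precomp_comp _ _ _)
    exact congrArg (fun φ => (⟨χ, l⟩ : PiData R X L).precomp φ)
      (SSet.yonedaEquiv_symm_naturality_left f.unop x).symm

lemma piLift_cut (χ : X ⟶ Δ[1]) (l : (relPart R χ : SSet.{u}) ⟶ L) :
    piLift χ l ≫ piCut R L = χ := by
  ext U x
  exact congrArg (χ.app U) (yonedaEquiv_symm_app_idSimplex x)

lemma piUncurry_piLift (χ : X ⟶ Δ[1]) (l : (relPart R χ : SSet.{u}) ⟶ L) :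
    piUncurry (piLift χ l) (piLift_cut χ l) = l := by
  ext U z
  exact congrArg (l.app U)
    (Subtype.ext (Prod.ext (yonedaEquiv_symm_app_idSimplex z.1.1) rfl))

lemma pi_ext {U : SimplexCategoryᵒᵖ} {a b : (piObj R L).obj U}
    (hc : (piCut R L).app U a = (piCut R L).app U b)
    (hl : ∀ (V : SimplexCategoryᵒᵖ) (f : U ⟶ V) (e : (Δ[1] : SSet.{u}).obj V)
      (ha : (⟨(piObj R L).map f a, e⟩ : (piObj R L ⊗ Δ[1]).obj V) ∈ (relPart R (piCut R L)).obj V)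
      (hb : (⟨(piObj R L).map f b, e⟩ : (piObj R L ⊗ Δ[1]).obj V) ∈ (relPart R (piCut R L)).obj V),
      (piEval R L).app V ⟨_, ha⟩ = (piEval R L).app V ⟨_, hb⟩) :
    a = b := by
  refine PiData.ext' (SSet.yonedaEquiv.injective hc) ?_
  rintro V ⟨x, e⟩ h₁ h₂
  obtain ⟨y, hy⟩ : ∃ y, y = (SSet.stdSimplex.map (SSet.stdSimplex.objEquiv x)).app V
    (idSimplex.{u} V) := ⟨_, rfl⟩
  obtain rfl : y = x := hy.trans (map_app_idSimplex x)
  have h₁' := (mem_relPart _ _ _).1 h₁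
  have h₂' := (mem_relPart _ _ _).1 h₂
  dsimp only at h₁' h₂'
  rw [hy] at h₁' h₂'
  have := hl V (SSet.stdSimplex.objEquiv y).op e h₁' h₂'
  refine Eq.trans ?_ (this.trans ?_)
  · exact congrArg ((PiData.map a).app V) (Subtype.ext (Prod.ext hy rfl))
  · exact congrArg ((PiData.map b).app V) (Subtype.ext (Prod.ext hy.symm rfl))

attribute [irreducible] piObj piLift piCut piEval

lemma piEval_congr {U : SimplexCategoryᵒᵖ} {a b : (piObj R L).obj U} (h : a = b)
    (e : (Δ[1] : SSet.{u}).obj U)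
    (ha : (⟨a, e⟩ : (piObj R L ⊗ Δ[1]).obj U) ∈ (relPart R (piCut R L)).obj U)
    (hb : (⟨b, e⟩ : (piObj R L ⊗ Δ[1]).obj U) ∈ (relPart R (piCut R L)).obj U) :
    (piEval R L).app U ⟨_, ha⟩ = (piEval R L).app U ⟨_, hb⟩ := by
  subst h
  rfl

lemma mem_relPart_comp {χ : X ⟶ Δ[1]} {U : SimplexCategoryᵒᵖ} {m : Y ⟶ X}
    {χ' : Y ⟶ Δ[1]} (h : m ≫ χ = χ') (x : Y.obj U) (e : (Δ[1] : SSet.{u}).obj U) :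
    (⟨m.app U x, e⟩ : (X ⊗ Δ[1]).obj U) ∈ (relPart R χ).obj U ↔
      (⟨x, e⟩ : (Y ⊗ Δ[1]).obj U) ∈ (relPart R χ').obj U := by
  subst h
  rfl

lemma piUncurry_app (m : X ⟶ piObj R L) {χ : X ⟶ Δ[1]} (h : m ≫ piCut R L = χ)
    {U : SimplexCategoryᵒᵖ} (x : X.obj U) (e : (Δ[1] : SSet.{u}).obj U)
    (hx : (⟨x, e⟩ : (X ⊗ Δ[1]).obj U) ∈ (relPart R χ).obj U) :
    (piUncurry m h).app U ⟨_, hx⟩ =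
      (piEval R L).app U ⟨⟨m.app U x, e⟩, (mem_relPart_comp h x e).2 hx⟩ := rfl

lemma piUncurry_comp (φ : Y ⟶ X) (m : X ⟶ piObj R L) {χ : X ⟶ Δ[1]} (h : m ≫ piCut R L = χ)
    (h' : (φ ≫ m) ≫ piCut R L = φ ≫ χ) :
    piUncurry (φ ≫ m) h' = relMap R φ χ ≫ piUncurry m h := by
  subst h
  rfl

/-- Together with `piLift`, this says that `piObj R L` represents the pairs of a cut `χ` of `X` and
a map to `L` from `relPart R χ`. -/
lemma piHom_ext {m m' : X ⟶ piObj R L} {χ : X ⟶ Δ[1]} (h : m ≫ piCut R L = χ)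
    (h' : m' ≫ piCut R L = χ) (e : piUncurry m h = piUncurry m' h') : m = m' := by
  suffices H : ∀ U x, m.app U x = m'.app U x by
    ext U x
    exact H U x
  intro U x
  refine pi_ext (ConcreteCategory.congr_hom (NatTrans.congr_app (h.trans h'.symm) U) x) ?_
  intro V f e' ha hb
  have k₁ : (piObj R L).map f (m.app U x) = m.app V (X.map f x) :=
    (NatTrans.naturality_apply m f x).symm
  have k₂ : (piObj R L).map f (m'.app U x) = m'.app V (X.map f x) :=
    (NatTrans.naturality_apply m' f x).symm
  have ha' : (⟨m.app V (X.map f x), e'⟩ : (piObj R L ⊗ Δ[1]).obj V) ∈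
      (relPart R (piCut R L)).obj V := k₁ ▸ ha
  have hb' : (⟨m'.app V (X.map f x), e'⟩ : (piObj R L ⊗ Δ[1]).obj V) ∈
      (relPart R (piCut R L)).obj V := k₂ ▸ hb
  have hx := (mem_relPart_comp h _ _).1 ha'
  rw [piEval_congr k₁ e' ha ha', piEval_congr k₂ e' hb hb', ← piUncurry_app m h _ _ hx,
    ← piUncurry_app m' h' _ _ hx, e]

/-! ### The comparison map -/

variable {R₀ : (Δ[1] ⊗ Δ[1] : SSet.{u}).Subcomplex} (hR : R₀ ≤ R) {L' : SSet.{u}} (q : L ⟶ L')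

lemma relPart_mono (hR : R₀ ≤ R) (χ : X ⟶ Δ[1]) : relPart R₀ χ ≤ relPart R χ :=
  fun _ _ h => hR _ h

/-- Restriction. -/
def piRes : piObj R L ⟶ piObj R₀ L :=
  piLift (piCut R L) (SSet.Subcomplex.homOfLE (relPart_mono hR _) ≫ piEval R L)

variable (R) in
/-- Postcomposition. -/
def piPush : piObj R L ⟶ piObj R L' :=
  piLift (piCut R L) (piEval R L ≫ q)

lemma piRes_cut : piRes (L := L) hR ≫ piCut R₀ L = piCut R L := piLift_cut _ _

lemma piPush_cut : piPush R q ≫ piCut R L' = piCut R L := piLift_cut _ _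

lemma comp_piRes_cut {m : X ⟶ piObj R L} {χ : X ⟶ Δ[1]} (h : m ≫ piCut R L = χ) :
    (m ≫ piRes hR) ≫ piCut R₀ L = χ := by rw [Category.assoc, piRes_cut, h]

lemma comp_piPush_cut {m : X ⟶ piObj R L} {χ : X ⟶ Δ[1]} (h : m ≫ piCut R L = χ) :
    (m ≫ piPush R q) ≫ piCut R L' = χ := by rw [Category.assoc, piPush_cut, h]

lemma piUncurry_piRes (m : X ⟶ piObj R L) {χ : X ⟶ Δ[1]} (h : m ≫ piCut R L = χ) :
    piUncurry (m ≫ piRes hR) (comp_piRes_cut hR h) =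
      SSet.Subcomplex.homOfLE (relPart_mono hR _) ≫ piUncurry m h := by
  subst h
  have := piUncurry_piLift (piCut R L)
    (SSet.Subcomplex.homOfLE (relPart_mono hR _) ≫ piEval R L)
  exact congrArg (fun φ => relMap R₀ m (piCut R L) ≫ φ) this

lemma piUncurry_piPush (m : X ⟶ piObj R L) {χ : X ⟶ Δ[1]} (h : m ≫ piCut R L = χ) :
    piUncurry (m ≫ piPush R q) (comp_piPush_cut q h) = piUncurry m h ≫ q := by
  subst h
  have := piUncurry_piLift (piCut R L) (piEval R L ≫ q)
  exact congrArg (fun φ => relMap R m (piCut R L) ≫ φ) this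

/-- Compatible pairs. -/
def piPairs : (piObj R₀ L ⊗ piObj R L').Subcomplex where
  obj U := {z | (piCut R₀ L).app U z.1 = (piCut R L').app U z.2 ∧
    ∀ (V : SimplexCategoryᵒᵖ) (f : U ⟶ V) (e : (Δ[1] : SSet.{u}).obj V)
      (h₀ : (⟨(piObj R₀ L).map f z.1, e⟩ : (piObj R₀ L ⊗ Δ[1]).obj V) ∈
        (relPart R₀ (piCut R₀ L)).obj V)
      (h₁ : (⟨(piObj R L').map f z.2, e⟩ : (piObj R L' ⊗ Δ[1]).obj V) ∈
        (relPart R (piCut R L')).obj V),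
      q.app V ((piEval R₀ L).app V ⟨_, h₀⟩) = (piEval R L').app V ⟨_, h₁⟩}
  map {U V} f z hz := by
    refine ⟨?_, ?_⟩
    · refine (NatTrans.naturality_apply (piCut R₀ L) f z.1).trans
        (Eq.trans ?_ (NatTrans.naturality_apply (piCut R L') f z.2).symm)
      exact congrArg (Δ[1].map f) hz.1
    · intro W g e h₀ h₁
      have k₁ : (piObj R₀ L).map g ((piObj R₀ L).map f z.1) = (piObj R₀ L).map (f ≫ g) z.1 :=
        (Functor.map_comp_apply _ _ _ _).symm
      have k₂ : (piObj R L').map g ((piObj R L').map f z.2) = (piObj R L').map (f ≫ g) z.2 :=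
        (Functor.map_comp_apply _ _ _ _).symm
      have h₀' : (⟨(piObj R₀ L).map (f ≫ g) z.1, e⟩ : (piObj R₀ L ⊗ Δ[1]).obj W) ∈
        (relPart R₀ (piCut R₀ L)).obj W := k₁ ▸ h₀
      have h₁' : (⟨(piObj R L').map (f ≫ g) z.2, e⟩ : (piObj R L' ⊗ Δ[1]).obj W) ∈
        (relPart R (piCut R L')).obj W := k₂ ▸ h₁
      refine Eq.trans ?_ ((hz.2 W (f ≫ g) e h₀' h₁').trans ?_)
      · exact congrArg (q.app W) (piEval_congr k₁ e h₀ h₀')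
      · exact (piEval_congr k₂ e h₁ h₁').symm

/-- `piPairs q` plays the role of the fibre product of `piObj R₀ L` and `piObj R L'` over `piObj R₀
L'`: a map into it is a cut together with a commutative square from `relPart R₀ χ ≤ relPart R χ` to
`q`. -/
lemma lift_mem_piPairs (b₀ : X ⟶ piObj R₀ L) (b₁ : X ⟶ piObj R L') {χ : X ⟶ Δ[1]}
    (h₀ : b₀ ≫ piCut R₀ L = χ) (h₁ : b₁ ≫ piCut R L' = χ)
    (h : piUncurry b₀ h₀ ≫ q = SSet.Subcomplex.homOfLE (relPart_mono hR _) ≫ piUncurry b₁ h₁)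
    {U : SimplexCategoryᵒᵖ} (x : X.obj U) :
    (⟨b₀.app U x, b₁.app U x⟩ : (piObj R₀ L ⊗ piObj R L').obj U) ∈ (piPairs q).obj U := by
  refine ⟨ConcreteCategory.congr_hom (NatTrans.congr_app (h₀.trans h₁.symm) U) x, ?_⟩
  intro V f e hm₀ hm₁
  have k₁ : (piObj R₀ L).map f (b₀.app U x) = b₀.app V (X.map f x) :=
    (NatTrans.naturality_apply b₀ f x).symm
  have k₂ : (piObj R L').map f (b₁.app U x) = b₁.app V (X.map f x) :=
    (NatTrans.naturality_apply b₁ f x).symm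
  have hm₀' : (⟨b₀.app V (X.map f x), e⟩ : (piObj R₀ L ⊗ Δ[1]).obj V) ∈
      (relPart R₀ (piCut R₀ L)).obj V := k₁ ▸ hm₀
  have hm₁' : (⟨b₁.app V (X.map f x), e⟩ : (piObj R L' ⊗ Δ[1]).obj V) ∈
      (relPart R (piCut R L')).obj V := k₂ ▸ hm₁
  have hx₀ := (mem_relPart_comp h₀ _ _).1 hm₀'
  have hx₁ := (mem_relPart_comp h₁ _ _).1 hm₁'
  refine (congrArg (q.app V) (piEval_congr k₁ e hm₀ hm₀')).trans
    (Eq.trans ?_ (piEval_congr k₂ e hm₁ hm₁').symm)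
  rw [← piUncurry_app b₀ h₀ _ _ hx₀, ← piUncurry_app b₁ h₁ _ _ hx₁]
  exact ConcreteCategory.congr_hom (NatTrans.congr_app h V) ⟨_, hx₀⟩

lemma piPairs_uncurry (b₀ : X ⟶ piObj R₀ L) (b₁ : X ⟶ piObj R L')
    (hb : ∀ U (x : X.obj U), (⟨b₀.app U x, b₁.app U x⟩ : (piObj R₀ L ⊗ piObj R L').obj U) ∈
      (piPairs q).obj U) {χ : X ⟶ Δ[1]}
    (h₀ : b₀ ≫ piCut R₀ L = χ) (h₁ : b₁ ≫ piCut R L' = χ) :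
    piUncurry b₀ h₀ ≫ q = SSet.Subcomplex.homOfLE (relPart_mono hR _) ≫ piUncurry b₁ h₁ := by
  suffices H : ∀ U x e (hx : (⟨x, e⟩ : (X ⊗ Δ[1]).obj U) ∈ (relPart R₀ χ).obj U),
      q.app U ((piUncurry b₀ h₀).app U ⟨_, hx⟩) =
        (piUncurry b₁ h₁).app U ⟨_, relPart_mono hR χ _ hx⟩ by
    ext U ⟨⟨x, e⟩, hx⟩
    exact H U x e hx
  intro U x e hx
  rw [piUncurry_app, piUncurry_app]
  have k₁ : (piObj R₀ L).map (𝟙 U) (b₀.app U x) = b₀.app U x :=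
    Functor.map_id_apply _ _ _
  have k₂ : (piObj R L').map (𝟙 U) (b₁.app U x) = b₁.app U x :=
    Functor.map_id_apply _ _ _
  have hm₀ := (mem_relPart_comp h₀ _ _).2 hx
  have hm₁ := (mem_relPart_comp h₁ _ _).2 (relPart_mono hR χ _ hx)
  have hm₀' : (⟨(piObj R₀ L).map (𝟙 U) (b₀.app U x), e⟩ : (piObj R₀ L ⊗ Δ[1]).obj U) ∈
      (relPart R₀ (piCut R₀ L)).obj U := k₁.symm ▸ hm₀
  have hm₁' : (⟨(piObj R L').map (𝟙 U) (b₁.app U x), e⟩ : (piObj R L' ⊗ Δ[1]).obj U) ∈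
      (relPart R (piCut R L')).obj U := k₂.symm ▸ hm₁
  rw [← piEval_congr k₁ e hm₀' hm₀, ← piEval_congr k₂ e hm₁' hm₁]
  -- The condition on a pair ranges over all operators out of `U`; the identity is the relevant one
  -- here.
  exact (hb U x).2 U (𝟙 U) e hm₀' hm₁'

end Pi

/-! ### Transposing extension problems on parts of cylinders -/

section PiFill

variable {X Y : SSet.{u}} {R R₀ : (Δ[1] ⊗ Δ[1] : SSet.{u}).Subcomplex} (hR : R₀ ≤ R)
  {L L' : SSet.{u}} (q : L ⟶ L')

lemma piRes_piPush (m : X ⟶ piObj R L) {χ : X ⟶ Δ[1]} (h : m ≫ piCut R L = χ) :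
    piUncurry (m ≫ piRes hR) (comp_piRes_cut hR h) ≫ q =
      SSet.Subcomplex.homOfLE (relPart_mono hR _) ≫
        piUncurry (m ≫ piPush R q) (comp_piPush_cut q h) := by
  rw [piUncurry_piRes hR m h, piUncurry_piPush q m h, Category.assoc]

/-- The comparison map. -/
def piComp : piObj R L ⟶ (piPairs (R := R) (R₀ := R₀) q : SSet.{u}) :=
  SSet.Subcomplex.lift (lift (piRes hR) (piPush R q)) (by
    rintro U _ ⟨x, rfl⟩
    exact lift_mem_piPairs hR q (𝟙 _ ≫ piRes hR) (𝟙 _ ≫ piPush R q) _ _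
      (piRes_piPush hR q (𝟙 _) rfl) x)

/-- The domain of the extension problems. -/
def relBase (R R₀ : (Δ[1] ⊗ Δ[1] : SSet.{u}).Subcomplex) (χ : X ⟶ Δ[1]) (X₀ : X.Subcomplex) :
    (X ⊗ Δ[1]).Subcomplex :=
  relPart R₀ χ ⊔ (relPart R χ ⊓ X₀.prod ⊤)

lemma relBase_le (hR : R₀ ≤ R) (χ : X ⟶ Δ[1]) (X₀ : X.Subcomplex) :
    relBase R R₀ χ X₀ ≤ relPart R χ :=
  sup_le (relPart_mono hR χ) inf_le_left

/-- Restriction to a subcomplex. -/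
def relInf (χ : X ⟶ Δ[1]) (X₀ : X.Subcomplex) :
    (relPart R χ ⊓ X₀.prod ⊤ : (X ⊗ Δ[1]).Subcomplex).toSSet ⟶ relPart R (X₀.ι ≫ χ) where
  app _ := ↾fun z => ⟨⟨⟨z.1.1, z.2.2.1⟩, z.1.2⟩, z.2.1⟩
  naturality _ _ _ := rfl

/-- Extension from a subcomplex. -/
def relIncl (χ : X ⟶ Δ[1]) (X₀ : X.Subcomplex) :
    (relPart R (X₀.ι ≫ χ) : SSet.{u}) ⟶ (relPart R χ ⊓ X₀.prod ⊤ : (X ⊗ Δ[1]).Subcomplex).toSSet where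
  app _ := ↾fun z => ⟨⟨z.1.1.1, z.1.2⟩, z.2, z.1.1.2, trivial⟩
  naturality _ _ _ := rfl

/-- Transposition: a square from `X₀.ι` to `piComp` consists of a cut `χ`, a map on `relPart R₀ χ`,
a map on the part of `relPart R χ` over `X₀`, and a compatible map from `relPart R χ` to `L'`. This
is exactly a square from `relBase` to `q`. -/
lemma piComp_hasLift (X₀ : X.Subcomplex)
    (H : ∀ χ : X ⟶ Δ[1], HasLiftingProperty (SSet.Subcomplex.homOfLE (relBase_le hR χ X₀)) q) :
    HasLiftingProperty X₀.ι (piComp hR q) where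
  sq_hasLift := by
    intro s b sq
    obtain ⟨b₀, hb₀⟩ : ∃ b₀, b₀ = b ≫ (piPairs q).ι ≫ fst _ _ := ⟨_, rfl⟩
    obtain ⟨b₁, hb₁⟩ : ∃ b₁, b₁ = b ≫ (piPairs q).ι ≫ snd _ _ := ⟨_, rfl⟩
    have hb : ∀ U (x : X.obj U), (⟨b₀.app U x, b₁.app U x⟩ : (piObj R₀ L ⊗ piObj R L').obj U) ∈
        (piPairs q).obj U := by
      subst hb₀ hb₁
      exact fun U x => (b.app U x).2
    have hs₀ : s ≫ piRes hR = X₀.ι ≫ b₀ := by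
      subst hb₀
      exact sq.w =≫ ((piPairs q).ι ≫ fst _ _)
    have hs₁ : s ≫ piPush R q = X₀.ι ≫ b₁ := by
      subst hb₁
      exact sq.w =≫ ((piPairs q).ι ≫ snd _ _)
    obtain ⟨χ, h₀⟩ : ∃ χ, b₀ ≫ piCut R₀ L = χ := ⟨_, rfl⟩
    have h₁ : b₁ ≫ piCut R L' = χ := by
      rw [← h₀]
      ext U x
      exact (hb U x).1.symm
    have hu := piPairs_uncurry hR q b₀ b₁ hb h₀ h₁
    have hs : s ≫ piCut R L = X₀.ι ≫ χ := by
      rw [← piRes_cut hR, ← Category.assoc, hs₀, Category.assoc, h₀]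
    have e₀ := piUncurry_piRes hR s hs
    have e₁ := piUncurry_piPush q s hs
    have e₀' : piUncurry (s ≫ piRes hR) (comp_piRes_cut hR hs) = relMap R₀ X₀.ι χ ≫
        piUncurry b₀ h₀ := by
      subst h₀
      simp only [hs₀]
      rfl
    have e₁' : piUncurry (s ≫ piPush R q) (comp_piPush_cut q hs) = relMap R X₀.ι χ ≫
        piUncurry b₁ h₁ := by
      subst h₁
      simp only [hs₁]
      rfl
    rw [e₀'] at e₀
    rw [e₁'] at e₁
    obtain ⟨t, ht₁, ht₂⟩ := exists_glue_sup (relPart R₀ χ) (relPart R χ ⊓ X₀.prod ⊤)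
      (piUncurry b₀ h₀) (relInf χ X₀ ≫ piUncurry s hs) (by
        intro U x hS hT
        exact ConcreteCategory.congr_hom (NatTrans.congr_app e₀ U)
          ⟨⟨⟨x.1, hT.2.1⟩, x.2⟩, hS⟩)
    have sq' : CommSq (t : (relBase R R₀ χ X₀ : SSet.{u}) ⟶ L)
        (SSet.Subcomplex.homOfLE (relBase_le hR χ X₀)) q (piUncurry b₁ h₁) := ⟨by
      ext U ⟨x, hx | hx⟩
      · have k₁ := ConcreteCategory.congr_hom (NatTrans.congr_app ht₁ U) ⟨x, hx⟩
        have k₂ := ConcreteCategory.congr_hom (NatTrans.congr_app hu U) ⟨x, hx⟩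
        exact (congrArg (q.app U) k₁).trans k₂
      · have k₁ := ConcreteCategory.congr_hom (NatTrans.congr_app ht₂ U) ⟨x, hx⟩
        have k₂ := ConcreteCategory.congr_hom (NatTrans.congr_app e₁ U)
          ⟨⟨⟨x.1, hx.2.1⟩, x.2⟩, hx.1⟩
        exact (congrArg (q.app U) k₁).trans k₂.symm⟩
    obtain ⟨⟨g, hl, hr⟩⟩ := ((H χ).sq_hasLift sq').exists_lift
    have m₁ : X₀.ι ≫ piLift χ g = s := by
      refine piHom_ext (by rw [Category.assoc, piLift_cut]) hs ?_
      rw [piUncurry_comp X₀.ι (piLift χ g) (piLift_cut χ g), piUncurry_piLift]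
      exact (congrArg (fun φ => relIncl χ X₀ ≫ SSet.Subcomplex.homOfLE le_sup_right ≫ φ) hl).trans
        (congrArg (fun φ => relIncl χ X₀ ≫ φ) ht₂)
    have m₂ : piLift χ g ≫ piRes hR = b₀ := by
      refine piHom_ext (comp_piRes_cut hR (piLift_cut χ g)) h₀ ?_
      rw [piUncurry_piRes hR _ (piLift_cut χ g), piUncurry_piLift]
      exact (congrArg (fun φ => SSet.Subcomplex.homOfLE le_sup_left ≫ φ) hl).trans ht₁
    have m₃ : piLift χ g ≫ piPush R q = b₁ := by
      refine piHom_ext (comp_piPush_cut q (piLift_cut χ g)) h₁ ?_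
      rw [piUncurry_piPush q _ (piLift_cut χ g), piUncurry_piLift, hr]
    refine ⟨⟨piLift χ g, m₁, ?_⟩⟩
    rw [← cancel_mono (piPairs q).ι]
    refine CartesianMonoidalCategory.hom_ext _ _ ?_ ?_
    · exact m₂.trans hb₀
    · exact m₃.trans hb₁

/-- The transposition in the other direction, now for one fixed cut. -/
lemma hasLift_of_piComp (X₀ : X.Subcomplex) [HasLiftingProperty X₀.ι (piComp hR q)]
    (χ : X ⟶ Δ[1]) : HasLiftingProperty (SSet.Subcomplex.homOfLE (relBase_le hR χ X₀)) q where
  sq_hasLift := by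
    intro t k sq
    let t₀ : (relPart R₀ χ : SSet.{u}) ⟶ L := SSet.Subcomplex.homOfLE le_sup_left ≫ t
    let t₁ : (relPart R (X₀.ι ≫ χ) : SSet.{u}) ⟶ L :=
      relIncl χ X₀ ≫ SSet.Subcomplex.homOfLE le_sup_right ≫ t
    have ht₀ : t₀ ≫ q = SSet.Subcomplex.homOfLE (relPart_mono hR χ) ≫ k :=
      congrArg (fun φ => SSet.Subcomplex.homOfLE le_sup_left ≫ φ) sq.w
    have ht₁ : t₁ ≫ q = relMap R X₀.ι χ ≫ k :=
      congrArg (fun φ => relIncl χ X₀ ≫ SSet.Subcomplex.homOfLE le_sup_right ≫ φ) sq.w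
    let b : X ⟶ (piPairs (R := R) (R₀ := R₀) q : SSet.{u}) :=
      SSet.Subcomplex.lift (lift (piLift χ t₀) (piLift χ k)) (by
        rintro U _ ⟨x, rfl⟩
        exact lift_mem_piPairs hR q (piLift χ t₀) (piLift χ k) (piLift_cut _ _) (piLift_cut _ _)
          (by rw [piUncurry_piLift, piUncurry_piLift, ht₀]) x)
    have e₀ : piLift (X₀.ι ≫ χ) t₁ ≫ piRes hR = X₀.ι ≫ piLift χ t₀ := by
      refine piHom_ext (comp_piRes_cut hR (piLift_cut _ _))
        (by rw [Category.assoc, piLift_cut]) ?_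
      rw [piUncurry_piRes hR _ (piLift_cut _ _), piUncurry_piLift,
        piUncurry_comp X₀.ι (piLift χ t₀) (piLift_cut χ t₀), piUncurry_piLift]
      rfl
    have e₁ : piLift (X₀.ι ≫ χ) t₁ ≫ piPush R q = X₀.ι ≫ piLift χ k := by
      refine piHom_ext (comp_piPush_cut q (piLift_cut _ _))
        (by rw [Category.assoc, piLift_cut]) ?_
      rw [piUncurry_piPush q _ (piLift_cut _ _), piUncurry_piLift,
        piUncurry_comp X₀.ι (piLift χ k) (piLift_cut χ k), piUncurry_piLift, ht₁]
    have sq' : CommSq (piLift (X₀.ι ≫ χ) t₁) X₀.ι (piComp hR q) b := ⟨by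
      rw [← cancel_mono (piPairs q).ι]
      exact CartesianMonoidalCategory.hom_ext _ _ e₀ e₁⟩
    have hl := sq'.fac_left
    have hr := sq'.fac_right
    generalize sq'.lift = m at hl hr
    have hr₀ : m ≫ piRes hR = piLift χ t₀ := hr =≫ ((piPairs q).ι ≫ fst _ _)
    have hr₁ : m ≫ piPush R q = piLift χ k := hr =≫ ((piPairs q).ι ≫ snd _ _)
    have hm : m ≫ piCut R L = χ := by
      rw [← piPush_cut q, ← Category.assoc, hr₁, piLift_cut]
    have f₀ := piUncurry_piRes hR m hm
    simp only [hr₀, piUncurry_piLift] at f₀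
    have f₁ := piUncurry_piPush q m hm
    simp only [hr₁, piUncurry_piLift] at f₁
    have f₂ : relMap R X₀.ι χ ≫ piUncurry m hm = t₁ := by
      rw [← piUncurry_comp X₀.ι m hm (by rw [Category.assoc, hm])]
      simp only [hl, piUncurry_piLift]
    refine ⟨⟨piUncurry m hm, ?_, f₁.symm⟩⟩
    ext U ⟨x, hx | hx⟩
    · exact (ConcreteCategory.congr_hom (NatTrans.congr_app f₀ U) ⟨x, hx⟩).symm
    · exact ConcreteCategory.congr_hom (NatTrans.congr_app f₂ U)
          ⟨⟨⟨x.1, hx.2.1⟩, x.2⟩, hx.1⟩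

/-- Extension of maps along the inclusion of the part of `X ⊗ Δ[1]` where the second coordinate
is bounded below by `χ`. -/
lemma hasLiftingProperty_relBase [SSet.InnerFibration q] (χ : X ⟶ Δ[1]) (X₀ : X.Subcomplex) :
    HasLiftingProperty (SSet.Subcomplex.homOfLE (relBase_le leEdges_le χ X₀)) q := by
  have h : (MorphismProperty.monomorphisms SSet.{u}).rlp (piComp leEdges_le q) := by
    -- Boundary inclusions suffice, and for these the transposed problem is the prism.
    rw [SSet.rlp_monomorphisms]
    rintro _ _ _ ⟨n⟩
    exact piComp_hasLift leEdges_le q _ fun χ => hasLiftingProperty_prismBase χ q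
  have := h X₀.ι (MorphismProperty.monomorphisms.infer_property _)
  exact hasLift_of_piComp leEdges_le q X₀ χ

end PiFill

/-! ## Decomposing a cylinder on a join -/

section Step

variable {W S T : SSet.{u}}

lemma join_hom_ext {a b : W ⟶ join S T} (hc : a ≫ joinCut S T = b ≫ joinCut S T)
    (hl : ∀ (U : SimplexCategoryᵒᵖ) (w : W.obj U)
      (ha : a.app U w ∈ (cutFiber (joinCut S T) 0).obj U)
      (hb : b.app U w ∈ (cutFiber (joinCut S T) 0).obj U),
      (joinLeft S T).app U ⟨_, ha⟩ = (joinLeft S T).app U ⟨_, hb⟩)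
    (hr : ∀ (U : SimplexCategoryᵒᵖ) (w : W.obj U)
      (ha : a.app U w ∈ (cutFiber (joinCut S T) 1).obj U)
      (hb : b.app U w ∈ (cutFiber (joinCut S T) 1).obj U),
      (joinRight S T).app U ⟨_, ha⟩ = (joinRight S T).app U ⟨_, hb⟩) : a = b := by
  suffices H : ∀ U w, a.app U w = b.app U w by
    ext U w
    exact H U w
  intro U w
  refine join_ext (ConcreteCategory.congr_hom (NatTrans.congr_app hc U) w) ?_ ?_
  · intro V f ha hb
    have k₁ : (join S T).map f (a.app U w) = a.app V (W.map f w) :=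
      (NatTrans.naturality_apply a f w).symm
    have k₂ : (join S T).map f (b.app U w) = b.app V (W.map f w) :=
      (NatTrans.naturality_apply b f w).symm
    rw [joinLeft_congr k₁ ha (k₁ ▸ ha), joinLeft_congr k₂ hb (k₂ ▸ hb)]
    exact hl _ _ _ _
  · intro V f ha hb
    have k₁ : (join S T).map f (a.app U w) = a.app V (W.map f w) :=
      (NatTrans.naturality_apply a f w).symm
    have k₂ : (join S T).map f (b.app U w) = b.app V (W.map f w) :=
      (NatTrans.naturality_apply b f w).symm
    rw [joinRight_congr k₁ ha (k₁ ▸ ha), joinRight_congr k₂ hb (k₂ ▸ hb)]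
    exact hr _ _ _ _

lemma mem_cutFiber_zero_of_oneExt (b : S ⟶ Δ[1]) {U : SimplexCategoryᵒᵖ} {z : (join S T).obj U}
    (h : z ∈ (cutFiber (oneExt b T) 0).obj U) : z ∈ (cutFiber (joinCut S T) 0).obj U := by
  rw [mem_cutFiber] at h ⊢
  intro i
  by_contra hi
  exact absurd ((h i).symm.trans (vx_oneExt b z (by lia))) zero_ne_one

lemma mem_cutFiber_one_of_zeroExt (b : T ⟶ Δ[1]) {U : SimplexCategoryᵒᵖ} {z : (join S T).obj U}
    (h : z ∈ (cutFiber (zeroExt S b) 1).obj U) : z ∈ (cutFiber (joinCut S T) 1).obj U := by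
  rw [mem_cutFiber] at h ⊢
  intro i
  by_contra hi
  exact absurd ((vx_zeroExt b z (by lia)).symm.trans (h i)) zero_ne_one

lemma joinLeft_mem_of_oneExt (b : S ⟶ Δ[1]) {U : SimplexCategoryᵒᵖ} {z : (join S T).obj U}
    (h : z ∈ (cutFiber (joinCut S T) 0).obj U) (ε : Fin 2) :
    (joinLeft S T).app U ⟨z, h⟩ ∈ (cutFiber b ε).obj U ↔ z ∈ (cutFiber (oneExt b T) ε).obj U := by
  rw [mem_cutFiber, mem_cutFiber, oneExt_app b z h]

lemma joinRight_mem_of_zeroExt (b : T ⟶ Δ[1]) {U : SimplexCategoryᵒᵖ} {z : (join S T).obj U}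
    (h : z ∈ (cutFiber (joinCut S T) 1).obj U) (ε : Fin 2) :
    (joinRight S T).app U ⟨z, h⟩ ∈ (cutFiber b ε).obj U ↔
      z ∈ (cutFiber (zeroExt S b) ε).obj U := by
  rw [mem_cutFiber, mem_cutFiber, zeroExt_app b z h]

variable (J B : SSet.{u})

instance {U : SimplexCategoryᵒᵖ} : Subsingleton ((Δ[0] : SSet.{u}).obj U) :=
  ⟨fun _ _ => vx_ext fun _ => Fin.ext (by lia)⟩

/-- The map to a point. -/
def toPoint (W : SSet.{u}) : W ⟶ Δ[0] where
  app _ := ↾fun _ => vxMk (fun _ => 0) monotone_const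
  naturality _ _ _ := rfl

/-- The map from `(J ⋆ Δ[0]) ⋆ T` to `J ⋆ Δ[0]` which collapses `Δ[0] ⋆ T`. -/
def coneProj (T : SSet.{u}) : join (rightCone J) T ⟶ rightCone J :=
  joinLift (oneExt (joinCut J Δ[0]) T)
    { app := fun U => ↾fun z => (joinLeft J Δ[0]).app U
        ⟨(joinLeft (rightCone J) T).app U ⟨z.1, mem_cutFiber_zero_of_oneExt _ z.2⟩,
          (joinLeft_mem_of_oneExt _ _ 0).2 z.2⟩
      naturality := fun U V f => by
        ext z
        have k₁ := joinLeft_map f z.1 (mem_cutFiber_zero_of_oneExt _ z.2)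
          (subcomplex_map_mem _ f (mem_cutFiber_zero_of_oneExt _ z.2))
        refine (joinLeft_congr k₁ ((joinLeft_mem_of_oneExt _ _ 0).2 (subcomplex_map_mem _ f z.2))
          (subcomplex_map_mem _ f ((joinLeft_mem_of_oneExt _ _ 0).2 z.2))).trans ?_
        exact joinLeft_map f _ _ _ }
    (toPoint _)

lemma coneProj_cut (T : SSet.{u}) :
    coneProj J T ≫ joinCut J Δ[0] = oneExt (joinCut J Δ[0]) T := joinLift_cut _ _ _

lemma coneProj_left (T : SSet.{u}) {U : SimplexCategoryᵒᵖ} (z : (join (rightCone J) T).obj U)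
    (h₁ : (coneProj J T).app U z ∈ (cutFiber (joinCut J Δ[0]) 0).obj U)
    (h₂ : z ∈ (cutFiber (joinCut (rightCone J) T) 0).obj U)
    (h₃ : (joinLeft (rightCone J) T).app U ⟨z, h₂⟩ ∈ (cutFiber (joinCut J Δ[0]) 0).obj U) :
    (joinLeft J Δ[0]).app U ⟨_, h₁⟩ = (joinLeft J Δ[0]).app U ⟨_, h₃⟩ := by
  have h : z ∈ (cutFiber (oneExt (joinCut J Δ[0]) T) 0).obj U :=
    (joinLeft_mem_of_oneExt _ h₂ 0).1 h₃
  exact joinLift_left _ _ _ z h h₁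

attribute [irreducible] coneProj

/-- The map from `(J ⋆ Δ[0]) ⋆ B` to `Δ[1]` which is `0` on `J` only. -/
abbrev baseCut : join (rightCone J) B ⟶ Δ[1] := oneExt (joinCut J Δ[0]) B

/-- The two cuts of `J ⋆ Δ[0] ⋆ B` differ only at the cone point, which `baseCut` puts on the side
of `B`. -/
lemma vx_joinCut_le_baseCut {U : SimplexCategoryᵒᵖ} (x : (join (rightCone J) B).obj U) (i) :
    vx ((joinCut (rightCone J) B).app U x) i ≤ vx ((baseCut J B).app U x) i := by
  by_cases h : vx ((joinCut (rightCone J) B).app U x) i = 0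
  · exact h.le.trans (Fin.zero_le _)
  · rw [vx_oneExt _ _ (by lia)]
    exact fin_two_le_one _

/-- The part of the cylinder on `(J ⋆ Δ[0]) ⋆ B` where the second coordinate is bounded above. -/
def upperPart : (join (rightCone J) B ⊗ Δ[1]).Subcomplex where
  obj U := {z | ∀ i, vx z.2 i ≤ vx ((baseCut J B).app U z.1) i}
  map {U V} f z hz i := by
    have : (baseCut J B).app V ((join (rightCone J) B).map f z.1) =
        Δ[1].map f ((baseCut J B).app U z.1) := NatTrans.naturality_apply _ _ _
    change vx z.2 (f.unop.toOrderHom i) ≤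
      vx ((baseCut J B).app V ((join (rightCone J) B).map f z.1)) i
    rw [this]
    exact hz (f.unop.toOrderHom i)

/-- The join of the second coordinate and the cut. -/
def upperCut : (upperPart J B : SSet.{u}) ⟶ Δ[1] where
  app U := ↾fun z => vxMk (fun i => max (vx z.1.2 i) (vx ((joinCut (rightCone J) B).app U z.1.1) i))
    (fun _ _ h => max_le_max (vx_mono _ h) (vx_mono _ h))
  naturality U V f := by
    ext z
    have : (joinCut (rightCone J) B).app V ((join (rightCone J) B).map f z.1.1) =
        Δ[1].map f ((joinCut (rightCone J) B).app U z.1.1) := NatTrans.naturality_apply _ _ _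
    refine vx_ext fun i => ?_
    change max (vx z.1.2 (f.unop.toOrderHom i))
      (vx ((joinCut (rightCone J) B).app V ((join (rightCone J) B).map f z.1.1)) i) = _
    rw [this]
    rfl

lemma vx_upperCut {U : SimplexCategoryᵒᵖ} (z : (upperPart J B : SSet.{u}).obj U) (i) :
    vx ((upperCut J B).app U z) i =
      max (vx z.1.2 i) (vx ((joinCut (rightCone J) B).app U z.1.1) i) := rfl

lemma upperCut_eq_zero {U : SimplexCategoryᵒᵖ} {z : (upperPart J B : SSet.{u}).obj U} {i} :
    vx ((upperCut J B).app U z) i = 0 ↔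
      vx z.1.2 i = 0 ∧ vx ((joinCut (rightCone J) B).app U z.1.1) i = 0 := by
  rw [vx_upperCut]
  exact max_eq_bot

lemma upperCut_zero_mem {U : SimplexCategoryᵒᵖ} {z : (upperPart J B : SSet.{u}).obj U}
    (h : z ∈ (cutFiber (upperCut J B) 0).obj U) :
    z.1.1 ∈ (cutFiber (joinCut (rightCone J) B) 0).obj U :=
  (mem_cutFiber _ _ _).2 fun i => (upperCut_eq_zero J B |>.1 ((mem_cutFiber _ _ _).1 h i)).2

/-- The part of the cylinder away from the initial end of the cone on `J`. -/
abbrev upperTail : SSet.{u} := (cutFiber (upperCut J B) 1 : SSet.{u})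

/-- The embedding of the upper part of the cylinder into a join. -/
def upperEmb : (upperPart J B : SSet.{u}) ⟶ join (rightCone J) (upperTail J B) :=
  joinLift (upperCut J B)
    { app := fun U => ↾fun z => (joinLeft (rightCone J) B).app U
        ⟨z.1.1.1, upperCut_zero_mem J B z.2⟩
      naturality := fun U V f => by
        ext z
        exact joinLeft_map f z.1.1.1 (upperCut_zero_mem J B z.2) _ }
    (𝟙 _)

lemma upperEmb_cut : upperEmb J B ≫ joinCut _ _ = upperCut J B := joinLift_cut _ _ _

lemma upperEmb_mem {U : SimplexCategoryᵒᵖ} (z : (upperPart J B : SSet.{u}).obj U) (ε : Fin 2) :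
    (upperEmb J B).app U z ∈ (cutFiber (joinCut _ _) ε).obj U ↔
      z ∈ (cutFiber (upperCut J B) ε).obj U := joinLift_mem _ _ _ _ _

lemma upperEmb_left {U : SimplexCategoryᵒᵖ} (z : (upperPart J B : SSet.{u}).obj U)
    (h : (upperEmb J B).app U z ∈ (cutFiber (joinCut _ _) 0).obj U)
    (h' : z.1.1 ∈ (cutFiber (joinCut (rightCone J) B) 0).obj U) :
    (joinLeft _ _).app U ⟨_, h⟩ = (joinLeft (rightCone J) B).app U ⟨z.1.1, h'⟩ :=
  joinLift_left _ _ _ z ((upperEmb_mem J B z 0).1 h) h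

lemma upperEmb_right {U : SimplexCategoryᵒᵖ} (z : (upperPart J B : SSet.{u}).obj U)
    (h : (upperEmb J B).app U z ∈ (cutFiber (joinCut _ _) 1).obj U)
    (h' : z ∈ (cutFiber (upperCut J B) 1).obj U) :
    (joinRight _ _).app U ⟨_, h⟩ = ⟨z, h'⟩ :=
  joinLift_right _ _ _ z ((upperEmb_mem J B z 1).1 h) h

attribute [irreducible] upperEmb

/-- The first component of a simplex of the tail. -/
def tailFst : upperTail J B ⟶ join (rightCone J) B :=
  (cutFiber (upperCut J B) 1).ι ≫ (upperPart J B).ι ≫ fst _ _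

/-- The second component of a simplex of the tail. -/
def tailSnd : upperTail J B ⟶ Δ[1] :=
  (cutFiber (upperCut J B) 1).ι ≫ (upperPart J B).ι ≫ snd _ _

/-- The cut of the first component of the collapse map. -/
def collapseCut : join (rightCone J) (upperTail J B) ⟶ Δ[1] :=
  zeroExt (rightCone J) (tailFst J B ≫ joinCut (rightCone J) B)

lemma collapseCut_mem {U : SimplexCategoryᵒᵖ}
    {w : (join (rightCone J) (upperTail J B)).obj U}
    (h : w ∈ (cutFiber (collapseCut J B) 1).obj U)
    (h' : w ∈ (cutFiber (joinCut (rightCone J) (upperTail J B)) 1).obj U) :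
    (tailFst J B).app U ((joinRight _ _).app U ⟨w, h'⟩) ∈
      (cutFiber (joinCut (rightCone J) B) 1).obj U :=
  (joinRight_mem_of_zeroExt (tailFst J B ≫ joinCut (rightCone J) B) h' 1).2 h

/-- The first component of the collapse map. -/
def collapseFst : join (rightCone J) (upperTail J B) ⟶ join (rightCone J) B :=
  joinLift (collapseCut J B) ((cutFiber (collapseCut J B) 0).ι ≫ coneProj J (upperTail J B))
    { app := fun U => ↾fun w => (joinRight (rightCone J) B).app U
        ⟨(tailFst J B).app U ((joinRight _ _).app U ⟨w.1, mem_cutFiber_one_of_zeroExt _ w.2⟩),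
          collapseCut_mem J B w.2 (mem_cutFiber_one_of_zeroExt _ w.2)⟩
      naturality := fun U V f => by
        ext w
        have k₁ := joinRight_map f w.1 (mem_cutFiber_one_of_zeroExt _ w.2)
          (subcomplex_map_mem _ f (mem_cutFiber_one_of_zeroExt _ w.2))
        have k₂ := (congrArg ((tailFst J B).app V) k₁).trans
          (NatTrans.naturality_apply (tailFst J B) f _)
        refine (joinRight_congr k₂ (collapseCut_mem J B (subcomplex_map_mem _ f w.2) _)
          (subcomplex_map_mem _ f (collapseCut_mem J B w.2
            (mem_cutFiber_one_of_zeroExt _ w.2)))).trans ?_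
        exact joinRight_map f _ _ _ }

lemma collapseFst_cut : collapseFst J B ≫ joinCut _ _ = collapseCut J B := joinLift_cut _ _ _

lemma collapseFst_mem {U : SimplexCategoryᵒᵖ} (w : (join (rightCone J) (upperTail J B)).obj U)
    (ε : Fin 2) : (collapseFst J B).app U w ∈ (cutFiber (joinCut _ _) ε).obj U ↔
      w ∈ (cutFiber (collapseCut J B) ε).obj U := joinLift_mem _ _ _ _ _

lemma collapseFst_left {U : SimplexCategoryᵒᵖ} (w : (join (rightCone J) (upperTail J B)).obj U)
    (h : (collapseFst J B).app U w ∈ (cutFiber (joinCut _ _) 0).obj U) :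
    (joinLeft _ _).app U ⟨_, h⟩ = (coneProj J (upperTail J B)).app U w :=
  joinLift_left _ _ _ w ((collapseFst_mem J B w 0).1 h) h

lemma collapseFst_right {U : SimplexCategoryᵒᵖ} (w : (join (rightCone J) (upperTail J B)).obj U)
    (h : (collapseFst J B).app U w ∈ (cutFiber (joinCut _ _) 1).obj U)
    (h' : w ∈ (cutFiber (joinCut (rightCone J) (upperTail J B)) 1).obj U)
    (h'' : (tailFst J B).app U ((joinRight _ _).app U ⟨w, h'⟩) ∈
      (cutFiber (joinCut (rightCone J) B) 1).obj U) :
    (joinRight _ _).app U ⟨_, h⟩ = (joinRight (rightCone J) B).app U ⟨_, h''⟩ :=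
  joinLift_right _ _ _ w ((collapseFst_mem J B w 1).1 h) h

attribute [irreducible] collapseFst

/-- The second component of the collapse map. -/
def collapseSnd : join (rightCone J) (upperTail J B) ⟶ Δ[1] :=
  zeroExt (rightCone J) (tailSnd J B)

/-- The collapse map from the join to the cylinder. -/
def collapse : join (rightCone J) (upperTail J B) ⟶ join (rightCone J) B ⊗ Δ[1] :=
  lift (collapseFst J B) (collapseSnd J B)

end Step

/-! ### The upper part of the cylinder as a retract of a join -/

section StepLemmas

variable (J B : SSet.{u})

lemma vertex_mem_cutFiber {X : SSet.{u}} (χ : X ⟶ Δ[1]) (x : X _⦋0⦌) {ε : Fin 2}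
    (h : vx (χ.app _ x) 0 = ε) : x ∈ (cutFiber χ ε).obj _ :=
  (mem_cutFiber _ _ _).2 fun i => by
    rw [← h]
    exact congrArg _ (Fin.ext (by lia))

lemma coneProj_cut_app (T : SSet.{u}) {U : SimplexCategoryᵒᵖ}
    (w : (join (rightCone J) T).obj U) :
    (joinCut J Δ[0]).app U ((coneProj J T).app U w) = (baseCut J T).app U w :=
  ConcreteCategory.congr_hom (NatTrans.congr_app (coneProj_cut J T) U) w

/-- Comparison with `zeroExt` on the upper part. -/
lemma upperEmb_zeroExt (b : upperTail J B ⟶ Δ[1]) (b' : (upperPart J B : SSet.{u}) ⟶ Δ[1])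
    (h₁ : (cutFiber (upperCut J B) 1).ι ≫ b' = b)
    (h₀ : ∀ z : (upperPart J B : SSet.{u}) _⦋0⦌, vx ((upperCut J B).app _ z) 0 = 0 →
      vx (b'.app _ z) 0 = 0) :
    upperEmb J B ≫ zeroExt (rightCone J) b = b' := by
  refine hom_ext_vx fun z => ?_
  change vx ((zeroExt (rightCone J) b).app _ ((upperEmb J B).app _ z)) 0 = _
  by_cases h : vx ((upperCut J B).app _ z) 0 = 0
  · rw [h₀ z h]
    refine vx_zeroExt b _ ?_
    rw [← upperEmb_cut] at h
    exact h
  · have hz := vertex_mem_cutFiber (upperCut J B) z (ε := 1) (by lia)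
    have hm := (upperEmb_mem J B z 1).2 hz
    rw [zeroExt_app b _ hm, upperEmb_right J B z hm hz, ← h₁]
    rfl

lemma upperEmb_collapseSnd : upperEmb J B ≫ collapseSnd J B = (upperPart J B).ι ≫ snd _ _ :=
  upperEmb_zeroExt J B _ _ rfl fun _ h => (upperCut_eq_zero J B |>.1 h).1

lemma upperEmb_collapseCut : upperEmb J B ≫ collapseCut J B =
    (upperPart J B).ι ≫ fst _ _ ≫ joinCut (rightCone J) B :=
  upperEmb_zeroExt J B _ _ rfl fun _ h => (upperCut_eq_zero J B |>.1 h).2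

/-- A vertex of the tail which does not lie over `B` has height `1`. In the upper part the height is
at most `baseCut`, so such a vertex lies over the cone point and both sides are `1`. -/
lemma upperEmb_baseCut {U : SimplexCategoryᵒᵖ} (z : (upperPart J B : SSet.{u}).obj U)
    (h : z.1.1 ∈ (cutFiber (joinCut (rightCone J) B) 0).obj U) :
    (baseCut J (upperTail J B)).app U ((upperEmb J B).app U z) =
      (baseCut J B).app U z.1.1 := by
  suffices H : ∀ z : (upperPart J B : SSet.{u}) _⦋0⦌,
      z.1.1 ∈ (cutFiber (joinCut (rightCone J) B) 0).obj _ →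
      vx ((baseCut J (upperTail J B)).app _ ((upperEmb J B).app _ z)) 0 =
        vx ((baseCut J B).app _ z.1.1) 0 by
    refine vx_ext fun i => ?_
    have h₁ := vx_vertex (upperEmb J B ≫ baseCut J (upperTail J B)) z i
    have h₂ := vx_vertex ((upperPart J B).ι ≫ fst _ _ ≫ baseCut J B) z i
    have hz := subcomplex_map_mem (cutFiber (joinCut (rightCone J) B) 0) (vertexHom U i) h
    exact h₁.trans ((H ((upperPart J B : SSet.{u}).map (vertexHom U i) z) hz).trans h₂.symm)
  clear z h
  intro z hz
  by_cases h : vx ((upperCut J B).app _ z) 0 = 0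
  · have hm := (upperEmb_mem J B z 0).2 (vertex_mem_cutFiber (upperCut J B) z h)
    rw [oneExt_app _ _ hm, upperEmb_left J B z hm hz, oneExt_app _ _ hz]
  · have h₁ : vx ((upperCut J B).app _ z) 0 = 1 := by lia
    rw [vx_oneExt]
    · have h₂ := z.2 0
      have h₃ := (mem_cutFiber _ _ _).1 hz 0
      rw [vx_upperCut, h₃] at h
      have h₄ : vx z.1.2 0 ≠ 0 := fun e => h (by rw [e]; rfl)
      lia
    · rw [← upperEmb_cut] at h₁
      exact h₁

/-- Tail vertices over `J^▷` sit at the cone point, so sending the whole tail to the cone point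
loses nothing. -/
lemma upperEmb_coneProj {U : SimplexCategoryᵒᵖ} (z : (upperPart J B : SSet.{u}).obj U)
    (h : z.1.1 ∈ (cutFiber (joinCut (rightCone J) B) 0).obj U) :
    (coneProj J (upperTail J B)).app U ((upperEmb J B).app U z) =
      (joinLeft (rightCone J) B).app U ⟨z.1.1, h⟩ := by
  have hc : ∀ {V} (z : (upperPart J B : SSet.{u}).obj V)
      (h : z.1.1 ∈ (cutFiber (joinCut (rightCone J) B) 0).obj V),
      (joinCut J Δ[0]).app V ((coneProj J (upperTail J B)).app V ((upperEmb J B).app V z)) =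
        (joinCut J Δ[0]).app V ((joinLeft (rightCone J) B).app V ⟨z.1.1, h⟩) := by
    intro V z h
    exact (coneProj_cut_app J _ _).trans ((upperEmb_baseCut J B z h).trans (oneExt_app _ _ h))
  refine join_ext (hc z h) ?_ fun _ _ _ _ => Subsingleton.elim _ _
  intro V f ha hb
  let z' := (upperPart J B : SSet.{u}).map f z
  have hz' : z'.1.1 ∈ (cutFiber (joinCut (rightCone J) B) 0).obj V := subcomplex_map_mem _ f h
  have k₁ : (rightCone J).map f ((coneProj J (upperTail J B)).app U ((upperEmb J B).app U z)) =
      (coneProj J (upperTail J B)).app V ((upperEmb J B).app V z') :=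
    (NatTrans.naturality_apply (upperEmb J B ≫ coneProj J (upperTail J B)) f z).symm
  have k₂ : (rightCone J).map f ((joinLeft (rightCone J) B).app U ⟨z.1.1, h⟩) =
      (joinLeft (rightCone J) B).app V ⟨z'.1.1, hz'⟩ :=
    (joinLeft_map f z.1.1 h hz').symm
  have hm₁ : (coneProj J (upperTail J B)).app V ((upperEmb J B).app V z') ∈
    (cutFiber (joinCut J Δ[0]) 0).obj V := k₁ ▸ ha
  have hm₂ : (joinLeft (rightCone J) B).app V ⟨z'.1.1, hz'⟩ ∈
    (cutFiber (joinCut J Δ[0]) 0).obj V := k₂ ▸ hb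
  rw [joinLeft_congr k₁ ha hm₁, joinLeft_congr k₂ hb hm₂]
  have hm₀ : (upperEmb J B).app V z' ∈ (cutFiber (joinCut _ _) 0).obj V := by
    refine mem_cutFiber_zero_of_oneExt (joinCut J Δ[0]) ?_
    rw [mem_cutFiber, upperEmb_baseCut J B z' hz']
    exact (mem_cutFiber _ _ _).1 ((joinLeft_mem_of_oneExt _ hz' 0).1 hm₂)
  have e := upperEmb_left J B z' hm₀ hz'
  rw [coneProj_left J _ _ hm₁ hm₀ (e ▸ hm₂)]
  exact joinLeft_congr e _ _

lemma upperEmb_collapseFst : upperEmb J B ≫ collapseFst J B = (upperPart J B).ι ≫ fst _ _ := by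
  refine join_hom_ext ?_ ?_ ?_
  · rw [Category.assoc, Category.assoc, collapseFst_cut, upperEmb_collapseCut]
  · intro U z ha hb
    exact (collapseFst_left J B _ ha).trans (upperEmb_coneProj J B z hb)
  · intro U z ha hb
    have hz : z ∈ (cutFiber (upperCut J B) 1).obj U := by
      rw [mem_cutFiber] at hb ⊢
      intro i
      rw [vx_upperCut]
      exact (congrArg (max _) (hb i)).trans (max_eq_right (fin_two_le_one _))
    have hm := (upperEmb_mem J B z 1).2 hz
    have e : (tailFst J B).app U ((joinRight _ _).app U ⟨_, hm⟩) = z.1.1 :=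
      congrArg ((tailFst J B).app U) (upperEmb_right J B z hm hz)
    exact (collapseFst_right J B _ ha hm (e ▸ hb)).trans (joinRight_congr e _ _)

/-- A simplex of the upper part is an initial segment in `J^▷` at height `0` followed by a tail, and
`collapse` reassembles the two. Extension over the upper part is thereby reduced to extension over a
join with first factor `J^▷`. -/
lemma upperEmb_collapse : upperEmb J B ≫ collapse J B = (upperPart J B).ι := by
  refine CartesianMonoidalCategory.hom_ext _ _ ?_ ?_
  · rw [Category.assoc, collapse, lift_fst, upperEmb_collapseFst]
  · rw [Category.assoc, collapse, lift_snd, upperEmb_collapseSnd]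

/-! ### Vertices of the collapse map -/

lemma collapse_vertex_zero {U : SimplexCategoryᵒᵖ}
    (w : (join (rightCone J) (upperTail J B)).obj U) {i}
    (h : vx ((joinCut _ _).app U w) i = 0) :
    vx ((collapseSnd J B).app U w) i = 0 ∧
      vx ((joinCut _ _).app U ((collapseFst J B).app U w)) i = 0 ∧
      vx ((baseCut J B).app U ((collapseFst J B).app U w)) i =
        vx ((baseCut J (upperTail J B)).app U w) i := by
  suffices H : ∀ w : (join (rightCone J) (upperTail J B)) _⦋0⦌,
      vx ((joinCut _ _).app _ w) 0 = 0 → vx ((collapseSnd J B).app _ w) 0 = 0 ∧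
      vx ((joinCut _ _).app _ ((collapseFst J B).app _ w)) 0 = 0 ∧
      vx ((baseCut J B).app _ ((collapseFst J B).app _ w)) 0 =
        vx ((baseCut J (upperTail J B)).app _ w) 0 by
    have h₁ := vx_vertex (collapseSnd J B) w i
    have h₂ := vx_vertex (collapseFst J B ≫ joinCut _ _) w i
    have h₃ := vx_vertex (collapseFst J B ≫ baseCut J B) w i
    have h₄ := vx_vertex (baseCut J (upperTail J B)) w i
    have h₅ := vx_vertex (joinCut _ _) w i
    obtain ⟨e₁, e₂, e₃⟩ := H _ (h₅.symm.trans h)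
    exact ⟨h₁.trans e₁, h₂.trans e₂, h₃.trans (e₃.trans h₄.symm)⟩
  clear w h
  intro w h
  have hc : vx ((collapseCut J B).app _ w) 0 = 0 := vx_zeroExt _ _ h
  have hm := (collapseFst_mem J B w 0).2 (vertex_mem_cutFiber _ w hc)
  refine ⟨vx_zeroExt _ _ h, (mem_cutFiber _ _ _).1 hm 0, ?_⟩
  rw [oneExt_app _ _ hm, collapseFst_left, coneProj_cut_app]

/-- A tail vertex has height `1` or lies over `B`, by the definition of `upperCut`. If it does not
lie over `B`, then `coneProj` has sent it to the cone point. -/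
lemma collapse_vertex_one {U : SimplexCategoryᵒᵖ}
    (w : (join (rightCone J) (upperTail J B)).obj U) {i}
    (h : vx ((joinCut _ _).app U w) i = 1) :
    (vx ((collapseSnd J B).app U w) i = 1 ∨
      vx ((joinCut _ _).app U ((collapseFst J B).app U w)) i = 1) ∧
      vx ((baseCut J B).app U ((collapseFst J B).app U w)) i = 1 := by
  suffices H : ∀ w : (join (rightCone J) (upperTail J B)) _⦋0⦌,
      vx ((joinCut _ _).app _ w) 0 = 1 → (vx ((collapseSnd J B).app _ w) 0 = 1 ∨
      vx ((joinCut _ _).app _ ((collapseFst J B).app _ w)) 0 = 1) ∧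
      vx ((baseCut J B).app _ ((collapseFst J B).app _ w)) 0 = 1 by
    have h₁ := vx_vertex (collapseSnd J B) w i
    have h₂ := vx_vertex (collapseFst J B ≫ joinCut _ _) w i
    have h₃ := vx_vertex (collapseFst J B ≫ baseCut J B) w i
    have h₅ := vx_vertex (joinCut _ _) w i
    obtain ⟨e₁, e₂⟩ := H _ (h₅.symm.trans h)
    exact ⟨e₁.imp h₁.trans h₂.trans, h₃.trans e₂⟩
  clear w h
  intro w h
  have hm := vertex_mem_cutFiber _ w h
  have hs : vx ((collapseSnd J B).app _ w) 0 =
      vx ((tailSnd J B).app _ ((joinRight _ _).app _ ⟨w, hm⟩)) 0 := by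
    rw [collapseSnd, zeroExt_app _ _ hm]
  have hc : vx ((collapseCut J B).app _ w) 0 =
      vx ((tailFst J B ≫ joinCut _ _).app _ ((joinRight _ _).app _ ⟨w, hm⟩)) 0 := by
    rw [collapseCut, zeroExt_app _ _ hm]
  have hf : vx ((joinCut _ _).app _ ((collapseFst J B).app _ w)) 0 =
      vx ((collapseCut J B).app _ w) 0 := by
    rw [← collapseFst_cut]
    rfl
  obtain ⟨⟨τ, hτ⟩, eτ⟩ : ∃ τ, τ = (joinRight _ _).app _ ⟨w, hm⟩ := ⟨_, rfl⟩
  rw [← eτ] at hs hc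
  have hκ := (mem_cutFiber _ _ _).1 hτ 0
  rw [vx_upperCut] at hκ
  have hs' : vx ((collapseSnd J B).app _ w) 0 = vx τ.1.2 0 := hs
  have hc' : vx ((collapseCut J B).app _ w) 0 =
      vx ((joinCut (rightCone J) B).app _ τ.1.1) 0 := hc
  rw [← hs', ← hc', ← hf] at hκ
  have hor : vx ((collapseSnd J B).app _ w) 0 = 1 ∨
      vx ((joinCut _ _).app _ ((collapseFst J B).app _ w)) 0 = 1 := by
    by_contra hne
    push Not at hne
    have e₁ : vx ((collapseSnd J B).app _ w) 0 = 0 := by lia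
    have e₂ : vx ((joinCut _ _).app _ ((collapseFst J B).app _ w)) 0 = 0 := by lia
    rw [e₁, e₂] at hκ
    exact absurd hκ (by decide)
  refine ⟨hor, ?_⟩
  by_cases hz : vx ((joinCut _ _).app _ ((collapseFst J B).app _ w)) 0 = 0
  · have hm' := vertex_mem_cutFiber _ _ hz
    rw [oneExt_app _ _ hm', collapseFst_left, coneProj_cut_app]
    exact vx_oneExt _ _ h
  · refine le_antisymm (fin_two_le_one _) (le_trans ?_ (vx_joinCut_le_baseCut J B _ 0))
    lia

end StepLemmas

/-! ### Comparing the subcomplexes of the cylinder and of the join -/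

section StepSub

variable {J B : SSet.{u}}

/-- The union of a cylinder on a subcomplex and of the ends of the cylinder. -/
def cylSub {X : SSet.{u}} (X₀ : X.Subcomplex) : (X ⊗ Δ[1]).Subcomplex :=
  X₀.prod ⊤ ⊔ (⊤ : X.Subcomplex).prod ∂Δ[1]

lemma mem_cylSub_of_left {X : SSet.{u}} {X₀ : X.Subcomplex} {U : SimplexCategoryᵒᵖ}
    {z : (X ⊗ Δ[1]).obj U} (h : z.1 ∈ X₀.obj U) : z ∈ (cylSub X₀).obj U :=
  Or.inl ⟨h, trivial⟩

lemma mem_cylSub_of_right {X : SSet.{u}} (X₀ : X.Subcomplex) {U : SimplexCategoryᵒᵖ}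
    {z : (X ⊗ Δ[1]).obj U} (h : (∀ i, vx z.2 i = 0) ∨ ∀ i, vx z.2 i = 1) :
    z ∈ (cylSub X₀).obj U :=
  Or.inr ⟨trivial, (mem_boundary_one _).2 h⟩

variable (Y : (join (rightCone J) B).Subcomplex)

/-- The subcomplex over which the extension problem is given. -/
def stepSub : (join (rightCone J) B).Subcomplex :=
  SSet.Subcomplex.range (joinMap (coneIncl J) (𝟙 B)) ⊔ Y

lemma mem_range_coneIncl {U : SimplexCategoryᵒᵖ} (s : (rightCone J).obj U)
    (h : s ∈ (cutFiber (joinCut J Δ[0]) 0).obj U) :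
    s ∈ (SSet.Subcomplex.range (coneIncl J)).obj U :=
  ⟨_, joinInl_joinLeft s h⟩

lemma mem_range_joinMap_coneIncl {T : SSet.{u}} {U : SimplexCategoryᵒᵖ}
    (x : (join (rightCone J) T).obj U)
    (h : ∀ i, vx ((baseCut J T).app U x) i = 0 ∨ vx ((joinCut _ _).app U x) i = 1) :
    x ∈ (SSet.Subcomplex.range (joinMap (coneIncl J) (𝟙 T))).obj U := by
  refine mem_range_joinMap _ _ x ?_ ?_
  · intro V φ hφ
    refine mem_range_coneIncl _ ?_
    rw [joinLeft_mem_of_oneExt, mem_cutFiber]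
    intro i
    rw [NatTrans.naturality_apply, vx_map]
    refine (h _).resolve_right fun h₁ => ?_
    have h₀ := (mem_cutFiber _ _ _).1 hφ i
    rw [NatTrans.naturality_apply, vx_map] at h₀
    exact absurd (h₀.symm.trans h₁) zero_ne_one
  · intro V φ hφ
    exact ⟨_, rfl⟩

lemma baseCut_of_mem_range {T : SSet.{u}} {U : SimplexCategoryᵒᵖ}
    {x : (join (rightCone J) T).obj U}
    (hx : x ∈ (SSet.Subcomplex.range (joinMap (coneIncl J) (𝟙 T))).obj U) {i}
    (hi : vx ((joinCut _ _).app U x) i = 0) : vx ((baseCut J T).app U x) i = 0 := by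
  obtain ⟨y, rfl⟩ := hx
  rw [vx_vertex] at hi ⊢
  rw [← NatTrans.naturality_apply] at hi ⊢
  generalize (join J T).map (vertexHom U i) y = y at hi ⊢
  have hm := vertex_mem_cutFiber _ _ hi
  rw [oneExt_app _ _ hm, joinMap_left _ _ y ((joinMap_mem _ _ y 0).1 hm)]
  exact (mem_cutFiber _ _ _).1 (joinInl_mem _) 0

lemma joinRight_mem_of_range {S T : SSet.{u}} (A : T.Subcomplex) {U : SimplexCategoryᵒᵖ}
    {z : (join S T).obj U} (hz : z ∈ (SSet.Subcomplex.range (joinMap (𝟙 S) A.ι)).obj U)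
    (h : z ∈ (cutFiber (joinCut S T) 1).obj U) : (joinRight S T).app U ⟨z, h⟩ ∈ A.obj U := by
  obtain ⟨y, rfl⟩ := hz
  rw [joinMap_right _ _ y ((joinMap_mem _ _ y 1).1 h)]
  exact Subtype.prop _

/-- The subcomplex of the tail over which the extension is known. -/
def tailSub : (upperTail J B).Subcomplex :=
  cutFiber (tailSnd J B) 0 ⊔ Y.preimage (tailFst J B)

/-- The region `baseCut = 0` lies over `J`, where the map is already given. With `inf_le_relBase`,
an extension over the lower part agrees with the given map wherever both are defined. -/
lemma relBase_le_cylSub : relBase lePart leEdges (baseCut J B) (stepSub Y) ≤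
    cylSub (stepSub Y) := by
  rintro U z ((h | h) | h)
  · refine mem_cylSub_of_left (Or.inl (mem_range_joinMap_coneIncl z.1 fun i => Or.inl (h i)))
  · exact mem_cylSub_of_right _ (Or.inr h)
  · exact Or.inl h.2

lemma inf_le_relBase : cylSub (stepSub Y) ⊓ relPart lePart (baseCut J B) ≤
    relBase lePart leEdges (baseCut J B) (stepSub Y) := by
  rintro U z ⟨h | ⟨-, h⟩, hD⟩
  · exact Or.inr ⟨hD, h⟩
  · rcases (mem_boundary_one _).1 h with h | h
    · exact Or.inl (Or.inl fun i => le_antisymm ((hD i).trans (h i).le) (Fin.zero_le _))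
    · exact Or.inl (Or.inr h)

/-- Two monotone sequences in `{0, 1}` are always comparable, so the lower and the upper part cover
the cylinder. -/
lemma mem_relPart_or_mem_upperPart {U : SimplexCategoryᵒᵖ}
    (z : (join (rightCone J) B ⊗ Δ[1]).obj U) :
    z ∈ (relPart lePart (baseCut J B)).obj U ∨ z ∈ (upperPart J B).obj U := by
  by_contra h
  push Not at h
  obtain ⟨h₁, h₂⟩ := h
  have h₁' : ¬ ∀ i, vx ((baseCut J B).app U z.1) i ≤ vx z.2 i := h₁
  have h₂' : ¬ ∀ i, vx z.2 i ≤ vx ((baseCut J B).app U z.1) i := h₂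
  push Not at h₁' h₂'
  obtain ⟨i, hi⟩ := h₁'
  obtain ⟨j, hj⟩ := h₂'
  rcases le_total i j with hij | hij
  · have := vx_mono ((baseCut J B).app U z.1) hij
    lia
  · have := vx_mono z.2 hij
    lia

/-- If all tail vertices lie over `B`, the collapsed simplex lies over `J ⋆ B`. Otherwise some tail
vertex lies over the cone point at height `1`. Later vertices then have height `1` by monotonicity;
so do earlier tail vertices, which cannot lie over `B` before a cone point. The simplex therefore
belongs to the lower part. -/
lemma collapse_left_mem {U : SimplexCategoryᵒᵖ}
    {w : (join (rightCone J) (upperTail J B)).obj U}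
    (hw : w ∈ (SSet.Subcomplex.range (joinMap (coneIncl J) (𝟙 (upperTail J B)))).obj U) :
    (collapse J B).app U w ∈
      (cylSub (stepSub Y) ⊔ relPart lePart (baseCut J B) : Subfunctor _).obj U := by
  by_cases h : ∀ i, vx ((joinCut _ _).app U w) i = 1 →
    vx ((joinCut _ _).app U ((collapseFst J B).app U w)) i = 1
  · refine Or.inl (mem_cylSub_of_left (Or.inl (mem_range_joinMap_coneIncl _ fun i => ?_)))
    by_cases hi : vx ((joinCut _ _).app U w) i = 0
    · exact Or.inl ((collapse_vertex_zero J B w hi).2.2.trans (baseCut_of_mem_range hw hi))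
    · exact Or.inr (h i (by lia))
  · push Not at h
    obtain ⟨i, hi, hi'⟩ := h
    refine Or.inr fun j => ?_
    change vx ((baseCut J B).app U ((collapseFst J B).app U w)) j ≤
      vx ((collapseSnd J B).app U w) j
    by_cases hj : vx ((joinCut _ _).app U w) j = 0
    · rw [(collapse_vertex_zero J B w hj).2.2, baseCut_of_mem_range hw hj]
      exact Fin.zero_le _
    · have hj₁ : vx ((joinCut _ _).app U w) j = 1 := by lia
      refine (fin_two_le_one _).trans ?_
      rcases le_total i j with hij | hij
      · have h₁ := (collapse_vertex_one J B w hi).1.resolve_right hi'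
        exact h₁.symm.le.trans (vx_mono _ hij)
      · refine ((collapse_vertex_one J B w hj₁).1.resolve_right fun h' => hi' ?_).symm.le
        exact le_antisymm (fin_two_le_one _) (h'.symm.le.trans (vx_mono _ hij))

lemma map_eq_map_tailHom {X : SSet.{u}} {U V : SimplexCategoryᵒᵖ} (f : U ⟶ V) (x : X.obj U)
    {i : Fin (U.unop.len + 1)} (h : ∀ j, i ≤ f.unop.toOrderHom j) :
    X.map f x = X.map f (X.map (tailHom U i) x) := by
  have : f = tailHom U i ≫ f := by
    apply Quiver.Hom.unop_inj
    ext j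
    exact congrArg Fin.val (max_eq_left (h j)).symm
  conv_lhs => rw [this]
  exact Functor.map_comp_apply _ _ _ _

lemma exists_first {U : SimplexCategoryᵒᵖ} (c : (Δ[1] : SSet.{u}).obj U)
    (h : ¬ ∀ i, vx c i = 0) : ∃ i, vx c i = 1 ∧ ∀ j, vx c j = 1 → i ≤ j := by
  classical
  push Not at h
  have h' : ∃ (n : ℕ) (i : Fin (U.unop.len + 1)), (i : ℕ) = n ∧ vx c i = 1 :=
    ⟨_, h.choose, rfl, by have := h.choose_spec; lia⟩
  obtain ⟨i, hi, hi'⟩ := Nat.find_spec h'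
  exact ⟨i, hi', fun j hj => Fin.le_def.2 (hi.le.trans (Nat.find_min' h' ⟨j, rfl, hj⟩))⟩

variable {Y} (hY : Y = ⊥ ∨ ∃ (A : SSet.{u}) (i : A ⟶ B) (_ : Mono i),
  Y = SSet.Subcomplex.range (joinMap (𝟙 (rightCone J)) i))

-- Membership in `J^▷ ⋆ A` depends only on the component in `B`. This fails for the empty subcomplex
-- on simplices with no such component, whence the nonemptiness condition.
include hY in
lemma mem_of_right_mem {U : SimplexCategoryᵒᵖ} (x : (join (rightCone J) B).obj U)
    (hne : ∃ V, (Y.obj V).Nonempty)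
    (h : ∀ (V : SimplexCategoryᵒᵖ) (f : U ⟶ V)
      (hf : (join (rightCone J) B).map f x ∈ (cutFiber (joinCut _ _) 1).obj V),
      ∃ (y : (join (rightCone J) B).obj V) (_ : y ∈ Y.obj V)
        (hy : y ∈ (cutFiber (joinCut _ _) 1).obj V),
        (joinRight _ _).app V ⟨_, hf⟩ = (joinRight _ _).app V ⟨y, hy⟩) : x ∈ Y.obj U := by
  obtain rfl | ⟨A, i, hi, rfl⟩ := hY
  · obtain ⟨V, y, hy⟩ := hne
    exact hy.elim
  · refine mem_range_joinMap _ _ x (fun V f _ => ⟨_, rfl⟩) ?_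
    intro V f hf
    obtain ⟨y, ⟨y', rfl⟩, hy, e⟩ := h V f hf
    rw [e]
    exact ⟨_, (joinMap_right _ _ y' ((joinMap_mem _ _ y' 1).1 hy) hy).symm⟩

-- A simplex without tail, or with a tail at height `0`, collapses into the end `0`. If the tail
-- lies over `Y`, its component in `B` forces the first coordinate of the whole collapsed simplex
-- into `Y`.
include hY in
lemma collapse_right_mem {U : SimplexCategoryᵒᵖ}
    {w : (join (rightCone J) (upperTail J B)).obj U}
    (hw : w ∈ (SSet.Subcomplex.range (joinMap (𝟙 (rightCone J)) (tailSub Y).ι)).obj U) :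
    (collapse J B).app U w ∈ (cylSub (stepSub Y)).obj U := by
  by_cases hall : ∀ i, vx ((joinCut _ _).app U w) i = 0
  · exact mem_cylSub_of_right _ (Or.inl fun i => (collapse_vertex_zero J B w (hall i)).1)
  -- Cutting at the first tail vertex makes `tailHom` capture the entire tail.
  obtain ⟨i, hi, hmin⟩ := exists_first _ hall
  have hm := map_tailHom_mem (joinCut _ _) w hi
  have hτ : (joinRight _ _).app U ⟨_, hm⟩ ∈ (tailSub Y).obj U :=
    joinRight_mem_of_range (tailSub Y) (subcomplex_map_mem _ _ hw) hm
  rcases hτ with hτ | hτ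
  · refine mem_cylSub_of_right _ (Or.inl fun j => ?_)
    change vx ((collapseSnd J B).app U w) j = 0
    by_cases hj : vx ((joinCut _ _).app U w) j = 0
    · exact (collapse_vertex_zero J B w hj).1
    · have hij : i ≤ j := hmin j (by lia)
      have h₁ := (mem_cutFiber _ _ _).1 ((joinRight_mem_of_zeroExt (tailSnd J B) hm 0).1 hτ) j
      rw [NatTrans.naturality_apply, vx_map] at h₁
      have h₂ : (tailHom U i).unop.toOrderHom j = j := max_eq_left hij
      rw [h₂] at h₁
      exact h₁
  · refine mem_cylSub_of_left (Or.inr ?_)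
    change (collapseFst J B).app U w ∈ Y.obj U
    refine mem_of_right_mem hY _ ⟨U, _, hτ⟩ ?_
    intro V f hf
    have k₁ : (join (rightCone J) B).map f ((collapseFst J B).app U w) =
        (collapseFst J B).app V ((join _ _).map f w) :=
      (NatTrans.naturality_apply _ _ _).symm
    have hf' : (collapseFst J B).app V ((join _ _).map f w) ∈
        (cutFiber (joinCut (rightCone J) B) 1).obj V := k₁ ▸ hf
    have h₁ := (collapseFst_mem J B _ 1).1 hf'
    have h₂ := mem_cutFiber_one_of_zeroExt _ h₁
    have h₃ : (join _ _).map f w = (join _ _).map f ((join _ _).map (tailHom U i) w) := by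
      refine map_eq_map_tailHom f w fun j => hmin _ ?_
      have := (mem_cutFiber _ _ _).1 h₂ j
      rwa [NatTrans.naturality_apply, vx_map] at this
    have h₄ : (tailFst J B).app V ((joinRight _ _).app V ⟨_, h₂⟩) ∈ Y.obj V := by
      rw [joinRight_congr h₃ h₂ (h₃ ▸ h₂), joinRight_map f _ hm, NatTrans.naturality_apply]
      exact subcomplex_map_mem _ f hτ
    refine ⟨_, h₄, collapseCut_mem J B h₁ h₂, ?_⟩
    rw [joinRight_congr k₁ hf hf', collapseFst_right J B _ hf' h₂ (collapseCut_mem J B h₁ h₂)]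

lemma upperEmb_right_mem {U : SimplexCategoryᵒᵖ} (z : (upperPart J B : SSet.{u}).obj U)
    (h : (∀ i, vx z.1.2 i = 0) ∨ z.1.1 ∈ Y.obj U) :
    (upperEmb J B).app U z ∈
      (SSet.Subcomplex.range (joinMap (𝟙 (rightCone J)) (tailSub Y).ι)).obj U := by
  refine mem_range_joinMap _ _ _ (fun V f _ => ⟨_, rfl⟩) ?_
  intro V f hf
  have k₁ : (join _ _).map f ((upperEmb J B).app U z) =
      (upperEmb J B).app V ((upperPart J B : SSet.{u}).map f z) :=
    (NatTrans.naturality_apply _ _ _).symm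
  have hf' : (upperEmb J B).app V ((upperPart J B : SSet.{u}).map f z) ∈
    (cutFiber (joinCut _ _) 1).obj V := k₁ ▸ hf
  have hz := (upperEmb_mem J B _ 1).1 hf'
  rw [joinRight_congr k₁ hf hf', upperEmb_right J B _ hf' hz]
  refine ⟨⟨_, ?_⟩, rfl⟩
  rcases h with h | h
  · exact Or.inl ((mem_cutFiber _ _ _).2 fun i => h _)
  · exact Or.inr (subcomplex_map_mem Y f h)

lemma upperEmb_left_mem {U : SimplexCategoryᵒᵖ} (z : (upperPart J B : SSet.{u}).obj U)
    (h : ∀ i, vx ((upperCut J B).app U z) i = 0 → vx ((baseCut J B).app U z.1.1) i = 0) :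
    (upperEmb J B).app U z ∈
      (SSet.Subcomplex.range (joinMap (coneIncl J) (𝟙 (upperTail J B)))).obj U := by
  refine mem_range_joinMap _ _ _ ?_ (fun V f _ => ⟨_, rfl⟩)
  intro V f hf
  have k₁ : (join _ _).map f ((upperEmb J B).app U z) =
      (upperEmb J B).app V ((upperPart J B : SSet.{u}).map f z) :=
    (NatTrans.naturality_apply _ _ _).symm
  have hf' : (upperEmb J B).app V ((upperPart J B : SSet.{u}).map f z) ∈
    (cutFiber (joinCut _ _) 0).obj V := k₁ ▸ hf
  have hz := (upperEmb_mem J B _ 0).1 hf'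
  have hz' := upperCut_zero_mem J B hz
  rw [joinLeft_congr k₁ hf hf', upperEmb_left J B _ hf' hz']
  refine mem_range_coneIncl _ ?_
  rw [joinLeft_mem_of_oneExt, mem_cutFiber]
  intro i
  have h₁ := (mem_cutFiber _ _ _).1 hz i
  rw [NatTrans.naturality_apply, vx_map] at h₁
  have e : (baseCut J B).app V ((join (rightCone J) B).map f z.1.1) =
    Δ[1].map f ((baseCut J B).app U z.1.1) := NatTrans.naturality_apply _ _ _
  exact (congrArg (fun c => vx c i) e).trans (h _ h₁)

/-- On the overlap with what is already filled, the embedded simplex lies in `J ⋆ Tail` or in `J^▷ ⋆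
tailSub`, and there the extension over the join is prescribed. The two partial maps hence agree. -/
lemma upperEmb_mem_of_mem {U : SimplexCategoryᵒᵖ} (z : (upperPart J B : SSet.{u}).obj U)
    (h : z.1 ∈ (cylSub (stepSub Y) ⊔ relPart lePart (baseCut J B) : Subfunctor _).obj U) :
    (upperEmb J B).app U z ∈
      (SSet.Subcomplex.range (joinMap (coneIncl J) (𝟙 (upperTail J B)))).obj U ∨
    (upperEmb J B).app U z ∈
      (SSet.Subcomplex.range (joinMap (𝟙 (rightCone J)) (tailSub Y).ι)).obj U := by
  rcases h with (⟨h | h, -⟩ | ⟨-, h⟩) | h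
  · refine Or.inl (upperEmb_left_mem z fun i hi => baseCut_of_mem_range h ?_)
    exact (upperCut_eq_zero J B |>.1 hi).2
  · exact Or.inr (upperEmb_right_mem z (Or.inr h))
  · rcases (mem_boundary_one _).1 h with h | h
    · exact Or.inr (upperEmb_right_mem z (Or.inl h))
    · refine Or.inl (upperEmb_left_mem z fun i hi => ?_)
      exact absurd ((upperCut_eq_zero J B |>.1 hi).1.symm.trans (h i)) zero_ne_one
  · refine Or.inl (upperEmb_left_mem z fun i hi => ?_)
    exact le_antisymm ((h i).trans (upperCut_eq_zero J B |>.1 hi).1.le) (Fin.zero_le _)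

end StepSub

/-! ## Extension of natural transformations out of colimit cones -/

/-- Colimit cones relative to a map `q`. -/
def IsRelColimitCone {J L L' : SSet.{u}} (q : L ⟶ L') (c : rightCone J ⟶ L) : Prop :=
  ∀ ⦃A B : SSet.{u}⦄ (i : A ⟶ B) [Mono i]
    (f : join J B ⟶ L) (g : join (rightCone J) A ⟶ L) (k : join (rightCone J) B ⟶ L'),
    joinInl (rightCone J) A ≫ g = c →
    joinMap (𝟙 J) i ≫ f = joinMap (coneIncl J) (𝟙 A) ≫ g →
    f ≫ q = joinMap (coneIncl J) (𝟙 B) ≫ k →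
    g ≫ q = joinMap (𝟙 (rightCone J)) i ≫ k →
    ∃ h : join (rightCone J) B ⟶ L,
      joinMap (coneIncl J) (𝟙 B) ≫ h = f ∧ joinMap (𝟙 (rightCone J)) i ≫ h = g ∧ h ≫ q = k

section StepTheorem

variable {J B : SSet.{u}}

lemma joinMap_comp {S S' S'' T T' T'' : SSet.{u}} (f : S ⟶ S') (f' : S' ⟶ S'') (g : T ⟶ T')
    (g' : T' ⟶ T'') : joinMap f g ≫ joinMap f' g' = joinMap (f ≫ f') (g ≫ g') := rfl

/-- The base of the cylinder in the upper part. -/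
def baseIncl (J B : SSet.{u}) : rightCone J ⟶ (upperPart J B : SSet.{u}) :=
  SSet.Subcomplex.lift (lift (joinInl (rightCone J) B) (constCut _ 0)) (by
    rintro U _ ⟨x, rfl⟩ i
    exact Fin.zero_le _)

lemma baseIncl_upperEmb : baseIncl J B ≫ upperEmb J B = joinInl (rightCone J) (upperTail J B) := by
  have hz : ∀ (U : SimplexCategoryᵒᵖ) (x : (rightCone J).obj U),
      (baseIncl J B).app U x ∈ (cutFiber (upperCut J B) 0).obj U := by
    intro U x
    rw [mem_cutFiber]
    intro i
    rw [upperCut_eq_zero]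
    exact ⟨rfl, (mem_cutFiber _ _ _).1 (joinInl_mem (T := B) x) i⟩
  suffices H : ∀ U x, (upperEmb J B).app U ((baseIncl J B).app U x) =
      (joinInl (rightCone J) (upperTail J B)).app U x by
    ext U x
    exact H U x
  intro U x
  have hm := (upperEmb_mem J B _ 0).2 (hz U x)
  rw [← joinInl_joinLeft _ hm, upperEmb_left J B _ hm (joinInl_mem (T := B) x)]
  exact congrArg _ (joinInl_left x _)

/-- The lower part, where `baseCut` is at most the height, is filled by inner horns. Pulling the
result back along `collapse` gives an extension problem from `J ⋆ Tail ∪ J^▷ ⋆ tailSub` to `J^▷ ⋆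
Tail` whose restriction to `J^▷` is `c`; the colimit property solves it, and `upperEmb` restricts
the solution to the upper part. -/
theorem exists_cylinder_extension {L L' : SSet.{u}} (q : L ⟶ L') [SSet.InnerFibration q]
    (c : rightCone J ⟶ L) (hc : IsRelColimitCone q c)
    {Y : (join (rightCone J) B).Subcomplex}
    (hY : Y = ⊥ ∨ ∃ (A : SSet.{u}) (i : A ⟶ B) (_ : Mono i),
      Y = SSet.Subcomplex.range (joinMap (𝟙 (rightCone J)) i))
    (t : (cylSub (stepSub Y) : SSet.{u}) ⟶ L) (k : join (rightCone J) B ⊗ Δ[1] ⟶ L')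
    (htk : t ≫ q = (cylSub (stepSub Y)).ι ≫ k)
    (ht : ∀ (U : SimplexCategoryᵒᵖ) (x : (rightCone J).obj U) (h),
      t.app U ⟨⟨(joinInl (rightCone J) B).app U x, (constCut _ 0).app U x⟩, h⟩ = c.app U x) :
    ∃ h : join (rightCone J) B ⊗ Δ[1] ⟶ L, (cylSub (stepSub Y)).ι ≫ h = t ∧ h ≫ q = k := by
  let D := relPart lePart (baseCut J B)
  let T := cylSub (stepSub Y)
  -- extension over the lower part
  obtain ⟨d, hd₁, hd₂⟩ : ∃ d : (D : SSet.{u}) ⟶ L,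
      SSet.Subcomplex.homOfLE (relBase_le leEdges_le (baseCut J B) (stepSub Y)) ≫ d =
        SSet.Subcomplex.homOfLE (relBase_le_cylSub Y) ≫ t ∧ d ≫ q = D.ι ≫ k := by
    have sq : CommSq (SSet.Subcomplex.homOfLE (relBase_le_cylSub Y) ≫ t)
        (SSet.Subcomplex.homOfLE (relBase_le leEdges_le (baseCut J B) (stepSub Y))) q
        (D.ι ≫ k) := ⟨by rw [Category.assoc, htk]; rfl⟩
    obtain ⟨⟨d, hd₁, hd₂⟩⟩ :=
      ((hasLiftingProperty_relBase q (baseCut J B) (stepSub Y)).sq_hasLift sq).exists_lift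
    exact ⟨d, hd₁, hd₂⟩
  obtain ⟨m, hm₁, hm₂⟩ := exists_glue_sup T D t d (by
    intro U x hT hD
    exact (ConcreteCategory.congr_hom (NatTrans.congr_app hd₁ U)
      ⟨x, inf_le_relBase Y U ⟨hT, hD⟩⟩).symm)
  have hmq : m ≫ q = (T ⊔ D).ι ≫ k := by
    ext U ⟨x, hx | hx⟩
    · have k₁ := ConcreteCategory.congr_hom (NatTrans.congr_app hm₁ U) ⟨x, hx⟩
      have k₂ := ConcreteCategory.congr_hom (NatTrans.congr_app htk U) ⟨x, hx⟩
      exact (congrArg (q.app U) k₁).trans k₂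
    · have k₁ := ConcreteCategory.congr_hom (NatTrans.congr_app hm₂ U) ⟨x, hx⟩
      have k₂ := ConcreteCategory.congr_hom (NatTrans.congr_app hd₂ U) ⟨x, hx⟩
      exact (congrArg (q.app U) k₁).trans k₂
  -- extension over the upper part
  let i := (tailSub Y).ι
  let φ₁ : join J (upperTail J B) ⟶ ((T ⊔ D : Subfunctor _) : SSet.{u}) :=
    SSet.Subcomplex.lift (joinMap (coneIncl J) (𝟙 _) ≫ collapse J B) (by
      rintro U _ ⟨y, rfl⟩
      exact collapse_left_mem Y ⟨y, rfl⟩)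
  let φ₂ : join (rightCone J) (tailSub Y : SSet.{u}) ⟶ ((T ⊔ D : Subfunctor _) : SSet.{u}) :=
    SSet.Subcomplex.lift (joinMap (𝟙 _) i ≫ collapse J B) (by
      rintro U _ ⟨y, rfl⟩
      exact Or.inl (collapse_right_mem hY ⟨y, rfl⟩))
  have hφ : joinMap (𝟙 J) i ≫ φ₁ = joinMap (coneIncl J) (𝟙 _) ≫ φ₂ := rfl
  -- The first factor of the join collapses to `J^▷` at height `0`, where the given map is the cone.
  have hcg : joinInl (rightCone J) (tailSub Y : SSet.{u}) ≫ φ₂ ≫ m = c := by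
    have e : joinInl (rightCone J) (tailSub Y : SSet.{u}) ≫ joinMap (𝟙 _) i ≫ collapse J B =
        lift (joinInl (rightCone J) B) (constCut _ 0) := by
      rw [← Category.assoc, joinInl_naturality, Category.id_comp, ← baseIncl_upperEmb,
        Category.assoc, upperEmb_collapse]
      rfl
    let c' : rightCone J ⟶ (T : SSet.{u}) :=
      SSet.Subcomplex.lift (lift (joinInl (rightCone J) B) (constCut _ 0)) (by
        rintro U _ ⟨x, rfl⟩
        exact mem_cylSub_of_right _ (Or.inl fun _ => rfl))
    have e₁ : joinInl (rightCone J) (tailSub Y : SSet.{u}) ≫ φ₂ =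
        c' ≫ SSet.Subcomplex.homOfLE le_sup_left := by
      rw [← cancel_mono (T ⊔ D).ι]
      exact e
    have e₂ : c' ≫ t = c := by
      ext U x
      exact ht U x _
    rw [← Category.assoc, e₁, Category.assoc]
    exact (congrArg (fun φ => c' ≫ φ) hm₁).trans e₂
  obtain ⟨h', hf, hg, hk⟩ := hc i (φ₁ ≫ m) (φ₂ ≫ m) (collapse J B ≫ k) hcg
    (by rw [← Category.assoc, ← Category.assoc, hφ])
    (by rw [Category.assoc, hmq]; rfl) (by rw [Category.assoc, hmq]; rfl)
  have hcov : ∀ (U : SimplexCategoryᵒᵖ) (x : (join (rightCone J) B ⊗ Δ[1]).obj U),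
      (∃ p, (T ⊔ D).ι.app U p = x) ∨ ∃ p, (upperPart J B).ι.app U p = x := by
    intro U x
    rcases mem_relPart_or_mem_upperPart x with hx | hx
    · exact Or.inl ⟨⟨x, Or.inr hx⟩, rfl⟩
    · exact Or.inr ⟨⟨x, hx⟩, rfl⟩
  have hcoll : ∀ (U : SimplexCategoryᵒᵖ) (z : (upperPart J B : SSet.{u}).obj U),
      (collapse J B).app U ((upperEmb J B).app U z) = z.1 := fun U z =>
    ConcreteCategory.congr_hom (NatTrans.congr_app (upperEmb_collapse J B) U) z
  obtain ⟨h, hh₁, hh₂⟩ := exists_glue (T ⊔ D).ι (upperPart J B).ι m (upperEmb J B ≫ h') hcov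
    (fun U p p' e => by rw [Subtype.ext e]) (fun U p p' e => by rw [Subtype.ext e]) (by
      rintro U ⟨p, hp⟩ z rfl
      change m.app U ⟨z.1, hp⟩ = h'.app U ((upperEmb J B).app U z)
      have hz := hcoll U z
      rcases upperEmb_mem_of_mem z hp with ⟨y, hy⟩ | ⟨y, hy⟩
      · rw [← hy] at hz ⊢
        refine Eq.trans ?_ (ConcreteCategory.congr_hom (NatTrans.congr_app hf U) y).symm
        exact congrArg (m.app U) (Subtype.ext hz.symm)
      · rw [← hy] at hz ⊢
        refine Eq.trans ?_ (ConcreteCategory.congr_hom (NatTrans.congr_app hg U) y).symm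
        exact congrArg (m.app U) (Subtype.ext hz.symm))
  refine ⟨h, ?_, ?_⟩
  · rw [← hm₁, ← hh₁]
    rfl
  · suffices H : ∀ U x, q.app U (h.app U x) = k.app U x by
      ext U x
      exact H U x
    intro U x
    obtain ⟨p, rfl⟩ | ⟨z, rfl⟩ := hcov U x
    · have k₁ := ConcreteCategory.congr_hom (NatTrans.congr_app hh₁ U) p
      have k₂ := ConcreteCategory.congr_hom (NatTrans.congr_app hmq U) p
      exact (congrArg (q.app U) k₁).trans k₂
    · have k₁ := ConcreteCategory.congr_hom (NatTrans.congr_app hh₂ U) z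
      have k₂ := ConcreteCategory.congr_hom (NatTrans.congr_app hk U) ((upperEmb J B).app U z)
      exact (congrArg (q.app U) k₁).trans (k₂.trans (congrArg (k.app U) (hcoll U z)))

end StepTheorem

/-! ## Extension along right deformation retracts of joins -/

section Deformation

variable {S T : SSet.{u}} (h : S ⊗ Δ[1] ⟶ S)

/-- The first component of `joinHomotopy`. -/
def joinHomotopyLeft (T : SSet.{u}) :
    (cutFiber (fst (join S T) Δ[1] ≫ joinCut S T) 0 : SSet.{u}) ⟶ S :=
  lift (cutFiberMap (fst (join S T) Δ[1]) (joinCut S T) 0 ≫ joinLeft S T)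
    ((cutFiber _ 0).ι ≫ snd _ _) ≫ h

/-- The homotopy of a join induced by a homotopy of the first factor. -/
def joinHomotopy (T : SSet.{u}) : join S T ⊗ Δ[1] ⟶ join S T :=
  joinLift (fst _ _ ≫ joinCut S T) (joinHomotopyLeft h T)
    (cutFiberMap (fst (join S T) Δ[1]) (joinCut S T) 1 ≫ joinRight S T)

lemma joinHomotopy_cut : joinHomotopy h T ≫ joinCut S T = fst _ _ ≫ joinCut S T :=
  joinLift_cut _ _ _

lemma joinHomotopy_mem {U : SimplexCategoryᵒᵖ} (z : (join S T ⊗ Δ[1]).obj U) (ε : Fin 2) :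
    (joinHomotopy h T).app U z ∈ (cutFiber (joinCut S T) ε).obj U ↔
      z.1 ∈ (cutFiber (joinCut S T) ε).obj U := joinLift_mem _ _ _ _ _

lemma joinHomotopy_left {U : SimplexCategoryᵒᵖ} (z : (join S T).obj U)
    (e : (Δ[1] : SSet.{u}).obj U) (hz : z ∈ (cutFiber (joinCut S T) 0).obj U)
    (hz' : (joinHomotopy h T).app U ⟨z, e⟩ ∈ (cutFiber (joinCut S T) 0).obj U) :
    (joinLeft S T).app U ⟨_, hz'⟩ = h.app U ⟨(joinLeft S T).app U ⟨z, hz⟩, e⟩ :=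
  joinLift_left (fst _ _ ≫ joinCut S T) (joinHomotopyLeft h T)
    (cutFiberMap (fst (join S T) Δ[1]) (joinCut S T) 1 ≫ joinRight S T)
    (⟨z, e⟩ : (join S T ⊗ Δ[1]).obj U) hz hz'

lemma joinHomotopy_right {U : SimplexCategoryᵒᵖ} (z : (join S T).obj U)
    (e : (Δ[1] : SSet.{u}).obj U) (hz : z ∈ (cutFiber (joinCut S T) 1).obj U)
    (hz' : (joinHomotopy h T).app U ⟨z, e⟩ ∈ (cutFiber (joinCut S T) 1).obj U) :
    (joinRight S T).app U ⟨_, hz'⟩ = (joinRight S T).app U ⟨z, hz⟩ :=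
  joinLift_right (fst _ _ ≫ joinCut S T) (joinHomotopyLeft h T)
    (cutFiberMap (fst (join S T) Δ[1]) (joinCut S T) 1 ≫ joinRight S T)
    (⟨z, e⟩ : (join S T ⊗ Δ[1]).obj U) hz hz'

attribute [irreducible] joinHomotopy

variable (S₀ : S.Subcomplex) (T₀ : T.Subcomplex)

/-- The union of the joins `S₀ ⋆ T` and `S ⋆ T₀`. -/
def joinUnion : (join S T).Subcomplex :=
  SSet.Subcomplex.range (joinMap S₀.ι (𝟙 T)) ⊔ SSet.Subcomplex.range (joinMap (𝟙 S) T₀.ι)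

variable {S₀ T₀}

lemma mem_joinUnion_of_left {U : SimplexCategoryᵒᵖ} (z : (join S T).obj U)
    (hz : ∀ (V : SimplexCategoryᵒᵖ) (f : U ⟶ V)
      (hf : (join S T).map f z ∈ (cutFiber (joinCut S T) 0).obj V),
      (joinLeft S T).app V ⟨_, hf⟩ ∈ S₀.obj V) : z ∈ (joinUnion S₀ T₀).obj U :=
  Or.inl (mem_range_joinMap _ _ z (fun V f hf => ⟨⟨_, hz V f hf⟩, rfl⟩) fun _ _ _ => ⟨_, rfl⟩)

lemma mem_joinUnion_of_right {U : SimplexCategoryᵒᵖ} (z : (join S T).obj U)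
    (hz : ∀ (V : SimplexCategoryᵒᵖ) (f : U ⟶ V)
      (hf : (join S T).map f z ∈ (cutFiber (joinCut S T) 1).obj V),
      (joinRight S T).app V ⟨_, hf⟩ ∈ T₀.obj V) : z ∈ (joinUnion S₀ T₀).obj U :=
  Or.inr (mem_range_joinMap _ _ z (fun _ _ _ => ⟨_, rfl⟩) fun V f hf => ⟨⟨_, hz V f hf⟩, rfl⟩)

lemma joinLeft_mem_of_range (A : S.Subcomplex) {U : SimplexCategoryᵒᵖ}
    {z : (join S T).obj U} (hz : z ∈ (SSet.Subcomplex.range (joinMap A.ι (𝟙 T))).obj U)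
    (h : z ∈ (cutFiber (joinCut S T) 0).obj U) : (joinLeft S T).app U ⟨z, h⟩ ∈ A.obj U := by
  obtain ⟨y, rfl⟩ := hz
  rw [joinMap_left _ _ y ((joinMap_mem _ _ y 0).1 h)]
  exact Subtype.prop _

lemma mem_joinUnion {U : SimplexCategoryᵒᵖ} {z : (join S T).obj U}
    (hz : z ∈ (joinUnion S₀ T₀).obj U) :
    (∀ (V : SimplexCategoryᵒᵖ) (f : U ⟶ V)
      (hf : (join S T).map f z ∈ (cutFiber (joinCut S T) 0).obj V),
      (joinLeft S T).app V ⟨_, hf⟩ ∈ S₀.obj V) ∨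
    ∀ (V : SimplexCategoryᵒᵖ) (f : U ⟶ V)
      (hf : (join S T).map f z ∈ (cutFiber (joinCut S T) 1).obj V),
      (joinRight S T).app V ⟨_, hf⟩ ∈ T₀.obj V := by
  rcases hz with hz | hz
  · exact Or.inl fun V f hf => joinLeft_mem_of_range S₀ (subcomplex_map_mem _ f hz) hf
  · exact Or.inr fun V f hf => joinRight_mem_of_range T₀ (subcomplex_map_mem _ f hz) hf

/-- The inclusion of `S₀ ⋆ T ∪ S ⋆ T₀` is a retract of one covered by `hasLiftingProperty_relBase`.
The section is the graph of the cut `χ`; the retraction applies the homotopy to the component in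
`S`. -/
theorem exists_joinUnion_extension {K : SSet.{u}} [SSet.Quasicategory K]
    (h₀ : ∀ (U : SimplexCategoryᵒᵖ) (s : S.obj U) (e : (Δ[1] : SSet.{u}).obj U),
      (∀ i, vx e i = 0) → h.app U ⟨s, e⟩ = s)
    (h₁ : ∀ (U : SimplexCategoryᵒᵖ) (s : S.obj U) (e : (Δ[1] : SSet.{u}).obj U),
      (∀ i, vx e i = 1) → h.app U ⟨s, e⟩ ∈ S₀.obj U)
    (h₂ : ∀ (U : SimplexCategoryᵒᵖ) (s : S.obj U) (e : (Δ[1] : SSet.{u}).obj U),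
      s ∈ S₀.obj U → h.app U ⟨s, e⟩ ∈ S₀.obj U)
    (t : (joinUnion S₀ T₀ : SSet.{u}) ⟶ K) :
    ∃ t' : join S T ⟶ K, (joinUnion S₀ T₀).ι ≫ t' = t := by
  let χ := joinCut S T
  have hmap : ∀ (U V : SimplexCategoryᵒᵖ) (f : U ⟶ V) (z : (join S T ⊗ Δ[1]).obj U),
      (join S T).map f ((joinHomotopy h T).app U z) =
        (joinHomotopy h T).app V ⟨(join S T).map f z.1, Δ[1].map f z.2⟩ := fun U V f z =>
    (NatTrans.naturality_apply (joinHomotopy h T) f z).symm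
  have hbase : ∀ (U : SimplexCategoryᵒᵖ) (z : (join S T ⊗ Δ[1]).obj U),
      z ∈ (relBase lePart leEdges χ (joinUnion S₀ T₀)).obj U →
        (joinHomotopy h T).app U z ∈ (joinUnion S₀ T₀).obj U := by
    -- Where `χ = 0` there is no component in `T`; at height `1` the homotopy has moved `S` into
    -- `S₀`; over the union itself, both conditions are preserved.
    rintro U z ((hz | hz) | ⟨-, hz, -⟩)
    · refine mem_joinUnion_of_right _ fun V f hf => ?_
      rw [hmap] at hf
      have hf' := (joinHomotopy_mem h _ 1).1 hf
      have hz' : z.1 ∈ (cutFiber χ 0).obj U := (mem_cutFiber _ _ _).2 hz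
      exact (cutFiber_disjoint _ (subcomplex_map_mem _ f hz') hf').elim
    · refine mem_joinUnion_of_left _ fun V f hf => ?_
      have k := hmap U V f z
      refine Set.mem_of_eq_of_mem ((joinLeft_congr k hf (k ▸ hf)).trans (joinHomotopy_left h _ _
        ((joinHomotopy_mem h _ 0).1 (k ▸ hf)) _)) ?_
      exact h₁ _ _ _ fun i => hz _
    · rcases mem_joinUnion hz with hz | hz
      · refine mem_joinUnion_of_left _ fun V f hf => ?_
        have k := hmap U V f z
        refine Set.mem_of_eq_of_mem ((joinLeft_congr k hf (k ▸ hf)).trans (joinHomotopy_left h _ _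
        ((joinHomotopy_mem h _ 0).1 (k ▸ hf)) _)) ?_
        exact h₂ _ _ _ (hz V f _)
      · refine mem_joinUnion_of_right _ fun V f hf => ?_
        have k := hmap U V f z
        refine Set.mem_of_eq_of_mem ((joinRight_congr k hf (k ▸ hf)).trans (joinHomotopy_right h _ _
        ((joinHomotopy_mem h _ 1).1 (k ▸ hf)) _)) ?_
        exact hz V f _
  let b : (relBase lePart leEdges χ (joinUnion S₀ T₀) : SSet.{u}) ⟶ joinUnion S₀ T₀ :=
    SSet.Subcomplex.lift ((relBase lePart leEdges χ (joinUnion S₀ T₀)).ι ≫ joinHomotopy h T) (by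
      rintro U _ ⟨z, rfl⟩
      exact hbase U z.1 z.2)
  have sq : CommSq (b ≫ t)
      (SSet.Subcomplex.homOfLE (relBase_le leEdges_le χ (joinUnion S₀ T₀)))
      (Limits.terminal.from K) (Limits.terminal.from _) := ⟨Limits.terminal.hom_ext _ _⟩
  obtain ⟨⟨d, hd, -⟩⟩ := ((hasLiftingProperty_relBase (Limits.terminal.from K) χ
    (joinUnion S₀ T₀)).sq_hasLift sq).exists_lift
  let j : join S T ⟶ (relPart lePart χ : SSet.{u}) :=
    SSet.Subcomplex.lift (lift (𝟙 _) χ) (by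
      rintro U _ ⟨z, rfl⟩ i
      exact le_rfl)
  -- On the component in `S` the graph has height `0`, where the homotopy is the identity.
  have hj : lift (𝟙 _) χ ≫ joinHomotopy h T = 𝟙 _ := by
    refine join_hom_ext ?_ ?_ ?_
    · rw [Category.assoc, joinHomotopy_cut, lift_fst_assoc]
    · intro U z ha hb
      refine (joinHomotopy_left h z (χ.app U z) hb ha).trans ?_
      exact h₀ _ _ _ ((mem_cutFiber _ _ _).1 hb)
    · intro U z ha hb
      exact joinHomotopy_right h z (χ.app U z) hb ha
  refine ⟨j ≫ d, ?_⟩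
  let j₀ : (joinUnion S₀ T₀ : SSet.{u}) ⟶
      (relBase lePart leEdges χ (joinUnion S₀ T₀) : SSet.{u}) :=
    SSet.Subcomplex.lift ((joinUnion S₀ T₀).ι ≫ lift (𝟙 _) χ) (by
      rintro U _ ⟨z, rfl⟩
      exact Or.inr ⟨fun i => le_rfl, z.2, trivial⟩)
  have e₁ : j₀ ≫ b = 𝟙 _ := by
    rw [← cancel_mono (joinUnion S₀ T₀).ι, Category.id_comp]
    exact congrArg (fun φ => (joinUnion S₀ T₀).ι ≫ φ) hj
  have e₂ := congrArg (fun φ => j₀ ≫ φ) hd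
  refine e₂.trans ?_
  rw [← Category.assoc, e₁, Category.id_comp]

end Deformation

/-! ## Maps from joins to simplices -/

section JoinToSimplex

variable {S T : SSet.{u}} {n k : ℕ}

/-- The map of standard simplices induced by a monotone map. -/
def simplexMap (g : Fin (n + 1) → Fin (k + 1)) (hg : Monotone g) :
    (Δ[n] : SSet.{u}) ⟶ Δ[k] where
  app _ := ↾fun x => vxMk (fun i => g (vx x i)) fun _ _ h => hg (vx_mono x h)
  naturality _ _ _ := rfl

lemma mem_cutFiber_zero_or_one {X : SSet.{u}} (χ : X ⟶ Δ[1]) (x : X _⦋0⦌) :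
    x ∈ (cutFiber χ 0).obj _ ∨ x ∈ (cutFiber χ 1).obj _ := by
  by_cases h : vx (χ.app _ x) 0 = 0
  · exact Or.inl (vertex_mem_cutFiber χ x h)
  · exact Or.inr (vertex_mem_cutFiber χ x (by lia))

variable (p : S ⟶ Δ[k]) (q : T ⟶ Δ[k])

open Classical in
/-- The values on vertices of `joinToSimplex`. -/
def joinToSimplexVx (z : (join S T) _⦋0⦌) : Fin (k + 1) :=
  if h : z ∈ (cutFiber (joinCut S T) 0).obj _ then vx (p.app _ ((joinLeft S T).app _ ⟨z, h⟩)) 0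
  else vx (q.app _ ((joinRight S T).app _
    ⟨z, (mem_cutFiber_zero_or_one (joinCut S T) z).resolve_left h⟩)) 0

lemma joinToSimplexVx_left {U : SimplexCategoryᵒᵖ} (z : (join S T).obj U)
    (h : z ∈ (cutFiber (joinCut S T) 0).obj U) (i) :
    joinToSimplexVx p q ((join S T).map (vertexHom U i) z) =
      vx (p.app U ((joinLeft S T).app U ⟨z, h⟩)) i := by
  rw [joinToSimplexVx, dif_pos (subcomplex_map_mem _ _ h), joinLeft_map _ z h, ← vx_vertex]

lemma joinToSimplexVx_right {U : SimplexCategoryᵒᵖ} (z : (join S T).obj U)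
    (h : z ∈ (cutFiber (joinCut S T) 1).obj U) (i) :
    joinToSimplexVx p q ((join S T).map (vertexHom U i) z) =
      vx (q.app U ((joinRight S T).app U ⟨z, h⟩)) i := by
  rw [joinToSimplexVx, dif_neg fun h' => cutFiber_disjoint _ h' (subcomplex_map_mem _ _ h),
    joinRight_map _ z h, ← vx_vertex]

lemma joinToSimplexVx_left_of_le {U : SimplexCategoryᵒᵖ} (z : (join S T).obj U) {i j}
    (hij : i ≤ j) (h : vx ((joinCut S T).app U z) j = 0) :
    joinToSimplexVx p q ((join S T).map (vertexHom U i) z) =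
      vx (p.app U ((joinLeft S T).app U ⟨_, map_headHom_mem _ z h⟩)) i := by
  rw [← joinToSimplexVx_left p q, ← Functor.map_comp_apply, headHom_vertexHom U hij]

lemma joinToSimplexVx_right_of_le {U : SimplexCategoryᵒᵖ} (z : (join S T).obj U) {i j}
    (hij : i ≤ j) (h : vx ((joinCut S T).app U z) i = 1) :
    joinToSimplexVx p q ((join S T).map (vertexHom U j) z) =
      vx (q.app U ((joinRight S T).app U ⟨_, map_tailHom_mem _ z h⟩)) j := by
  rw [← joinToSimplexVx_right p q, ← Functor.map_comp_apply, tailHom_vertexHom U hij]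

variable (hpq : ∃ l, (∀ (U : SimplexCategoryᵒᵖ) (s : S.obj U) (i), vx (p.app U s) i ≤ l) ∧
  ∀ (U : SimplexCategoryᵒᵖ) (t : T.obj U) (i), l ≤ vx (q.app U t) i)

/-- The map from a join to a simplex whose restrictions to the factors are given. -/
def joinToSimplex : join S T ⟶ Δ[k] :=
  homOfVx (joinToSimplexVx p q) fun U z i j hij => by
    obtain ⟨l, hl, hr⟩ := hpq
    by_cases hi : vx ((joinCut S T).app U z) i = 0
    · by_cases hj : vx ((joinCut S T).app U z) j = 0
      · rw [joinToSimplexVx_left_of_le p q z hij hj, joinToSimplexVx_left_of_le p q z le_rfl hj]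
        exact vx_mono _ hij
      · rw [joinToSimplexVx_left_of_le p q z le_rfl hi,
          joinToSimplexVx_right_of_le p q z le_rfl (by lia : vx ((joinCut S T).app U z) j = 1)]
        exact (hl _ _ _).trans (hr _ _ _)
    · have hi' : vx ((joinCut S T).app U z) i = 1 := by lia
      rw [joinToSimplexVx_right_of_le p q z le_rfl hi', joinToSimplexVx_right_of_le p q z hij hi']
      exact vx_mono _ hij

lemma vx_joinToSimplex_left {U : SimplexCategoryᵒᵖ} (z : (join S T).obj U) {i j}
    (hij : i ≤ j) (h : vx ((joinCut S T).app U z) j = 0) :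
    vx ((joinToSimplex p q hpq).app U z) i =
      vx (p.app U ((joinLeft S T).app U ⟨_, map_headHom_mem _ z h⟩)) i :=
  joinToSimplexVx_left_of_le p q z hij h

lemma vx_joinToSimplex_right {U : SimplexCategoryᵒᵖ} (z : (join S T).obj U) {i j}
    (hij : i ≤ j) (h : vx ((joinCut S T).app U z) i = 1) :
    vx ((joinToSimplex p q hpq).app U z) j =
      vx (q.app U ((joinRight S T).app U ⟨_, map_tailHom_mem _ z h⟩)) j :=
  joinToSimplexVx_right_of_le p q z hij h

lemma exists_last {U : SimplexCategoryᵒᵖ} (c : (Δ[1] : SSet.{u}).obj U)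
    (h : ¬ ∀ i, vx c i = 1) : ∃ i, vx c i = 0 ∧ ∀ j, vx c j = 0 → j ≤ i := by
  classical
  push Not at h
  obtain ⟨i₀, h₀⟩ := h
  obtain ⟨i, hi, hmax⟩ := (Finset.univ.filter fun i => vx c i = 0).exists_max_image id
    ⟨i₀, Finset.mem_filter.2 ⟨Finset.mem_univ _, by lia⟩⟩
  exact ⟨i, (Finset.mem_filter.1 hi).2,
    fun j hj => hmax j (Finset.mem_filter.2 ⟨Finset.mem_univ _, hj⟩)⟩

end JoinToSimplex

/-! ## Extension along retracts -/

/-- A map extends to a larger subcomplex if the new simplices are in a retract of an object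
over which the corresponding extension problem can be solved. -/
lemma exists_extension_of_retract {X W K : SSet.{u}} {Ω Ω' P : X.Subcomplex} {W₀ : W.Subcomplex}
    (hΩ : Ω ≤ Ω') (a : X ⟶ W) (b : W ⟶ X)
    (hΩ' : ∀ (U : SimplexCategoryᵒᵖ) (x : X.obj U), x ∈ Ω'.obj U → x ∈ Ω.obj U ∨ x ∈ P.obj U)
    (hab : ∀ (U : SimplexCategoryᵒᵖ) (x : X.obj U), x ∈ P.obj U → b.app U (a.app U x) = x)
    (ha : ∀ (U : SimplexCategoryᵒᵖ) (x : X.obj U), x ∈ P.obj U → x ∈ Ω.obj U →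
      a.app U x ∈ W₀.obj U)
    (hb : ∀ (U : SimplexCategoryᵒᵖ) (w : W.obj U), w ∈ W₀.obj U → b.app U w ∈ Ω.obj U)
    (t : (Ω : SSet.{u}) ⟶ K)
    (hW : ∀ s : (W₀ : SSet.{u}) ⟶ K,
      (∀ (U : SimplexCategoryᵒᵖ) (w : W.obj U) (h : w ∈ W₀.obj U),
        s.app U ⟨w, h⟩ = t.app U ⟨b.app U w, hb U w h⟩) → ∃ s' : W ⟶ K, W₀.ι ≫ s' = s) :
    ∃ t' : (Ω' : SSet.{u}) ⟶ K, SSet.Subcomplex.homOfLE hΩ ≫ t' = t := by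
  let b₀ : (W₀ : SSet.{u}) ⟶ Ω := SSet.Subcomplex.lift (W₀.ι ≫ b) (by
    rintro U _ ⟨w, rfl⟩
    exact hb U w.1 w.2)
  obtain ⟨s', hs'⟩ := hW (b₀ ≫ t) fun _ _ _ => rfl
  -- On the overlap `a` lands in `W₀`, where the solution is `t` after `b`, and `b` undoes `a`.
  obtain ⟨m, hm, -⟩ := exists_glue_sup Ω P t (P.ι ≫ a ≫ s') fun U x hx hx' => by
    refine Eq.trans ?_
      (congrArg (fun φ => φ.app U ⟨a.app U x, ha U x hx' hx⟩) hs').symm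
    exact congrArg (t.app U) (Subtype.ext (hab U x hx').symm)
  refine ⟨SSet.Subcomplex.homOfLE (show Ω' ≤ Ω ⊔ P from fun U x hx => hΩ' U x hx) ≫ m, ?_⟩
  exact hm

/-! ## Extending a colimit cone to a cylinder -/

section CylinderFiltration

variable (J : SSet.{u}) (m : ℕ)

/-- The part of `J^▷ ⊗ Δ[m]` consisting of `J ⊗ Δ[m]` and `J^▷ ⊗ ∂Δ[m]`. -/
def cylBase : (rightCone J ⊗ Δ[m]).Subcomplex :=
  (cutFiber (joinCut J Δ[0]) 0).prod ⊤ ⊔ (⊤ : (rightCone J).Subcomplex).prod ∂Δ[m]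

/-- The simplices of `J^▷ ⊗ Δ[m]` whose second coordinate is at most `l` on `J` and
at least `l` on the cone point. -/
def cylPart (l : ℕ) : (rightCone J ⊗ Δ[m]).Subcomplex where
  obj U := {z | ∀ i, (vx ((joinCut J Δ[0]).app U z.1) i = 0 → (vx z.2 i : ℕ) ≤ l) ∧
    (vx ((joinCut J Δ[0]).app U z.1) i = 1 → l ≤ (vx z.2 i : ℕ))}
  map {U V} f z hz i := by
    have := hz (f.unop.toOrderHom i)
    rw [← vx_map f, ← NatTrans.naturality_apply] at this
    exact this

/-- A filtration of `J^▷ ⊗ Δ[m]`. -/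
def cylFilt (l : ℕ) : (rightCone J ⊗ Δ[m]).Subcomplex where
  obj U := {z | z ∈ (cylBase J m).obj U ∨ ∃ l', l ≤ l' ∧ z ∈ (cylPart J m l').obj U}
  map {U V} f z := by
    rintro (hz | ⟨l', hl, hz⟩)
    · exact Or.inl (subcomplex_map_mem _ f hz)
    · exact Or.inr ⟨l', hl, subcomplex_map_mem _ f hz⟩

variable {J m}

lemma mem_cylBase_of_cut {U : SimplexCategoryᵒᵖ} (z : (rightCone J ⊗ Δ[m]).obj U)
    (h : ∀ i, vx ((joinCut J Δ[0]).app U z.1) i = 0) : z ∈ (cylBase J m).obj U :=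
  Or.inl ⟨(mem_cutFiber _ _ _).2 h, trivial⟩

lemma mem_cylBase_of_ne {U : SimplexCategoryᵒᵖ} (z : (rightCone J ⊗ Δ[m]).obj U) (j : Fin (m + 1))
    (h : ∀ i, vx z.2 i ≠ j) : z ∈ (cylBase J m).obj U :=
  Or.inr ⟨trivial, (mem_boundary_vx _).2 ⟨j, h⟩⟩

lemma mem_cylBase {U : SimplexCategoryᵒᵖ} {z : (rightCone J ⊗ Δ[m]).obj U}
    (hz : z ∈ (cylBase J m).obj U) :
    (∀ i, vx ((joinCut J Δ[0]).app U z.1) i = 0) ∨ ∃ j, ∀ i, vx z.2 i ≠ j := by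
  rcases hz with hz | hz
  · exact Or.inl ((mem_cutFiber _ _ _).1 hz.1)
  · exact Or.inr ((mem_boundary_vx _).1 hz.2)

lemma cylBase_le_cylFilt (l : ℕ) : cylBase J m ≤ cylFilt J m l := fun _ _ hz => Or.inl hz

lemma cylFilt_succ_le (l : ℕ) : cylFilt J m (l + 1) ≤ cylFilt J m l := by
  rintro U z (hz | ⟨l', hl, hz⟩)
  · exact Or.inl hz
  · exact Or.inr ⟨l', by lia, hz⟩

lemma mem_cylFilt_or {U : SimplexCategoryᵒᵖ} {z : (rightCone J ⊗ Δ[m]).obj U} {l : ℕ}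
    (hz : z ∈ (cylFilt J m l).obj U) :
    z ∈ (cylFilt J m (l + 1)).obj U ∨ z ∈ (cylPart J m l).obj U := by
  rcases hz with hz | ⟨l', hl, hz⟩
  · exact Or.inl (Or.inl hz)
  · by_cases h : l' = l
    · exact Or.inr (h ▸ hz)
    · exact Or.inl (Or.inr ⟨l', by lia, hz⟩)

/-- A vertex at the cone point would need second coordinate at least `m + 1`, so only simplices over
`J` are left. -/
lemma cylFilt_last_le : cylFilt J m (m + 1) ≤ cylBase J m := by
  rintro U z (hz | ⟨l', hl, hz⟩)
  · exact hz
  · refine mem_cylBase_of_cut _ fun i => ?_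
    by_contra h
    have := (hz i).2 (by lia)
    have := (vx z.2 i).2
    lia

/-- The vertices over `J` precede those at the cone point. The second coordinate of the last one
over `J` therefore separates the two groups; if there is none, `0` does. -/
lemma mem_cylFilt_zero {U : SimplexCategoryᵒᵖ} (z : (rightCone J ⊗ Δ[m]).obj U) :
    z ∈ (cylFilt J m 0).obj U := by
  refine Or.inr ?_
  by_cases h : ∀ i, vx ((joinCut J Δ[0]).app U z.1) i = 1
  · refine ⟨0, le_rfl, fun i => ⟨fun h' => ?_, fun _ => Nat.zero_le _⟩⟩
    exact absurd ((h i).symm.trans h') one_ne_zero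
  · obtain ⟨j, hj, hmax⟩ := exists_last _ h
    refine ⟨vx z.2 j, Nat.zero_le _, fun i => ⟨fun hi => ?_, fun hi => ?_⟩⟩
    · exact Fin.le_def.1 (vx_mono _ (hmax i hi))
    · refine Fin.le_def.1 (vx_mono _ (le_of_not_ge fun hij => ?_))
      exact absurd ((vx_mono ((joinCut J Δ[0]).app U z.1) hij).trans hj.le) (by lia)

/-! ### The parts of the filtration as joins -/

variable (J m) in
/-- The first component of `cylSplit`. -/
def cylSplitLeft : (cutFiber (fst (rightCone J) Δ[m] ≫ joinCut J Δ[0]) 0 : SSet.{u}) ⟶ J ⊗ Δ[m] :=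
  lift (cutFiberMap (fst (rightCone J) Δ[m]) (joinCut J Δ[0]) 0 ≫ joinLeft J Δ[0])
    ((cutFiber (fst (rightCone J) Δ[m] ≫ joinCut J Δ[0]) 0).ι ≫ snd _ _)

variable (J m) in
/-- The map from the cylinder to a join which separates `J` and the cone point. -/
def cylSplit : rightCone J ⊗ Δ[m] ⟶ join (J ⊗ Δ[m]) Δ[m] :=
  joinLift (fst _ _ ≫ joinCut J Δ[0]) (cylSplitLeft J m)
    ((cutFiber (fst (rightCone J) Δ[m] ≫ joinCut J Δ[0]) 1).ι ≫ snd _ _)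

variable (J m) in
lemma cylSplit_cut : cylSplit J m ≫ joinCut _ _ = fst _ _ ≫ joinCut J Δ[0] := joinLift_cut _ _ _

lemma vx_cylSplit_cut {U : SimplexCategoryᵒᵖ} (z : (rightCone J ⊗ Δ[m]).obj U) (i) :
    vx ((joinCut _ _).app U ((cylSplit J m).app U z)) i = vx ((joinCut J Δ[0]).app U z.1) i :=
  congrArg (fun φ => vx (φ.app U z) i) (cylSplit_cut J m)

lemma cylSplit_mem {U : SimplexCategoryᵒᵖ} (z : (rightCone J ⊗ Δ[m]).obj U) (ε : Fin 2) :
    (cylSplit J m).app U z ∈ (cutFiber (joinCut _ _) ε).obj U ↔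
      z.1 ∈ (cutFiber (joinCut J Δ[0]) ε).obj U := joinLift_mem _ _ _ _ _

lemma cylSplit_left {U : SimplexCategoryᵒᵖ} (z : (rightCone J ⊗ Δ[m]).obj U)
    (h' : (cylSplit J m).app U z ∈ (cutFiber (joinCut _ _) 0).obj U)
    (h : z.1 ∈ (cutFiber (joinCut J Δ[0]) 0).obj U) :
    (joinLeft _ _).app U ⟨_, h'⟩ = ((joinLeft _ _).app U ⟨_, h⟩, z.2) :=
  joinLift_left (fst _ _ ≫ joinCut J Δ[0]) (cylSplitLeft J m)
    ((cutFiber (fst (rightCone J) Δ[m] ≫ joinCut J Δ[0]) 1).ι ≫ snd _ _) z h h'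

lemma cylSplit_right {U : SimplexCategoryᵒᵖ} (z : (rightCone J ⊗ Δ[m]).obj U)
    (h' : (cylSplit J m).app U z ∈ (cutFiber (joinCut _ _) 1).obj U) :
    (joinRight _ _).app U ⟨_, h'⟩ = z.2 :=
  joinLift_right (fst _ _ ≫ joinCut J Δ[0]) _ _ z ((cylSplit_mem z 1).1 h') h'

attribute [irreducible] cylSplit

lemma cylSplit_left_map {U V : SimplexCategoryᵒᵖ} (f : U ⟶ V) (z : (rightCone J ⊗ Δ[m]).obj U)
    (h' : (join _ _).map f ((cylSplit J m).app U z) ∈ (cutFiber (joinCut _ _) 0).obj V) :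
    ((joinLeft _ _).app V ⟨_, h'⟩).2 = (Δ[m] : SSet.{u}).map f z.2 := by
  have k := (NatTrans.naturality_apply (cylSplit J m) f z).symm
  rw [joinLeft_congr k h' (k ▸ h'), cylSplit_left _ _ ((cylSplit_mem _ 0).1 (k ▸ h'))]
  rfl

lemma cylSplit_right_map {U V : SimplexCategoryᵒᵖ} (f : U ⟶ V) (z : (rightCone J ⊗ Δ[m]).obj U)
    (h' : (join _ _).map f ((cylSplit J m).app U z) ∈ (cutFiber (joinCut _ _) 1).obj V) :
    (joinRight _ _).app V ⟨_, h'⟩ = (Δ[m] : SSet.{u}).map f z.2 := by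
  have k := (NatTrans.naturality_apply (cylSplit J m) f z).symm
  rw [joinRight_congr k h' (k ▸ h'), cylSplit_right]
  rfl

variable (J m) in
lemma cylSplit_joinMap :
    cylSplit J m ≫ joinMap (fst J Δ[m]) (toPoint Δ[m]) = fst _ _ := by
  refine join_hom_ext (by rw [Category.assoc, joinMap_cut, cylSplit_cut]) ?_ ?_
  · intro U w ha hb
    have h' := (joinMap_mem (fst J Δ[m]) (toPoint Δ[m]) ((cylSplit J m).app U w) 0).1 ha
    refine (joinMap_left (fst J Δ[m]) (toPoint Δ[m]) _ h' ha).trans ?_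
    rw [cylSplit_left w h' hb]
    rfl
  · intro U w ha hb
    exact Subsingleton.elim _ _

variable (l : Fin (m + 1))

lemma cylJoin_aux : ∃ k : Fin (m + 1), (∀ (U : SimplexCategoryᵒᵖ) (s : (J ⊗ Δ[m]).obj U) (i),
      vx ((snd J Δ[m] ≫ simplexMap (fun i => min i l)
        fun _ _ h => min_le_min_right l h).app U s) i ≤ k) ∧
    ∀ (U : SimplexCategoryᵒᵖ) (t : (Δ[m] : SSet.{u}).obj U) (i), k ≤ vx ((simplexMap
      (fun i => max i l) fun _ _ h => max_le_max_right l h).app U t) i :=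
  ⟨l, fun _ _ _ => min_le_right _ _, fun _ _ _ => le_max_right _ _⟩

/-- The second component of `cylJoin`. -/
def cylJoinSnd : join (J ⊗ Δ[m]) Δ[m] ⟶ Δ[m] :=
  joinToSimplex (snd J Δ[m] ≫ simplexMap (fun i => min i l) fun _ _ h => min_le_min_right l h)
    (simplexMap (fun i => max i l) fun _ _ h => max_le_max_right l h)
    (cylJoin_aux l)

/-- The map from the join to the cylinder whose image is the `l`-th part of the filtration. -/
def cylJoin : join (J ⊗ Δ[m]) Δ[m] ⟶ rightCone J ⊗ Δ[m] :=
  lift (joinMap (fst J Δ[m]) (toPoint Δ[m])) (cylJoinSnd l)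

lemma vx_cylJoin_cut {U : SimplexCategoryᵒᵖ} (w : (join (J ⊗ Δ[m]) Δ[m]).obj U) (i) :
    vx ((joinCut J Δ[0]).app U ((cylJoin l).app U w).1) i = vx ((joinCut _ _).app U w) i :=
  congrArg (fun φ => vx (φ.app U w) i) (joinMap_cut (fst J Δ[m]) (toPoint Δ[m]))

lemma vx_cylJoin_left {U : SimplexCategoryᵒᵖ} (w : (join (J ⊗ Δ[m]) Δ[m]).obj U) {i j}
    (hij : i ≤ j) (h : vx ((joinCut _ _).app U w) j = 0) :
    vx ((cylJoin l).app U w).2 i =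
      min (vx ((joinLeft _ _).app U ⟨_, map_headHom_mem _ w h⟩).2 i) l :=
  vx_joinToSimplex_left _ _ (cylJoin_aux l) w hij h

lemma vx_cylJoin_right {U : SimplexCategoryᵒᵖ} (w : (join (J ⊗ Δ[m]) Δ[m]).obj U) {i j}
    (hij : i ≤ j) (h : vx ((joinCut _ _).app U w) i = 1) :
    vx ((cylJoin l).app U w).2 j =
      max (vx ((joinRight _ _).app U ⟨_, map_tailHom_mem _ w h⟩) j) l :=
  vx_joinToSimplex_right _ _ (cylJoin_aux l) w hij h

/-- On the `l`-th part the truncations by `min · l` and `max · l` have no effect, so this part is a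
retract-like piece of `(J ⊗ Δ[m]) ⋆ Δ[m]`. -/
lemma cylJoin_cylSplit {U : SimplexCategoryᵒᵖ} (z : (rightCone J ⊗ Δ[m]).obj U)
    (hz : z ∈ (cylPart J m l).obj U) : (cylJoin l).app U ((cylSplit J m).app U z) = z := by
  refine Prod.ext (congrArg (fun φ => φ.app U z) (cylSplit_joinMap J m))
    (vx_ext fun i => ?_)
  by_cases hi : vx ((joinCut J Δ[0]).app U z.1) i = 0
  · rw [vx_cylJoin_left l _ le_rfl ((vx_cylSplit_cut z i).trans hi), cylSplit_left_map, vx_map]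
    refine (min_eq_left (Fin.le_def.2 ?_)).trans ?_
    · exact (Fin.le_def.1 (vx_mono z.2 (min_le_right _ _))).trans ((hz i).1 hi)
    · exact congrArg (vx z.2) (min_self i)
  · have hi' : vx ((joinCut J Δ[0]).app U z.1) i = 1 := by lia
    rw [vx_cylJoin_right l _ le_rfl ((vx_cylSplit_cut z i).trans hi'), cylSplit_right_map, vx_map]
    refine (max_eq_left (Fin.le_def.2 ?_)).trans ?_
    · exact ((hz i).2 hi').trans (Fin.le_def.1 (vx_mono z.2 (le_max_right _ _)))
    · exact congrArg (vx z.2) (max_self i)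

end CylinderFiltration

section CylinderExtension

variable {J : SSet.{u}} {m : ℕ} (l : Fin (m + 1))

/-! ### The positive steps of the filtration -/

/-- The homotopy from the identity to the truncation below `l`. -/
def truncHomotopy (J : SSet.{u}) : (J ⊗ Δ[m]) ⊗ Δ[1] ⟶ J ⊗ Δ[m] :=
  lift (fst _ _ ≫ fst _ _)
    { app := fun U => ↾fun s => vxMk
        (fun i => if vx s.2 i = 0 then vx s.1.2 i else max (vx s.1.2 i) l) fun i j hij => by
          have h₁ := vx_mono s.1.2 hij
          have h₂ := vx_mono s.2 hij
          dsimp only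
          split_ifs with hi hj hj
          · exact h₁
          · exact h₁.trans (le_max_left _ _)
          · exact absurd (h₂.trans hj.le) (by lia)
          · exact max_le_max_right l h₁
      naturality := fun _ _ _ => rfl }

lemma vx_truncHomotopy {U : SimplexCategoryᵒᵖ} (s : (J ⊗ Δ[m]).obj U)
    (e : (Δ[1] : SSet.{u}).obj U) (i) : vx ((truncHomotopy l J).app U ⟨s, e⟩).2 i =
      if vx e i = 0 then vx s.2 i else max (vx s.2 i) l := rfl

/-- The subcomplex of simplices which do not meet some vertex below `l`. -/
def lowerSub (J : SSet.{u}) : (J ⊗ Δ[m]).Subcomplex where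
  obj U := {s | ∃ j < l, ∀ i, vx s.2 i ≠ j}
  map {U V} f s := by
    rintro ⟨j, hj, h⟩
    exact ⟨j, hj, fun i => h _⟩

/-- The subcomplex of simplices whose truncation does not meet some vertex from `l` on. -/
def higherSub : (Δ[m] : SSet.{u}).Subcomplex where
  obj U := {s | ∃ j, l ≤ j ∧ ∀ i, max (vx s i) l ≠ j}
  map {U V} f s := by
    rintro ⟨j, hj, h⟩
    exact ⟨j, hj, fun i => h _⟩

/-- The truncations keep the components on the two sides of `l`. A vertex below `l` omitted on `J`,
or one above `l` omitted on the cone side, is thus omitted altogether. If the cone side omits `l`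
itself, it starts at `l + 1`, which is the next part of the filtration. -/
lemma cylJoin_mem (hl : 0 < l) {U : SimplexCategoryᵒᵖ} (w : (join (J ⊗ Δ[m]) Δ[m]).obj U)
    (hw : w ∈ (joinUnion (lowerSub l J) (higherSub l)).obj U) :
    (cylJoin l).app U w ∈ (cylFilt J m (l + 1)).obj U := by
  rcases mem_joinUnion hw with hw | hw
  · refine Or.inl ?_
    by_cases h : ∀ i, vx ((joinCut _ _).app U w) i = 1
    -- With no vertex over `J`, everything has second coordinate at least `l > 0`.
    · refine mem_cylBase_of_ne _ 0 fun i => ?_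
      rw [vx_cylJoin_right l w le_rfl (h i)]
      exact (hl.trans_le (le_max_right _ _)).ne'
    · obtain ⟨j, hj, hmax⟩ := exists_last _ h
      obtain ⟨k, hk, hk'⟩ := hw _ _ (map_headHom_mem _ w hj)
      refine mem_cylBase_of_ne _ k fun i => ?_
      by_cases hi : vx ((joinCut _ _).app U w) i = 0
      · rw [vx_cylJoin_left l w (hmax i hi) hj]
        have := hk' i
        grind
      · rw [vx_cylJoin_right l w le_rfl (by lia : vx ((joinCut _ _).app U w) i = 1)]
        exact (hk.trans_le (le_max_right _ _)).ne'
  · by_cases h : ∀ i, vx ((joinCut _ _).app U w) i = 0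
    · exact Or.inl (mem_cylBase_of_cut _ fun i => (vx_cylJoin_cut l w i).trans (h i))
    · obtain ⟨j, hj, hmin⟩ := exists_first _ h
      obtain ⟨k, hk, hk'⟩ := hw _ _ (map_tailHom_mem _ w hj)
      by_cases hkl : k = l
      · refine Or.inr ⟨l + 1, le_rfl, fun i => ⟨fun hi => ?_, fun hi => ?_⟩⟩
        · rw [vx_cylJoin_left l w le_rfl ((vx_cylJoin_cut l w i).symm.trans hi)]
          have := Fin.le_def.1 (min_le_right (vx ((joinLeft _ _).app U
            ⟨_, map_headHom_mem _ w ((vx_cylJoin_cut l w i).symm.trans hi)⟩).2 i) l)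
          lia
        · rw [vx_cylJoin_right l w (hmin i ((vx_cylJoin_cut l w i).symm.trans hi)) hj]
          have h₁ := hk' i
          rw [hkl] at h₁
          have h₂ := lt_of_le_of_ne (le_max_right _ _) (Ne.symm h₁)
          exact Fin.lt_def.1 h₂
      · refine Or.inl (mem_cylBase_of_ne _ k fun i => ?_)
        by_cases hi : vx ((joinCut _ _).app U w) i = 0
        · rw [vx_cylJoin_left l w le_rfl hi]
          exact ((min_le_right _ _).trans_lt (lt_of_le_of_ne hk (Ne.symm hkl))).ne
        · have hi' : vx ((joinCut _ _).app U w) i = 1 := by lia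
          rw [vx_cylJoin_right l w (hmin i hi') hj]
          exact hk' i

lemma cylSplit_mem_joinUnion {U : SimplexCategoryᵒᵖ} (z : (rightCone J ⊗ Δ[m]).obj U)
    (hz : z ∈ (cylPart J m l).obj U) (hz' : z ∈ (cylFilt J m (l + 1)).obj U) :
    (cylSplit J m).app U z ∈ (joinUnion (lowerSub l J) (higherSub l)).obj U := by
  have key : ∀ (V : SimplexCategoryᵒᵖ) (f : U ⟶ V)
      (_ : (join _ _).map f ((cylSplit J m).app U z) ∈ (cutFiber (joinCut _ _) 1).obj V) (i),
      vx ((joinCut J Δ[0]).app U z.1) (f.unop.toOrderHom i) = 1 := fun V f hf i => by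
    have := (mem_cutFiber _ _ _).1 hf i
    rw [NatTrans.naturality_apply, vx_map, vx_cylSplit_cut] at this
    exact this
  rcases hz' with hz' | ⟨l', hl', hz'⟩
  · rcases mem_cylBase hz' with h | ⟨j, hj⟩
    · refine mem_joinUnion_of_right _ fun V f hf => ?_
      exact absurd ((key V f hf 0).symm.trans (h _)) one_ne_zero
    · by_cases hjl : j < l
      · refine mem_joinUnion_of_left _ fun V f hf => ⟨j, hjl, fun i => ?_⟩
        rw [cylSplit_left_map]
        exact hj _
      · refine mem_joinUnion_of_right _ fun V f hf => ⟨j, not_lt.1 hjl, fun i => ?_⟩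
        rw [cylSplit_right_map, vx_map, max_eq_left (Fin.le_def.2 ((hz _).2 (key V f hf i)))]
        exact hj _
  · refine mem_joinUnion_of_right _ fun V f hf => ⟨l, le_rfl, fun i => ?_⟩
    have := (hz' _).2 (key V f hf i)
    rw [cylSplit_right_map, vx_map, max_eq_left (Fin.le_def.2 (by lia))]
    exact fun h => by
      rw [h] at this
      lia

/-- The extension along the step of the filtration at a positive `l`. -/
lemma exists_cylFilt_extension {K : SSet.{u}} [SSet.Quasicategory K] (hl : 0 < l)
    (t : (cylFilt J m (l + 1) : SSet.{u}) ⟶ K) :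
    ∃ t' : (cylFilt J m l : SSet.{u}) ⟶ K,
      SSet.Subcomplex.homOfLE (cylFilt_succ_le (l : ℕ)) ≫ t' = t := by
  refine exists_extension_of_retract (P := cylPart J m l) _ (cylSplit J m) (cylJoin l)
    (fun U z hz => mem_cylFilt_or hz) (fun U z hz => cylJoin_cylSplit l z hz)
    (fun U z hz hz' => cylSplit_mem_joinUnion l z hz hz')
    (fun U w hw => cylJoin_mem l hl w hw) t fun s _ => ?_
  -- The homotopy pushes `J ⊗ Δ[m]` to second coordinates at least `l`. Since `l > 0`, the end of
  -- the homotopy omits the vertex `0`.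
  refine exists_joinUnion_extension (truncHomotopy l J) ?_ ?_ ?_ s
  · intro U s e he
    exact Prod.ext rfl (vx_ext fun i => (vx_truncHomotopy l s e i).trans (if_pos (he i)))
  · intro U s e he
    refine ⟨0, hl, fun i => ?_⟩
    rw [vx_truncHomotopy, if_neg (by rw [he i]; exact one_ne_zero)]
    exact (hl.trans_le (le_max_right _ _)).ne'
  · rintro U s e ⟨j, hj, h⟩
    refine ⟨j, hj, fun i => ?_⟩
    rw [vx_truncHomotopy]
    split_ifs
    · exact h i
    · exact (hj.trans_le (le_max_right _ _)).ne'

/-- Descending induction on the stage from `m + 1`, where there is only the base. All steps use a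
positive index; taking `l = 0` leaves just the step at `0`, which inner horns cannot fill. -/
lemma exists_cylFilt_one_extension {K : SSet.{u}} [SSet.Quasicategory K]
    (t : (cylBase J m : SSet.{u}) ⟶ K) (n l : ℕ) (hn : n + l = m) :
    ∃ t' : (cylFilt J m (l + 1) : SSet.{u}) ⟶ K,
      SSet.Subcomplex.homOfLE (cylBase_le_cylFilt _) ≫ t' = t := by
  induction n generalizing l with
  | zero =>
    obtain rfl : l = m := by lia
    exact ⟨SSet.Subcomplex.homOfLE cylFilt_last_le ≫ t, rfl⟩
  | succ n ih =>
    obtain ⟨t', ht'⟩ := ih (l + 1) (by lia)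
    obtain ⟨t'', ht''⟩ := exists_cylFilt_extension (J := J) (⟨l + 1, by lia⟩ : Fin (m + 1))
      (Fin.lt_def.2 (Nat.succ_pos l)) t'
    refine ⟨t'', Eq.trans ?_ ht'⟩
    exact congrArg (fun φ => SSet.Subcomplex.homOfLE (cylBase_le_cylFilt (l + 1 + 1)) ≫ φ) ht''

end CylinderExtension

/-! ### The last step of the filtration, by the universal property -/

section ColimitStep

variable {J K : SSet.{u}}

/-- The universal property in the language of subcomplexes: extension from `J ⋆ T ∪ J^▷ ⋆ T₀` to
`J^▷ ⋆ T`. -/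
lemma exists_joinUnion_extension_of_isColimitCone {c : rightCone J ⟶ K} (hc : IsColimitCone c)
    {T : SSet.{u}} (T₀ : T.Subcomplex)
    (s : (joinUnion (SSet.Subcomplex.range (coneIncl J)) T₀ : SSet.{u}) ⟶ K)
    (hs : ∀ (U : SimplexCategoryᵒᵖ) (x : (rightCone J).obj U) (h),
      s.app U ⟨(joinInl (rightCone J) T).app U x, h⟩ = c.app U x) :
    ∃ s' : join (rightCone J) T ⟶ K,
      (joinUnion (SSet.Subcomplex.range (coneIncl J)) T₀).ι ≫ s' = s := by
  let α : join J T ⟶ (joinUnion (SSet.Subcomplex.range (coneIncl J)) T₀ : SSet.{u}) :=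
    SSet.Subcomplex.lift (joinMap (coneIncl J) (𝟙 T)) (by
      rintro U _ ⟨y, rfl⟩
      refine Or.inl ⟨(joinMap (SSet.Subcomplex.toRange (coneIncl J)) (𝟙 T)).app U y, ?_⟩
      exact congrArg (fun φ => (joinMap φ (𝟙 T)).app U y)
        (SSet.Subcomplex.toRange_ι (coneIncl J)))
  let β : join (rightCone J) T₀ ⟶ (joinUnion (SSet.Subcomplex.range (coneIncl J)) T₀ : SSet.{u}) :=
    SSet.Subcomplex.lift (joinMap (𝟙 _) T₀.ι) (by
      rintro U _ ⟨y, rfl⟩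
      exact Or.inr ⟨y, rfl⟩)
  obtain ⟨h, hf, hg⟩ := hc T₀.ι (α ≫ s) (β ≫ s) (by
    suffices H : ∀ U x, (joinInl (rightCone J) T₀ ≫ β ≫ s).app U x = c.app U x by
      ext U x
      exact H U x
    intro U x
    have e : (joinMap (𝟙 (rightCone J)) T₀.ι).app U ((joinInl (rightCone J) T₀).app U x) =
        (joinInl (rightCone J) T).app U x :=
      congrArg (fun φ => φ.app U x) (joinInl_naturality (𝟙 (rightCone J)) T₀.ι)
    have hm : (joinInl (rightCone J) T).app U x ∈
        (joinUnion (SSet.Subcomplex.range (coneIncl J)) T₀).obj U := e ▸ Or.inr ⟨_, rfl⟩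
    exact (congrArg (s.app U) (Subtype.ext e)).trans (hs U x hm)) (by
    rw [← Category.assoc, ← Category.assoc]
    refine congrArg (fun φ => φ ≫ s) ?_
    rw [← cancel_mono (SSet.Subcomplex.ι _)]
    change joinMap (𝟙 J) T₀.ι ≫ joinMap (coneIncl J) (𝟙 T) =
      joinMap (coneIncl J) (𝟙 _) ≫ joinMap (𝟙 _) T₀.ι
    rw [joinMap_comp, joinMap_comp, Category.id_comp, Category.id_comp, Category.comp_id,
      Category.comp_id])
  refine ⟨h, ?_⟩
  suffices H : ∀ (U : SimplexCategoryᵒᵖ) (z : (join (rightCone J) T).obj U) (hz),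
      h.app U z = s.app U ⟨z, hz⟩ by
    ext U z
    exact H U z.1 z.2
  intro U z hz
  rcases mem_joinUnion hz with hz' | hz'
  · obtain ⟨y, rfl⟩ := mem_range_joinMap (coneIncl J) (𝟙 T) z hz' fun _ _ _ => ⟨_, rfl⟩
    exact congrArg (fun φ => φ.app U y) hf
  · obtain ⟨y, rfl⟩ := mem_range_joinMap (𝟙 (rightCone J)) T₀.ι z (fun _ _ _ => ⟨_, rfl⟩)
      fun V f hf => ⟨⟨_, hz' V f hf⟩, rfl⟩
    exact congrArg (fun φ => φ.app U y) hg

variable {n : ℕ}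

lemma pred_mono : Monotone fun i : Fin (n + 1 + 1) => (⟨i - 1, by lia⟩ : Fin (n + 1)) :=
  fun _ _ h => Fin.le_def.2 (Nat.sub_le_sub_right h 1)

lemma sign_mono : Monotone fun i : Fin (n + 1 + 1) => (if i = 0 then 0 else 1 : Fin 2) := by
  intro i j h
  dsimp only
  split_ifs with hi hj hj
  · exact le_rfl
  · exact Fin.zero_le _
  · exact absurd (Fin.le_zero_iff.1 (h.trans hj.le)) hi
  · exact le_rfl

variable (J n) in
/-- The map which collapses the first coordinate of a cylinder over the positive vertices. -/
def cylCone : rightCone J ⊗ Δ[n + 1] ⟶ join (rightCone J) Δ[n] :=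
  joinLift (snd _ _ ≫ simplexMap _ sign_mono) ((cutFiber _ 0).ι ≫ fst _ _)
    ((cutFiber _ 1).ι ≫ snd _ _ ≫ simplexMap _ pred_mono)

variable (J n) in
lemma cylCone_cut : cylCone J n ≫ joinCut _ _ = snd _ _ ≫ simplexMap _ sign_mono :=
  joinLift_cut _ _ _

lemma vx_cylCone_cut_zero {U : SimplexCategoryᵒᵖ} (z : (rightCone J ⊗ Δ[n + 1]).obj U) (i) :
    vx ((joinCut _ _).app U ((cylCone J n).app U z)) i = 0 ↔ vx z.2 i = 0 := by
  have : vx ((joinCut _ _).app U ((cylCone J n).app U z)) i = if vx z.2 i = 0 then 0 else 1 :=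
    congrArg (fun φ => vx (φ.app U z) i) (cylCone_cut J n)
  rw [this]
  split_ifs with h <;> simp [h]

lemma cylCone_left {U : SimplexCategoryᵒᵖ} (z : (rightCone J ⊗ Δ[n + 1]).obj U)
    (h : (cylCone J n).app U z ∈ (cutFiber (joinCut _ _) 0).obj U) :
    (joinLeft _ _).app U ⟨_, h⟩ = z.1 :=
  joinLift_left _ _ _ z ((joinLift_mem _ _ _ _ _).1 h) h

lemma cylCone_right {U : SimplexCategoryᵒᵖ} (z : (rightCone J ⊗ Δ[n + 1]).obj U)
    (h : (cylCone J n).app U z ∈ (cutFiber (joinCut _ _) 1).obj U) :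
    (joinRight _ _).app U ⟨_, h⟩ = (simplexMap _ pred_mono).app U z.2 :=
  joinLift_right _ _ _ z ((joinLift_mem _ _ _ _ _).1 h) h

attribute [irreducible] cylCone

lemma cylCone_left_map {U V : SimplexCategoryᵒᵖ} (f : U ⟶ V)
    (z : (rightCone J ⊗ Δ[n + 1]).obj U)
    (h : (join _ _).map f ((cylCone J n).app U z) ∈ (cutFiber (joinCut _ _) 0).obj V) :
    (joinLeft _ _).app V ⟨_, h⟩ = (rightCone J).map f z.1 := by
  have k := (NatTrans.naturality_apply (cylCone J n) f z).symm
  rw [joinLeft_congr k h (k ▸ h), cylCone_left]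
  rfl

lemma vx_cylCone_right_map {U V : SimplexCategoryᵒᵖ} (f : U ⟶ V)
    (z : (rightCone J ⊗ Δ[n + 1]).obj U)
    (h : (join _ _).map f ((cylCone J n).app U z) ∈ (cutFiber (joinCut _ _) 1).obj V) (i) :
    vx ((joinRight _ _).app V ⟨_, h⟩) i =
      (⟨vx z.2 (f.unop.toOrderHom i) - 1, by lia⟩ : Fin (n + 1)) := by
  have k := (NatTrans.naturality_apply (cylCone J n) f z).symm
  rw [joinRight_congr k h (k ▸ h), cylCone_right]
  rfl

lemma cylUncone_aux : ∃ k : Fin (n + 1 + 1),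
    (∀ (U : SimplexCategoryᵒᵖ) (s : (rightCone J).obj U) (i),
      vx ((SSet.const (SSet.stdSimplex.obj₀Equiv.symm 0) : rightCone J ⟶ Δ[n + 1]).app U s) i
        ≤ k) ∧
    ∀ (U : SimplexCategoryᵒᵖ) (t : (Δ[n] : SSet.{u}).obj U) (i), k ≤ vx ((simplexMap
      Fin.succ (Fin.strictMono_succ (n := n + 1)).monotone).app U t) i :=
  ⟨0, fun _ _ _ => le_rfl, fun _ _ _ => Fin.zero_le _⟩

variable (J n) in
/-- The second component of `cylUncone`. -/
def cylUnconeSnd : join (rightCone J) Δ[n] ⟶ Δ[n + 1] :=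
  joinToSimplex (SSet.const (SSet.stdSimplex.obj₀Equiv.symm 0))
    (simplexMap Fin.succ (Fin.strictMono_succ (n := n + 1)).monotone) cylUncone_aux

variable (J n) in
/-- A partial section of `cylCone`. -/
def cylUncone : join (rightCone J) Δ[n] ⟶ rightCone J ⊗ Δ[n + 1] :=
  lift (coneProj J _) (cylUnconeSnd J n)

lemma vx_cylUncone_left {U : SimplexCategoryᵒᵖ} (w : (join (rightCone J) Δ[n]).obj U) {i}
    (h : vx ((joinCut _ _).app U w) i = 0) : vx ((cylUncone J n).app U w).2 i = 0 :=
  vx_joinToSimplex_left _ _ cylUncone_aux w le_rfl h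

lemma vx_cylUncone_right {U : SimplexCategoryᵒᵖ} (w : (join (rightCone J) Δ[n]).obj U) {i j}
    (hij : i ≤ j) (h : vx ((joinCut _ _).app U w) i = 1) :
    vx ((cylUncone J n).app U w).2 j =
      (vx ((joinRight _ _).app U ⟨_, map_tailHom_mem _ w h⟩) j).succ :=
  vx_joinToSimplex_right _ _ cylUncone_aux w hij h

lemma vx_cylUncone_cut {U : SimplexCategoryᵒᵖ} (w : (join (rightCone J) Δ[n]).obj U) (i) :
    vx ((joinCut J Δ[0]).app U ((cylUncone J n).app U w).1) i = vx ((baseCut J _).app U w) i :=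
  congrArg (fun φ => vx (φ.app U w) i) (coneProj_cut J Δ[n])

end ColimitStep

section ColimitStep

variable {J K : SSet.{u}} {n : ℕ}

lemma vx_oneExt_left {S T : SSet.{u}} (b : S ⟶ Δ[1]) {U : SimplexCategoryᵒᵖ} (z : (join S T).obj U)
    {i : Fin (U.unop.len + 1)} (h : vx ((joinCut S T).app U z) i = 0) :
    vx ((oneExt b T).app U z) i =
      vx (b.app U ((joinLeft S T).app U ⟨_, map_headHom_mem _ z h⟩)) i := by
  rw [← oneExt_app b _ (map_headHom_mem _ z h), NatTrans.naturality_apply, vx_map]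
  exact congrArg _ (min_self i).symm

lemma vx_baseCut_cylCone {U : SimplexCategoryᵒᵖ} (z : (rightCone J ⊗ Δ[n + 1]).obj U) {i}
    (hi : vx z.2 i = 0) : vx ((baseCut J _).app U ((cylCone J n).app U z)) i =
      vx ((joinCut J Δ[0]).app U z.1) i := by
  rw [vx_oneExt_left _ _ ((vx_cylCone_cut_zero z i).2 hi), cylCone_left_map,
    NatTrans.naturality_apply, vx_map]
  exact congrArg _ (min_self i)

/-- In the part for `l = 0`, all vertices over `J` have second coordinate `0`. Those with positive
second coordinate are at the cone point, which is where `coneProj` sends them. -/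
lemma cylPart_zero_ι_cylCone :
    (cylPart J (n + 1) 0).ι ≫ cylCone J n ≫ coneProj J Δ[n] = (cylPart J (n + 1) 0).ι ≫ fst _ _ := by
  refine join_hom_ext ?_ ?_ ?_
  · rw [Category.assoc, Category.assoc, coneProj_cut]
    suffices H : ∀ U (z : (rightCone J ⊗ Δ[n + 1]).obj U), z ∈ (cylPart J (n + 1) 0).obj U →
        (baseCut J _).app U ((cylCone J n).app U z) = (joinCut J Δ[0]).app U z.1 by
      ext U z
      exact H U z.1 z.2
    refine fun U z hz => vx_ext fun i => ?_
    by_cases hi : vx z.2 i = 0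
    · exact vx_baseCut_cylCone z hi
    · have h₁ : vx ((joinCut _ _).app U ((cylCone J n).app U z)) i = 1 := by
        have := (vx_cylCone_cut_zero z i).not.2 hi
        lia
      have h₂ : vx ((joinCut J Δ[0]).app U z.1) i ≠ 0 := fun h =>
        hi (Fin.ext (Nat.le_zero.1 ((hz i).1 h)))
      rw [vx_oneExt _ _ h₁]
      lia
  · intro U w ha hb
    have hb' := (mem_cutFiber _ _ _).1 hb
    have hm : (cylCone J n).app U w.1 ∈ (cutFiber (joinCut _ _) 0).obj U :=
      (mem_cutFiber _ _ _).2 fun i => (vx_cylCone_cut_zero w.1 i).2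
        (Fin.ext (Nat.le_zero.1 ((w.2 i).1 (hb' i))))
    have e := cylCone_left w.1 hm
    exact (coneProj_left J Δ[n] _ ha hm (e ▸ hb)).trans (joinLeft_congr e (e ▸ hb) hb)
  · intro U w ha hb
    exact Subsingleton.elim _ _

lemma cylUncone_cylCone {U : SimplexCategoryᵒᵖ} (z : (rightCone J ⊗ Δ[n + 1]).obj U)
    (hz : z ∈ (cylPart J (n + 1) 0).obj U) :
    (cylUncone J n).app U ((cylCone J n).app U z) = z := by
  refine Prod.ext (congrArg (fun φ => φ.app U ⟨z, hz⟩) cylPart_zero_ι_cylCone)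
    (vx_ext fun i => ?_)
  by_cases hi : vx z.2 i = 0
  · rw [vx_cylUncone_left _ ((vx_cylCone_cut_zero z i).2 hi), hi]
  · have h₁ : vx ((joinCut _ _).app U ((cylCone J n).app U z)) i = 1 := by
      have := (vx_cylCone_cut_zero z i).not.2 hi
      lia
    rw [vx_cylUncone_right _ le_rfl h₁, vx_cylCone_right_map]
    have h₂ : (tailHom U i).unop.toOrderHom i = i := max_self i
    have h₃ : (vx z.2 i : ℕ) ≠ 0 := fun h => hi (Fin.ext h)
    refine Fin.ext ?_
    change (vx z.2 ((tailHom U i).unop.toOrderHom i) : ℕ) - 1 + 1 = vx z.2 i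
    rw [h₂]
    exact Nat.succ_pred_eq_of_ne_zero h₃

/-- Omitting the vertex `0` leaves no component in `J^▷`; omitting `j > 0` makes the component in
`Δ[n]` omit `j - 1`. In a part with `l ≥ 1`, nothing at the cone point has second coordinate `0`, so
the first component lies in `J`. -/
lemma cylCone_mem_joinUnion {U : SimplexCategoryᵒᵖ} (z : (rightCone J ⊗ Δ[n + 1]).obj U)
    (hz' : z ∈ (cylFilt J (n + 1) 1).obj U) :
    (cylCone J n).app U z ∈ (joinUnion (SSet.Subcomplex.range (coneIncl J)) ∂Δ[n]).obj U := by
  have key₀ : ∀ (V : SimplexCategoryᵒᵖ) (f : U ⟶ V)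
      (_ : (join _ _).map f ((cylCone J n).app U z) ∈ (cutFiber (joinCut _ _) 0).obj V) (i),
      vx z.2 (f.unop.toOrderHom i) = 0 := fun V f hf i => by
    have := (mem_cutFiber _ _ _).1 hf i
    rw [NatTrans.naturality_apply, vx_map, vx_cylCone_cut_zero] at this
    exact this
  have key₁ : ∀ (V : SimplexCategoryᵒᵖ) (f : U ⟶ V)
      (_ : (join _ _).map f ((cylCone J n).app U z) ∈ (cutFiber (joinCut _ _) 1).obj V) (i),
      vx z.2 (f.unop.toOrderHom i) ≠ 0 := fun V f hf i => by
    have := (mem_cutFiber _ _ _).1 hf i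
    rw [NatTrans.naturality_apply, vx_map] at this
    rw [Ne, ← vx_cylCone_cut_zero, this]
    exact one_ne_zero
  rcases hz' with hz' | ⟨l, hl, hz'⟩
  · rcases mem_cylBase hz' with h | ⟨j, hj⟩
    · refine mem_joinUnion_of_left _ fun V f hf => ?_
      rw [cylCone_left_map]
      refine mem_range_coneIncl _ ((mem_cutFiber _ _ _).2 fun i => ?_)
      rw [NatTrans.naturality_apply]
      exact h _
    · by_cases hj₀ : j = 0
      · refine mem_joinUnion_of_left _ fun V f hf => ?_
        exact absurd (key₀ V f hf 0) (hj₀ ▸ hj _)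
      · refine mem_joinUnion_of_right _ fun V f hf => (mem_boundary_vx _).2
          ⟨⟨j - 1, by lia⟩, fun i h => ?_⟩
        rw [vx_cylCone_right_map] at h
        have h₁ := Fin.mk.inj h
        have h₂ : (vx z.2 (f.unop.toOrderHom i) : ℕ) ≠ 0 := fun h => key₁ V f hf i (Fin.ext h)
        have h₃ : (j : ℕ) ≠ 0 := fun h => hj₀ (Fin.ext h)
        exact hj _ (Fin.ext (Nat.pred_inj (Nat.pos_of_ne_zero h₂) (Nat.pos_of_ne_zero h₃) h₁))
  · refine mem_joinUnion_of_left _ fun V f hf => ?_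
    rw [cylCone_left_map]
    refine mem_range_coneIncl _ ((mem_cutFiber _ _ _).2 fun i => ?_)
    rw [NatTrans.naturality_apply, vx_map]
    by_contra h
    have h₁ := (hz' (f.unop.toOrderHom i)).2 (by lia)
    rw [key₀ V f hf i] at h₁
    exact absurd (hl.trans h₁) (by simp)

lemma cylUncone_mem {U : SimplexCategoryᵒᵖ} (w : (join (rightCone J) Δ[n]).obj U)
    (hw : w ∈ (joinUnion (SSet.Subcomplex.range (coneIncl J)) ∂Δ[n]).obj U) :
    (cylUncone J n).app U w ∈ (cylFilt J (n + 1) 1).obj U := by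
  rcases mem_joinUnion hw with hw | hw
  -- The first component lies in `J` at `0` and the rest is at the cone point with second coordinate
  -- at least `1`.
  · refine Or.inr ⟨1, le_rfl, fun i => ?_⟩
    rw [vx_cylUncone_cut]
    by_cases hi : vx ((joinCut _ _).app U w) i = 0
    · rw [vx_cylUncone_left w hi, vx_oneExt_left _ w hi]
      obtain ⟨y, hy⟩ := hw _ _ (map_headHom_mem _ w hi)
      have := (mem_cutFiber _ _ _).1 (joinInl_mem (T := Δ[0]) y) i
      rw [hy] at this
      rw [this]
      exact ⟨fun _ => Nat.zero_le _, fun h => absurd h zero_ne_one⟩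
    · have hi' : vx ((joinCut _ _).app U w) i = 1 := by lia
      rw [vx_cylUncone_right w le_rfl hi', vx_oneExt _ w hi']
      exact ⟨fun h => absurd h one_ne_zero, fun _ => Nat.succ_pos _⟩
  · refine Or.inl ?_
    by_cases h : ∀ i, vx ((joinCut _ _).app U w) i = 0
    -- Without a component in `Δ[n]` the second coordinate is constantly `0`; the vertex `1` exists
    -- because the dimension is `n + 1`.
    · refine mem_cylBase_of_ne _ 1 fun i => ?_
      rw [vx_cylUncone_left w (h i)]
      exact zero_ne_one
    · obtain ⟨j, hj, hmin⟩ := exists_first _ h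
      obtain ⟨k, hk⟩ := (mem_boundary_vx _).1 (hw _ _ (map_tailHom_mem _ w hj))
      refine mem_cylBase_of_ne _ k.succ fun i => ?_
      by_cases hi : vx ((joinCut _ _).app U w) i = 0
      · rw [vx_cylUncone_left w hi]
        exact (Fin.succ_ne_zero k).symm
      · rw [vx_cylUncone_right w (hmin i (by lia)) hj]
        exact fun h => hk i (Fin.succ_injective _ h)

lemma joinInl_coneProj (T : SSet.{u}) : joinInl (rightCone J) T ≫ coneProj J T = 𝟙 _ := by
  have hcut : (joinInl (rightCone J) T ≫ coneProj J T) ≫ joinCut J Δ[0] =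
      𝟙 _ ≫ joinCut J Δ[0] := by
    rw [Category.assoc, coneProj_cut, Category.id_comp]
    suffices H : ∀ U x, (oneExt (joinCut J Δ[0]) T).app U ((joinInl (rightCone J) T).app U x) =
        (joinCut J Δ[0]).app U x by
      ext U x
      exact H U x
    intro U x
    rw [oneExt_app _ _ (joinInl_mem x), joinInl_left]
  refine join_hom_ext hcut ?_ ?_
  · intro U x ha hb
    have e := joinInl_left (T := T) x (joinInl_mem x)
    have hm := Set.mem_of_eq_of_mem e (show x ∈ (cutFiber (joinCut J Δ[0]) 0).obj U from hb)
    exact (coneProj_left J T _ ha (joinInl_mem x) hm).trans (joinLeft_congr e hm hb)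
  · intro U w ha hb
    exact Subsingleton.elim _ _

/-- A map on `J ⊗ Δ[n + 1]` and `J^▷ ⊗ ∂Δ[n + 1]` whose restriction over the first vertex is
a colimit cone extends to `J^▷ ⊗ Δ[n + 1]`. -/
theorem exists_cylBase_extension [SSet.Quasicategory K] {c : rightCone J ⟶ K}
    (hc : IsColimitCone c) (t : (cylBase J (n + 1) : SSet.{u}) ⟶ K)
    (ht : ∀ (U : SimplexCategoryᵒᵖ) (z : (rightCone J ⊗ Δ[n + 1]).obj U) (h),
      (∀ i, vx z.2 i = 0) → t.app U ⟨z, h⟩ = c.app U z.1) :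
    ∃ t' : rightCone J ⊗ Δ[n + 1] ⟶ K, (cylBase J (n + 1)).ι ≫ t' = t := by
  obtain ⟨t₁, ht₁⟩ := exists_cylFilt_one_extension t (n + 1) 0 rfl
  obtain ⟨t₀, ht₀⟩ := exists_extension_of_retract (P := cylPart J (n + 1) 0)
    (cylFilt_succ_le (J := J) (m := n + 1) 0) (cylCone J n)
    (cylUncone J n) (fun U z hz => mem_cylFilt_or hz) (fun U z hz => cylUncone_cylCone z hz)
    (fun U z _ hz => cylCone_mem_joinUnion z hz) (fun U w hw => cylUncone_mem w hw) t₁ (by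
    refine fun s hs => exists_joinUnion_extension_of_isColimitCone hc _ s fun U x h => ?_
    have hz : ∀ i, vx ((cylUncone J n).app U ((joinInl (rightCone J) Δ[n]).app U x)).2 i = 0 :=
      fun i => vx_cylUncone_left _ ((mem_cutFiber _ _ _).1 (joinInl_mem x) i)
    have hm : (cylUncone J n).app U ((joinInl (rightCone J) Δ[n]).app U x) ∈
        (cylBase J (n + 1)).obj U :=
      mem_cylBase_of_ne _ 1 fun i => by
        rw [hz]
        exact zero_ne_one
    refine (hs U _ h).trans (Eq.trans ?_ ((ht U _ hm hz).trans ?_))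
    · exact congrArg (fun φ => φ.app U ⟨_, hm⟩) ht₁
    · exact congrArg (fun φ => c.app U (φ.app U x)) (joinInl_coneProj (J := J) Δ[n]))
  refine ⟨SSet.Subcomplex.lift (𝟙 _) (fun U z _ => mem_cylFilt_zero z) ≫ t₀, ?_⟩
  refine Eq.trans ?_ ht₁
  exact congrArg (fun φ => SSet.Subcomplex.homOfLE (cylBase_le_cylFilt _) ≫ φ) ht₀

end ColimitStep

/-! ## Maps to arrow categories -/

section Arrows

variable {X Y A B K L : SSet.{u}}

lemma const_app_eq {Z : SSet.{u}} (f : Z ⟶ Y) (v : Z _⦋0⦌) :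
    (SSet.const v : X ⟶ Z) ≫ f = SSet.const (f.app _ v) := by
  ext U x
  exact NatTrans.naturality_apply f _ v

lemma comp_const (f : X ⟶ Y) (v : L _⦋0⦌) : f ≫ SSet.const v = SSet.const v := rfl

lemma comp_evalAt (r : X ⟶ (ihom A).obj K) (v : A _⦋0⦌) :
    r ≫ evalAt v K = lift (SSet.const v) (𝟙 X) ≫ uncurry r := by
  rw [evalAt, uncurry_eq, ← Category.assoc, ← Category.assoc]
  refine congrArg (fun φ => φ ≫ (ihom.ev A).app K) ?_
  rw [comp_lift, lift_whiskerLeft, Category.comp_id, Category.id_comp, comp_const]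

lemma pre_evalAt (i : B ⟶ A) (v : B _⦋0⦌) :
    (MonoidalClosed.pre i).app K ≫ evalAt v K = evalAt (i.app _ v) K := by
  rw [comp_evalAt, uncurry_pre, evalAt, ← Category.assoc, lift_whiskerRight, const_app_eq]

/-- The map from a cylinder corresponding to a map to the arrow category. -/
def arrHom (r : X ⟶ Arr K) : X ⊗ Δ[1] ⟶ K := (β_ X Δ[1]).hom ≫ uncurry r

/-- The map to the arrow category corresponding to a map from a cylinder. -/
def arrMk (g : X ⊗ Δ[1] ⟶ K) : X ⟶ Arr K := curry ((β_ Δ[1] X).hom ≫ g)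

@[simp]
lemma arrHom_arrMk (g : X ⊗ Δ[1] ⟶ K) : arrHom (arrMk g) = g := by
  rw [arrHom, arrMk, uncurry_curry, SymmetricCategory.symmetry_assoc]

@[simp]
lemma arrMk_arrHom (r : X ⟶ Arr K) : arrMk (arrHom r) = r := by
  rw [arrHom, arrMk, SymmetricCategory.symmetry_assoc, curry_uncurry]

lemma arrHom_comp (f : X ⟶ Y) (r : Y ⟶ Arr K) : arrHom (f ≫ r) = f ▷ Δ[1] ≫ arrHom r := by
  rw [arrHom, arrHom, uncurry_natural_left, BraidedCategory.braiding_naturality_left_assoc]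

lemma lift_arrHom (r : X ⟶ Arr K) (v : (Δ[1] : SSet.{u}) _⦋0⦌) :
    lift (𝟙 X) (SSet.const v) ≫ arrHom r = r ≫ evalAt v K := by
  rw [comp_evalAt, arrHom, ← Category.assoc]
  refine congrArg (fun φ => φ ≫ uncurry r) ?_
  ext <;> simp

lemma arrHom_app_zero (r : X ⟶ Arr K) {U : SimplexCategoryᵒᵖ} (x : X.obj U)
    (e : (Δ[1] : SSet.{u}).obj U) (he : ∀ i, vx e i = 0) :
    (arrHom r).app U ⟨x, e⟩ = (r ≫ source K).app U x := by
  obtain rfl : e = (SSet.const (X := X) (SSet.stdSimplex.obj₀Equiv.symm 0)).app U x :=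
    vx_ext fun i => he i
  exact congrArg (fun φ => φ.app U x) (lift_arrHom r (SSet.stdSimplex.obj₀Equiv.symm 0))

lemma arrHom_app_one (r : X ⟶ Arr K) {U : SimplexCategoryᵒᵖ} (x : X.obj U)
    (e : (Δ[1] : SSet.{u}).obj U) (he : ∀ i, vx e i = 1) :
    (arrHom r).app U ⟨x, e⟩ = (r ≫ target K).app U x := by
  obtain rfl : e = (SSet.const (X := X) (SSet.stdSimplex.obj₀Equiv.symm 1)).app U x :=
    vx_ext fun i => he i
  exact congrArg (fun φ => φ.app U x) (lift_arrHom r (SSet.stdSimplex.obj₀Equiv.symm 1))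

/-- A map to the arrow category which is given on a subcomplex, with given source and target,
exists if the corresponding extension problem on the cylinder can be solved. -/
lemma exists_arr_extension {X₀ : X.Subcomplex} (ρ₀ : (X₀ : SSet.{u}) ⟶ Arr K) (s₀ s₁ : X ⟶ K)
    (h₀ : ρ₀ ≫ source K = X₀.ι ≫ s₀) (h₁ : ρ₀ ≫ target K = X₀.ι ≫ s₁)
    (hext : ∀ t : (cylSub X₀ : SSet.{u}) ⟶ K,
      (∀ (U : SimplexCategoryᵒᵖ) (z : (X ⊗ Δ[1]).obj U) (h), (∀ i, vx z.2 i = 0) →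
        t.app U ⟨z, h⟩ = s₀.app U z.1) → ∃ t', (cylSub X₀).ι ≫ t' = t) :
    ∃ ρ : X ⟶ Arr K, X₀.ι ≫ ρ = ρ₀ ∧ ρ ≫ source K = s₀ ∧ ρ ≫ target K = s₁ := by
  -- The two ends are disjoint, so `s₀` and `s₁` glue freely; `h₀` and `h₁` give the agreement with
  -- `ρ₀` on the cylinder over `X₀`.
  let E : Fin 2 → (X ⊗ Δ[1]).Subcomplex := fun ε => cutFiber (snd X Δ[1]) ε
  obtain ⟨t₁, ht₁, ht₁'⟩ := exists_glue_sup (E 0) (E 1) ((E 0).ι ≫ fst _ _ ≫ s₀)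
    ((E 1).ι ≫ fst _ _ ≫ s₁) fun U x h h' => (cutFiber_disjoint _ h h').elim
  let α : (X₀.prod ⊤ : (X ⊗ Δ[1]).Subcomplex).toSSet ⟶ (X₀ : SSet.{u}) ⊗ Δ[1] :=
    lift (SSet.Subcomplex.lift ((X₀.prod ⊤ : (X ⊗ Δ[1]).Subcomplex).ι ≫ fst _ _) (by
      rintro U _ ⟨z, rfl⟩
      exact z.2.1)) ((X₀.prod ⊤ : (X ⊗ Δ[1]).Subcomplex).ι ≫ snd _ _)
  obtain ⟨t, ht, ht'⟩ := exists_glue_sup (X₀.prod ⊤) (E 0 ⊔ E 1) (α ≫ arrHom ρ₀) t₁ (by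
    rintro U ⟨x, e⟩ h (h' | h')
    · refine (arrHom_app_zero ρ₀ ⟨x, h.1⟩ e ((mem_cutFiber _ _ _).1 h')).trans ?_
      rw [h₀]
      exact (congrArg (fun φ => φ.app U ⟨(x, e), h'⟩) ht₁).symm
    · refine (arrHom_app_one ρ₀ ⟨x, h.1⟩ e ((mem_cutFiber _ _ _).1 h')).trans ?_
      rw [h₁]
      exact (congrArg (fun φ => φ.app U ⟨(x, e), h'⟩) ht₁').symm)
  have hle : cylSub X₀ ≤ X₀.prod ⊤ ⊔ (E 0 ⊔ E 1) := by
    rintro U z (hz | ⟨-, hz⟩)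
    · exact Or.inl hz
    · refine Or.inr ?_
      rcases (mem_boundary_one _).1 hz with hz | hz
      · exact Or.inl ((mem_cutFiber _ _ _).2 hz)
      · exact Or.inr ((mem_cutFiber _ _ _).2 hz)
  have hz₀ : ∀ (U : SimplexCategoryᵒᵖ) (z : (X ⊗ Δ[1]).obj U) (h), (∀ i, vx z.2 i = 0) →
      (SSet.Subcomplex.homOfLE hle ≫ t).app U ⟨z, h⟩ = s₀.app U z.1 := fun U z h hz => by
    have hm : z ∈ (E 0).obj U := (mem_cutFiber _ _ _).2 hz
    exact (congrArg (fun φ => φ.app U ⟨z, Or.inl hm⟩) ht').trans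
      (congrArg (fun φ => φ.app U ⟨z, hm⟩) ht₁)
  have hz₁ : ∀ (U : SimplexCategoryᵒᵖ) (z : (X ⊗ Δ[1]).obj U) (h), (∀ i, vx z.2 i = 1) →
      (SSet.Subcomplex.homOfLE hle ≫ t).app U ⟨z, h⟩ = s₁.app U z.1 := fun U z h hz => by
    have hm : z ∈ (E 1).obj U := (mem_cutFiber _ _ _).2 hz
    exact (congrArg (fun φ => φ.app U ⟨z, Or.inr hm⟩) ht').trans
      (congrArg (fun φ => φ.app U ⟨z, hm⟩) ht₁')
  obtain ⟨t', ht'⟩ := hext (SSet.Subcomplex.homOfLE hle ≫ t) hz₀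
  have hval : ∀ (U : SimplexCategoryᵒᵖ) (z : (X ⊗ Δ[1]).obj U) (h), t'.app U z =
      (SSet.Subcomplex.homOfLE hle ≫ t).app U ⟨z, h⟩ := fun U z h =>
    congrArg (fun φ => φ.app U ⟨z, h⟩) ht'
  refine ⟨arrMk t', ?_, ?_, ?_⟩
  · rw [← arrMk_arrHom (X₀.ι ≫ arrMk t'), ← arrMk_arrHom ρ₀, arrHom_comp, arrHom_arrMk]
    refine congrArg arrMk ?_
    suffices H : ∀ (U : SimplexCategoryᵒᵖ) (x : (X₀ : SSet.{u}).obj U) (e : (Δ[1] : SSet.{u}).obj U),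
        t'.app U ⟨x.1, e⟩ = (arrHom ρ₀).app U ⟨x, e⟩ by
      ext U x
      exact H U x.1 x.2
    intro U x e
    exact (hval U _ (mem_cylSub_of_left x.2)).trans
      (congrArg (fun φ => φ.app U ⟨(x.1, e), ⟨x.2, trivial⟩⟩) ht)
  · rw [source, ← lift_arrHom, arrHom_arrMk]
    suffices H : ∀ (U : SimplexCategoryᵒᵖ) (x : X.obj U), (lift (𝟙 X) (SSet.const
        (SSet.stdSimplex.obj₀Equiv.symm 0)) ≫ t').app U x = s₀.app U x by
      ext U x
      exact H U x
    intro U x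
    exact (hval U _ (mem_cylSub_of_right _ (Or.inl fun _ => rfl))).trans
      (hz₀ U _ _ fun _ => rfl)
  · rw [target, ← lift_arrHom, arrHom_arrMk]
    suffices H : ∀ (U : SimplexCategoryᵒᵖ) (x : X.obj U), (lift (𝟙 X) (SSet.const
        (SSet.stdSimplex.obj₀Equiv.symm 1)) ≫ t').app U x = s₁.app U x by
      ext U x
      exact H U x
    intro U x
    exact (hval U _ (mem_cylSub_of_right _ (Or.inr fun _ => rfl))).trans
      (hz₁ U _ _ fun _ => rfl)

end Arrows

/-! ## Maps to the category of lax algebras -/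

section LaxAlgebras

variable {X K : SSet.{u}} (F : K ⟶ K)

lemma forget_target : forget F ≫ target K = toSpan F ≫ evalAt spanVertex₂ K := by
  rw [forget, Category.assoc, target, pre_evalAt]
  rfl

lemma laxAlg_condition : (Limits.pullback.fst _ _ : LaxAlg F ⟶ K) ≫ lift F (𝟙 K) =
    toSpan F ≫ lift (evalAt spanVertex₁ K) (evalAt spanVertex₂ K) :=
  Limits.pullback.condition

lemma laxAlg_fst : (Limits.pullback.fst _ _ : LaxAlg F ⟶ K) = toSpan F ≫ evalAt spanVertex₂ K := by
  have h := congrArg (fun φ => φ ≫ snd _ _) (laxAlg_condition F)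
  rw [Category.assoc, lift_snd, Category.comp_id] at h
  exact h.trans ((Category.assoc _ _ _).trans (congrArg (fun φ => toSpan F ≫ φ) (lift_snd _ _)))

lemma toSpan_evalAt : toSpan F ≫ evalAt spanVertex₁ K = toSpan F ≫ evalAt spanVertex₂ K ≫ F := by
  have h := congrArg (fun φ => φ ≫ fst _ _) (laxAlg_condition F)
  rw [Category.assoc, lift_fst, laxAlg_fst] at h
  exact ((Category.assoc _ _ _).symm.trans (h.trans <| (Category.assoc _ _ _).trans
    (congrArg (fun φ => toSpan F ≫ φ) (lift_fst _ _)))).symm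

lemma resolution_target : resolution F ≫ target K = forget F ≫ target K ≫ F := by
  rw [← Category.assoc (forget F), forget_target, Category.assoc, ← toSpan_evalAt, resolution,
    Category.assoc, target, pre_evalAt]
  rfl

lemma uncurry_source (r : X ⟶ Arr K) :
    SSet.stdSimplex.δ (1 : Fin 2) ▷ X ≫ uncurry r = snd _ _ ≫ r ≫ source K := by
  rw [source, comp_evalAt, ← Category.assoc, SSet.stdSimplex.δ_one_eq_const]
  rfl

/-- The horn is two edges glued at their source, and tensoring with `X` preserves this pushout. A
map to `Span K` is therefore a pair of maps to `Arr K` with the same source. -/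
lemma isPushout_whiskerRight (X : SSet.{u}) :
    IsPushout (SSet.stdSimplex.{u}.δ (1 : Fin 2) ▷ X) (SSet.stdSimplex.{u}.δ (1 : Fin 2) ▷ X)
      (SSet.horn₂₀.ι₀₁ ▷ X) (SSet.horn₂₀.ι₀₂ ▷ X) :=
  SSet.horn₂₀.isPushout.map (tensorRight X)

lemma forget_source : forget F ≫ source K = resolution F ≫ source K := by
  rw [forget, resolution, Category.assoc, Category.assoc, source, pre_evalAt, pre_evalAt]
  refine congrArg (fun v => toSpan F ≫ evalAt v K) ?_
  have h := congrArg (fun φ => φ.app _ (SSet.stdSimplex.obj₀Equiv.symm 0)) SSet.horn₂₀.isPushout.w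
  rw [SSet.stdSimplex.δ_one_eq_const] at h
  exact h.symm

variable {F}

/-- The two edges determine the span, and the component in `K` is the vertex `2` of the span. -/
lemma laxAlg_hom_ext {z z' : X ⟶ LaxAlg F} (h₁ : z ≫ forget F = z' ≫ forget F)
    (h₂ : z ≫ resolution F = z' ≫ resolution F) : z = z' := by
  have hs : z ≫ toSpan F = z' ≫ toSpan F := by
    refine uncurry_injective ((isPushout_whiskerRight X).hom_ext ?_ ?_)
    · rw [← uncurry_pre_app, ← uncurry_pre_app, Category.assoc, Category.assoc]
      exact congrArg uncurry h₂
    · rw [← uncurry_pre_app, ← uncurry_pre_app, Category.assoc, Category.assoc]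
      exact congrArg uncurry h₁
  refine Limits.pullback.hom_ext ?_ hs
  rw [laxAlg_fst]
  exact congrArg (fun φ => φ ≫ evalAt spanVertex₂ K) hs

lemma exists_laxAlg_lift (x y : X ⟶ Arr K) (hs : x ≫ source K = y ≫ source K)
    (ht : y ≫ target K = x ≫ target K ≫ F) :
    ∃ z : X ⟶ LaxAlg F, z ≫ forget F = x ∧ z ≫ resolution F = y := by
  let w : X ⟶ Span K := curry ((isPushout_whiskerRight X).desc (uncurry y) (uncurry x)
    (by rw [uncurry_source, uncurry_source, hs]))
  have h₁ : w ≫ (MonoidalClosed.pre SSet.horn₂₀.ι₀₁).app K = y := by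
    rw [curry_pre_app, IsPushout.inl_desc, curry_uncurry]
  have h₂ : w ≫ (MonoidalClosed.pre SSet.horn₂₀.ι₀₂).app K = x := by
    rw [curry_pre_app, IsPushout.inr_desc, curry_uncurry]
  refine ⟨Limits.pullback.lift (x ≫ target K) w ?_, ?_, ?_⟩
  · rw [comp_lift, comp_lift, Category.comp_id, Category.assoc]
    refine congrArg₂ lift ?_ ?_
    · rw [← ht, ← h₁, Category.assoc, target, pre_evalAt]
      rfl
    · rw [← h₂, Category.assoc, target, pre_evalAt]
      rfl
  · exact (Limits.pullback.lift_snd_assoc _ _ _ _).trans h₂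
  · exact (Limits.pullback.lift_snd_assoc _ _ _ _).trans h₁

end LaxAlgebras

/-! ## Extending maps from a prism over a colimit cone -/

section PrismExtension

variable (J : SSet.{u}) (n : ℕ)

lemma lastCut_mono :
    Monotone fun i : Fin (n + 1) => (if (i : ℕ) < n then 0 else 1 : Fin 2) := by
  intro i j h
  have := Fin.le_def.1 h
  dsimp only
  split_ifs
  · exact le_rfl
  · exact Fin.zero_le _
  · lia
  · exact le_rfl

/-- The map which sends the last vertex to `1` and the others to `0`. -/
def lastCut : (Δ[n] : SSet.{u}) ⟶ Δ[1] := simplexMap _ (lastCut_mono n)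

variable {n}

lemma vx_lastCut {U : SimplexCategoryᵒᵖ} (x : (Δ[n] : SSet.{u}).obj U) (i) :
    vx ((lastCut n).app U x) i = if (vx x i : ℕ) < n then 0 else 1 := rfl

variable {J}

/-- The region `lastCut = 0` omits the last vertex, so it lies over `∂Δ[n]`. The given map is thus
defined on all of `J^▷ ⊗ prismBase`. -/
lemma mem_cylSub_cylBase {U : SimplexCategoryᵒᵖ} {z : ((rightCone J ⊗ Δ[n]) ⊗ Δ[1]).obj U}
    (h : (z.1.2, z.2) ∈ (prismBase (lastCut n)).obj U) : z ∈ (cylSub (cylBase J n)).obj U := by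
  rcases h with (h | h) | h
  · refine mem_cylSub_of_left (mem_cylBase_of_ne _ (Fin.last n) fun i e => ?_)
    have h' : vx ((lastCut n).app U z.1.2) i = 0 := h i
    rw [vx_lastCut, e] at h'
    simp at h'
  · exact mem_cylSub_of_right _ (Or.inr h)
  · obtain ⟨j, hj⟩ := (mem_boundary_vx _).1 h.2.1
    exact mem_cylSub_of_left (mem_cylBase_of_ne _ j hj)

lemma mem_prismBase_lastCut {U : SimplexCategoryᵒᵖ} {z : ((rightCone J ⊗ Δ[n]) ⊗ Δ[1]).obj U}
    (h : (z.1.2, z.2) ∈ (relPart lePart (lastCut n)).obj U)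
    (hz : z ∈ (cylSub (cylBase J n)).obj U) :
    z.1.1 ∈ (cutFiber (joinCut J Δ[0]) 0).obj U ∨
      (z.1.2, z.2) ∈ (prismBase (lastCut n)).obj U := by
  rcases hz with ⟨hz | hz, -⟩ | ⟨-, hz⟩
  · exact Or.inl hz.1
  · exact Or.inr (Or.inr ⟨h, hz.2, trivial⟩)
  · refine Or.inr (Or.inl ?_)
    rcases (mem_boundary_one _).1 hz with hz | hz
    · exact Or.inl fun i => Fin.le_zero_iff.1 ((h i).trans (hz i).le)
    · exact Or.inr hz

variable (J n) in
/-- The part of `J^▷ ⊗ Δ[n] ⊗ Δ[1]` over the lower part of the prism `Δ[n] ⊗ Δ[1]`. -/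
def conePrism : ((rightCone J ⊗ Δ[n]) ⊗ Δ[1]).Subcomplex :=
  (relPart lePart (lastCut n)).preimage (lift (fst _ _ ≫ snd _ _) (snd _ _))

lemma mem_conePrism {U : SimplexCategoryᵒᵖ} (z : ((rightCone J ⊗ Δ[n]) ⊗ Δ[1]).obj U) :
    z ∈ (conePrism J n).obj U ↔ ∀ i, vx ((lastCut n).app U z.1.2) i ≤ vx z.2 i := Iff.rfl

/-- Transposed, this is a lifting problem from `prismBase` to the lower part of the prism against
the restriction from `K^{J^▷}` to `K^J`, an inner fibration since `K` is a quasicategory. The bottom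
map records the data over `J`. -/
lemma exists_conePrism_extension {K : SSet.{u}} [SSet.Quasicategory K]
    (t : (cylSub (cylBase J n) : SSet.{u}) ⟶ K) :
    ∃ t' : (cylSub (cylBase J n) ⊔ conePrism J n :
        ((rightCone J ⊗ Δ[n]) ⊗ Δ[1]).Subcomplex).toSSet ⟶ K,
      SSet.Subcomplex.homOfLE le_sup_left ≫ t' = t := by
  let D := relPart lePart (lastCut.{u} n)
  let D₀ := prismBase (lastCut.{u} n)
  let a : rightCone J ⊗ (D₀ : SSet.{u}) ⟶ (cylSub (cylBase J n) : SSet.{u}) :=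
    SSet.Subcomplex.lift (rightCone J ◁ D₀.ι ≫ (α_ _ _ _).inv) (by
      rintro U _ ⟨z, rfl⟩
      exact mem_cylSub_cylBase z.2.2)
  let b : J ⊗ (D : SSet.{u}) ⟶ (cylSub (cylBase J n) : SSet.{u}) :=
    SSet.Subcomplex.lift ((coneIncl J ⊗ₘ D.ι) ≫ (α_ _ _ _).inv) (by
      rintro U _ ⟨z, rfl⟩
      exact mem_cylSub_of_left (Or.inl ⟨joinInl_mem z.1, trivial⟩))
  have sq : CommSq (curry (a ≫ t)) (SSet.Subcomplex.homOfLE (prismBase_le (lastCut n)))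
      ((MonoidalClosed.pre (coneIncl J)).app K) (curry (b ≫ t)) := ⟨by
    rw [curry_pre_app, ← curry_natural_left]
    rfl⟩
  obtain ⟨⟨d, hd₁, hd₂⟩⟩ := ((hasLiftingProperty_prismBase (lastCut n)
    ((MonoidalClosed.pre (coneIncl J)).app K)).sq_hasLift sq).exists_lift
  have hd₁' : rightCone J ◁ SSet.Subcomplex.homOfLE (prismBase_le (lastCut n)) ≫ uncurry d =
      a ≫ t := by
    rw [← uncurry_natural_left, hd₁, uncurry_curry]
  have hd₂' : coneIncl J ▷ _ ≫ uncurry d = b ≫ t := by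
    rw [← uncurry_pre_app, hd₂, uncurry_curry]
  let e : (conePrism J n : SSet.{u}) ⟶ rightCone J ⊗ (D : SSet.{u}) :=
    lift ((conePrism J n).ι ≫ fst _ _ ≫ fst _ _)
      (SSet.Subcomplex.lift ((conePrism J n).ι ≫ lift (fst _ _ ≫ snd _ _) (snd _ _)) (by
        rintro U _ ⟨z, rfl⟩
        exact z.2))
  obtain ⟨t', ht', -⟩ := exists_glue_sup _ (conePrism J n) t (e ≫ uncurry d) fun U z hz hz' => by
    rcases mem_prismBase_lastCut hz' hz with h | h
    · have hj := joinInl_joinLeft z.1.1 h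
      refine Eq.trans ?_ ((congrArg (fun φ : J ⊗ (D : SSet.{u}) ⟶ K => φ.app U
        ((joinLeft J Δ[0]).app U ⟨_, h⟩, ⟨(z.1.2, z.2), hz'⟩)) hd₂').symm.trans ?_)
      · exact congrArg (t.app U) (Subtype.ext (Prod.ext (Prod.ext hj.symm rfl) rfl))
      · exact congrArg (fun y => (uncurry d).app U (y, ⟨(z.1.2, z.2), hz'⟩)) hj
    · exact (congrArg (fun φ => φ.app U (z.1.1, ⟨(z.1.2, z.2), h⟩)) hd₁').symm
  exact ⟨t', ht'⟩

variable (n) in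
/-- The retraction of a prism onto its last cell. -/
def prismRetract : (Δ[n] ⊗ Δ[1] : SSet.{u}) ⟶ Δ[n + 1] where
  app _ := ↾fun z => vxMk
    (fun i => if vx z.2 i = 0 then (vx z.1 i).castSucc else Fin.last _) fun i j h => by
      have h₁ := vx_mono z.1 h
      have h₂ := vx_mono z.2 h
      dsimp only
      split_ifs with hi hj hj
      · exact h₁
      · exact Fin.le_last _
      · exact absurd (h₂.trans hj.le) (by lia)
      · exact le_rfl
  naturality _ _ _ := rfl

lemma vx_prismRetract {U : SimplexCategoryᵒᵖ} (z : (Δ[n] ⊗ Δ[1] : SSet.{u}).obj U) (i) :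
    vx ((prismRetract n).app U z) i =
      if vx z.2 i = 0 then (vx z.1 i).castSucc else Fin.last _ := rfl

variable (J n) in
/-- The part of `J^▷ ⊗ Δ[n] ⊗ Δ[1]` over the last cell of the prism `Δ[n] ⊗ Δ[1]`. -/
def coneCell : ((rightCone J ⊗ Δ[n]) ⊗ Δ[1]).Subcomplex where
  obj U := {z | ∀ i, vx z.2 i ≤ vx ((lastCut n).app U z.1.2) i}
  map f _ hz i := hz (f.unop.toOrderHom i)

lemma vx_fst_of_mem_coneCell {U : SimplexCategoryᵒᵖ} {z : ((rightCone J ⊗ Δ[n]) ⊗ Δ[1]).obj U}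
    (hz : z ∈ (coneCell J n).obj U) {i} (hi : vx z.2 i ≠ 0) : (vx z.1.2 i : ℕ) = n := by
  have h := hz i
  rw [vx_lastCut] at h
  have := (vx z.1.2 i).2
  split_ifs at h
  · exact absurd (Fin.le_zero_iff.1 h) hi
  · lia

lemma mem_conePrism_or {U : SimplexCategoryᵒᵖ} (z : ((rightCone J ⊗ Δ[n]) ⊗ Δ[1]).obj U) :
    z ∈ (conePrism J n).obj U ∨ z ∈ (coneCell J n).obj U := by
  by_contra! h
  obtain ⟨h₁, h₂⟩ := h
  rw [mem_conePrism] at h₁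
  have h₂' : ¬ ∀ i, vx z.2 i ≤ vx ((lastCut n).app U z.1.2) i := h₂
  push Not at h₁ h₂'
  obtain ⟨i, hi⟩ := h₁
  obtain ⟨j, hj⟩ := h₂'
  rcases le_total i j with h | h
  · have := vx_mono ((lastCut n).app U z.1.2) h
    lia
  · have := vx_mono z.2 h
    lia

/-- In the last cell, height `1` occurs only over the last vertex `n`. Sending all of height `1` to
the vertex `n + 1` is then reversible. -/
lemma prismCell_prismRetract {U : SimplexCategoryᵒᵖ} (z : ((rightCone J ⊗ Δ[n]) ⊗ Δ[1]).obj U)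
    (hz : z ∈ (coneCell J n).obj U) :
    (prismCell n le_rfl).app U ((prismRetract n).app U (z.1.2, z.2)) = (z.1.2, z.2) := by
  refine Prod.ext (vx_ext fun i => Fin.ext ?_) (vx_ext fun i => ?_)
  · rw [vx_prismCell_fst, vx_prismRetract (z.1.2, z.2) i]
    have h₁ := (vx z.1.2 i).2
    by_cases hi : vx z.2 i = 0
    · rw [if_pos hi, if_pos (by simp only [Fin.val_castSucc]; lia)]
      rfl
    · rw [if_neg hi, if_neg (by simp)]
      have := vx_fst_of_mem_coneCell hz hi
      simp only [Fin.val_last]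
      lia
  · rw [vx_prismCell_snd, vx_prismRetract (z.1.2, z.2) i]
    have h₁ := (vx z.1.2 i).2
    by_cases hi : vx z.2 i = 0
    · rw [if_pos hi, if_pos (by simp only [Fin.val_castSucc]; lia), hi]
    · rw [if_neg hi, if_neg (by simp)]
      lia

lemma prismRetract_mem {U : SimplexCategoryᵒᵖ} (z : ((rightCone J ⊗ Δ[n]) ⊗ Δ[1]).obj U)
    (hz' : z ∈ (cylSub (cylBase J n) ⊔ conePrism J n :
      ((rightCone J ⊗ Δ[n]) ⊗ Δ[1]).Subcomplex).obj U) :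
    ((z.1.1, (prismRetract n).app U (z.1.2, z.2)) : (rightCone J ⊗ Δ[n + 1]).obj U) ∈
      (cylBase J (n + 1)).obj U := by
  rcases hz' with (⟨hz' | hz', -⟩ | ⟨-, hz'⟩) | hz'
  · exact mem_cylBase_of_cut _ ((mem_cutFiber _ _ _).1 hz'.1)
  · obtain ⟨j, hj⟩ := (mem_boundary_vx _).1 hz'.2
    refine mem_cylBase_of_ne _ j.castSucc fun i => ?_
    refine ne_of_eq_of_ne (vx_prismRetract (z.1.2, z.2) i) ?_
    split_ifs
    · exact fun h => hj i (Fin.castSucc_injective _ h)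
    · exact (Fin.castSucc_lt_last j).ne'
  · rcases (mem_boundary_one _).1 hz' with hz' | hz'
    · refine mem_cylBase_of_ne _ (Fin.last _) fun i => ?_
      refine ne_of_eq_of_ne ((vx_prismRetract (z.1.2, z.2) i).trans (if_pos (hz' i))) ?_
      exact (Fin.castSucc_lt_last _).ne
    · refine mem_cylBase_of_ne _ 0 fun i => ?_
      refine ne_of_eq_of_ne ((vx_prismRetract (z.1.2, z.2) i).trans
        (if_neg (ne_of_eq_of_ne (hz' i) one_ne_zero))) ?_
      exact (Fin.last_pos).ne'
  · refine mem_cylBase_of_ne _ (Fin.last n).castSucc fun i => ?_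
    have h := hz' i
    refine ne_of_eq_of_ne (vx_prismRetract (z.1.2, z.2) i) ?_
    split_ifs with hi
    · intro h'
      have h₁ : vx ((lastCut n).app U z.1.2) i ≤ vx z.2 i := h
      rw [vx_lastCut, Fin.castSucc_injective _ h', hi] at h₁
      simp at h₁
    · exact (Fin.castSucc_lt_last _).ne'

/-- The whole boundary of the last cell is already filled: face `n` lies in the part filled by inner
horns, face `n + 1` in the end `0`, and the others over `∂Δ[n]`. -/
lemma prismCell_mem_sup {U : SimplexCategoryᵒᵖ} (w : (rightCone J ⊗ Δ[n + 1]).obj U)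
    (hw : w ∈ (cylBase J (n + 1)).obj U) :
    (((w.1, ((prismCell n le_rfl).app U w.2).1), ((prismCell n le_rfl).app U w.2).2) :
      ((rightCone J ⊗ Δ[n]) ⊗ Δ[1]).obj U) ∈
      (cylSub (cylBase J n) ⊔ conePrism J n :
        ((rightCone J ⊗ Δ[n]) ⊗ Δ[1]).Subcomplex).obj U := by
  rcases mem_cylBase hw with hw | ⟨j, hj⟩
  · exact Or.inl (mem_cylSub_of_left (mem_cylBase_of_cut _ hw))
  · have hj' : ∀ i, (vx w.2 i : ℕ) ≠ j := fun i h => hj i (Fin.ext h)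
    rcases lt_trichotomy (j : ℕ) n with h | h | h
    · refine Or.inl (mem_cylSub_of_left (mem_cylBase_of_ne _ ⟨j, by lia⟩ fun i h' => ?_))
      have h₁ := (vx_prismCell_fst n le_rfl w.2 i).symm.trans (congrArg Fin.val h')
      have := hj' i
      have := (vx w.2 i).2
      split_ifs at h₁ <;> simp only at h₁ <;> lia
    · refine Or.inr ((mem_conePrism _).2 fun i => ?_)
      rw [vx_lastCut, vx_prismCell_snd, vx_prismCell_fst]
      have := hj' i
      split_ifs <;> lia
    · refine Or.inl (mem_cylSub_of_right _ (Or.inl fun i => ?_))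
      rw [vx_prismCell_snd, if_pos]
      have := hj' i
      have := (vx w.2 i).2
      lia

/-- A map which is given on the boundary of the prism and on `J`, and which is a colimit cone over
the first end of the prism, extends. -/
theorem exists_prism_extension {K : SSet.{u}} [SSet.Quasicategory K] {c : rightCone J ⟶ K}
    (hc : IsColimitCone c) (t : (cylSub (cylBase J n) : SSet.{u}) ⟶ K)
    (ht : ∀ (U : SimplexCategoryᵒᵖ) (z : ((rightCone J ⊗ Δ[n]) ⊗ Δ[1]).obj U) (h),
      (∀ i, vx z.2 i = 0) → t.app U ⟨z, h⟩ = c.app U z.1.1) :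
    ∃ t' : (rightCone J ⊗ Δ[n]) ⊗ Δ[1] ⟶ K, (cylSub (cylBase J n)).ι ≫ t' = t := by
  obtain ⟨t₁, ht₁⟩ := exists_conePrism_extension t
  obtain ⟨t₀, ht₀⟩ := exists_extension_of_retract (Ω' := ⊤) (P := coneCell J n)
    (W₀ := cylBase J (n + 1)) le_top
    ((α_ _ _ _).hom ≫ rightCone J ◁ prismRetract n)
    (rightCone J ◁ prismCell n le_rfl ≫ (α_ _ _ _).inv)
    (fun U z _ => (mem_conePrism_or z).imp_left Or.inr)
    (fun U z hz => by
      have h := prismCell_prismRetract z hz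
      have h₁ := congrArg Prod.fst h
      have h₂ := congrArg Prod.snd h
      exact Prod.ext (Prod.ext rfl h₁) h₂)
    (fun U z _ hz' => prismRetract_mem z hz')
    (fun U w hw => prismCell_mem_sup w hw) t₁ (by
    -- The initial vertex of the last cell is `(0,0)`, in the end `0`, where the map is the colimit
    -- cone. The cell has dimension `n + 1`, so this also covers `n = 0`.
    refine fun s hs => exists_cylBase_extension hc s fun U z hz h => ?_
    have h₀ : ∀ i, vx ((prismCell n le_rfl).app U z.2).2 i = 0 := fun i => by
      rw [vx_prismCell_snd, h i, if_pos]
      exact Nat.zero_le _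
    have hm : (((z.1, ((prismCell n le_rfl).app U z.2).1), ((prismCell n le_rfl).app U z.2).2) :
      ((rightCone J ⊗ Δ[n]) ⊗ Δ[1]).obj U) ∈ (cylSub (cylBase J n)).obj U :=
      mem_cylSub_of_right _ (Or.inl h₀)
    refine (hs U z hz).trans (Eq.trans ?_ (ht U _ hm h₀))
    exact congrArg (fun φ => φ.app U ⟨_, hm⟩) ht₁)
  refine ⟨SSet.Subcomplex.lift (𝟙 _) le_top ≫ t₀, ?_⟩
  refine Eq.trans ?_ ht₁
  exact congrArg (fun φ => SSet.Subcomplex.homOfLE le_sup_left ≫ φ) ht₀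

end PrismExtension

/-! ## Colimits of lax algebras -/

section Reflection

variable {J K L A B : SSet.{u}}

lemma IsColimitCone.isRelColimitCone {c : rightCone J ⟶ K} (hc : IsColimitCone c) (q : K ⟶ ⊤_ SSet.{u}) :
    IsRelColimitCone q c := fun A B i _ f g k h₁ h₂ _ _ => by
  obtain ⟨h, hf, hg⟩ := hc i f g h₁ h₂
  exact ⟨h, hf, hg, Limits.terminal.hom_ext _ _⟩

/-- Compatible maps on `J ⋆ B` and `J^▷ ⋆ A` glue. -/
lemma exists_glue_join (i : A ⟶ B) [Mono i] (f : join J B ⟶ L) (g : join (rightCone J) A ⟶ L)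
    (hfg : joinMap (𝟙 J) i ≫ f = joinMap (coneIncl J) (𝟙 A) ≫ g) :
    ∃ m : (stepSub (SSet.Subcomplex.range (joinMap (𝟙 (rightCone J)) i)) : SSet.{u}) ⟶ L,
      (∀ (U : SimplexCategoryᵒᵖ) (y : (join J B).obj U),
        m.app U ⟨(joinMap (coneIncl J) (𝟙 B)).app U y, Or.inl ⟨y, rfl⟩⟩ = f.app U y) ∧
      ∀ (U : SimplexCategoryᵒᵖ) (y : (join (rightCone J) A).obj U),
        m.app U ⟨(joinMap (𝟙 (rightCone J)) i).app U y, Or.inr ⟨y, rfl⟩⟩ = g.app U y := by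
  let α : join J B ⟶ (stepSub (SSet.Subcomplex.range (joinMap (𝟙 (rightCone J)) i)) : SSet.{u}) :=
    SSet.Subcomplex.lift (joinMap (coneIncl J) (𝟙 B)) (by
      rintro U _ ⟨y, rfl⟩
      exact Or.inl ⟨y, rfl⟩)
  let β : join (rightCone J) A ⟶
      (stepSub (SSet.Subcomplex.range (joinMap (𝟙 (rightCone J)) i)) : SSet.{u}) :=
    SSet.Subcomplex.lift (joinMap (𝟙 (rightCone J)) i) (by
      rintro U _ ⟨y, rfl⟩
      exact Or.inr ⟨y, rfl⟩)
  obtain ⟨m, hf, hg⟩ := exists_glue α β f g (by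
      rintro U ⟨x, ⟨y, rfl⟩ | ⟨y, rfl⟩⟩
      · exact Or.inl ⟨y, rfl⟩
      · exact Or.inr ⟨y, rfl⟩) (fun U y y' h => by
      rw [app_injective_of_mono (joinMap (coneIncl J) (𝟙 B)) U (congrArg Subtype.val h)])
    (fun U y y' h => by
      rw [app_injective_of_mono (joinMap (𝟙 (rightCone J)) i) U (congrArg Subtype.val h)])
    fun U y y' h => by
      have h₀ : (joinMap (coneIncl J) (𝟙 B)).app U y = (joinMap (𝟙 (rightCone J)) i).app U y' :=
        congrArg Subtype.val h
      -- The overlap of `J ⋆ B` and `J^▷ ⋆ A` is `J ⋆ A`: the component in `B` of `y` comes from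
      -- `A`.
      obtain ⟨w, rfl⟩ : y ∈ (SSet.Subcomplex.range (joinMap (𝟙 J) i)).obj U := by
        refine mem_range_joinMap _ _ y (fun _ _ _ => ⟨_, rfl⟩) fun V φ hφ => ?_
        have h₁ : (join _ _).map φ ((joinMap (coneIncl J) (𝟙 B)).app U y) =
            (joinMap (𝟙 (rightCone J)) i).app V ((join _ _).map φ y') :=
          (congrArg _ h₀).trans (NatTrans.naturality_apply (joinMap (𝟙 (rightCone J)) i) φ y').symm
        have h₂ : (joinMap (coneIncl J) (𝟙 B)).app V ((join _ _).map φ y) =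
            (joinMap (𝟙 (rightCone J)) i).app V ((join _ _).map φ y') :=
          (NatTrans.naturality_apply (joinMap (coneIncl J) (𝟙 B)) φ y).trans h₁
        have h₃ := (joinMap_mem (coneIncl J) (𝟙 B) _ 1).2 hφ
        have h₄ := h₃
        rw [h₂] at h₄
        have h₅ := (joinMap_mem (𝟙 (rightCone J)) i _ 1).1 h₄
        have e₁ := joinMap_right (coneIncl J) (𝟙 B) _ hφ h₃
        have e₂ := joinMap_right (𝟙 (rightCone J)) i _ h₅ h₄
        exact ⟨_, e₂.symm.trans ((joinRight_congr h₂ h₃ h₄).symm.trans e₁)⟩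
      have h₁ : (joinMap (coneIncl J) (𝟙 A)).app U w = y' :=
        app_injective_of_mono (joinMap (𝟙 (rightCone J)) i) U h₀
      exact (congrArg (fun φ => φ.app U w) hfg).trans (congrArg (g.app U) h₁)
  exact ⟨m, fun U y => congrArg (fun φ => φ.app U y) hf, fun U y => congrArg (fun φ => φ.app U y) hg⟩

/-- The functor `u` reflects colimits which are preserved by the source functor. -/
theorem isColimitCone_of_forget [SSet.Quasicategory K] (F : K ⟶ K) (P : rightCone J ⟶ LaxAlg F)
    (hP : IsColimitCone (P ≫ forget F)) (hP' : IsColimitCone (P ≫ forget F ≫ source K)) :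
    IsColimitCone P := by
  intro A B i _ f g hg hfg
  obtain ⟨h, hf, hg'⟩ := hP i (f ≫ forget F) (g ≫ forget F) (by rw [← hg, Category.assoc])
    (by rw [← Category.assoc, hfg, Category.assoc])
  obtain ⟨m, hm, hm'⟩ := exists_glue_join i f g hfg
  let X₀ := stepSub (SSet.Subcomplex.range (joinMap (𝟙 (rightCone J)) i))
  have hmh : m ≫ forget F = X₀.ι ≫ h := by
    suffices H : ∀ U x, (m ≫ forget F).app U x = (X₀.ι ≫ h).app U x by
      ext U x
      exact H U x
    rintro U ⟨_, ⟨y, rfl⟩ | ⟨y, rfl⟩⟩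
    · exact (congrArg ((forget F).app U) (hm U y)).trans
        (congrArg (fun φ => φ.app U y) hf).symm
    · exact (congrArg ((forget F).app U) (hm' U y)).trans
        (congrArg (fun φ => φ.app U y) hg').symm
  -- The source and target are forced by the lax action `h` found first. Only the source has to be a
  -- colimit cone, so nothing is asked of `F`.
  obtain ⟨ρ, hρ, hs, ht⟩ := exists_arr_extension (X₀ := X₀) (m ≫ resolution F) (h ≫ source K)
    (h ≫ target K ≫ F)
    (by rw [Category.assoc, ← forget_source, ← Category.assoc, hmh, Category.assoc])
    (by rw [Category.assoc, resolution_target, ← Category.assoc, hmh, Category.assoc]) (by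
    intro t ht
    obtain ⟨t', ht', -⟩ := exists_cylinder_extension (Limits.terminal.from K)
      (P ≫ forget F ≫ source K) (hP'.isRelColimitCone _) (Or.inr ⟨A, i, inferInstance, rfl⟩) t
      (Limits.terminal.from _) (Limits.terminal.hom_ext _ _) (by
      intro U x hx
      refine (ht U _ hx fun _ => rfl).trans ?_
      have e : joinInl (rightCone J) B ≫ h = P ≫ forget F := by
        rw [← hg, Category.assoc, ← hg', ← Category.assoc, joinInl_naturality,
          Category.id_comp]
      exact congrArg (fun φ => (φ ≫ source K).app U x) e)
    exact ⟨t', ht'⟩)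
  obtain ⟨z, hz, hz'⟩ := exists_laxAlg_lift h ρ hs.symm ht
  refine ⟨z, laxAlg_hom_ext ?_ ?_, laxAlg_hom_ext ?_ ?_⟩
  · rw [Category.assoc, hz, hf]
  · rw [Category.assoc, hz']
    suffices H : ∀ U y, (joinMap (coneIncl J) (𝟙 B) ≫ ρ).app U y = (f ≫ resolution F).app U y by
      ext U y
      exact H U y
    intro U y
    exact (congrArg (fun φ => φ.app U ⟨_, Or.inl ⟨y, rfl⟩⟩) hρ).trans
      (congrArg ((resolution F).app U) (hm U y))
  · rw [Category.assoc, hz, hg']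
  · rw [Category.assoc, hz']
    suffices H : ∀ U y, (joinMap (𝟙 (rightCone J)) i ≫ ρ).app U y =
        (g ≫ resolution F).app U y by
      ext U y
      exact H U y
    intro U y
    exact (congrArg (fun φ => φ.app U ⟨_, Or.inr ⟨y, rfl⟩⟩) hρ).trans
      (congrArg ((resolution F).app U) (hm' U y))

end Reflection

/-! ### Contractibility of the space of induced maps -/

section Contractibility

variable {X Z A Y J K : SSet.{u}}

lemma const_yonedaEquiv (k : Δ[0] ⟶ Y) :
    (SSet.const (SSet.yonedaEquiv k) : Z ⟶ Y) = toPoint Z ≫ k := by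
  suffices H : ∀ U z, (SSet.const (SSet.yonedaEquiv k) : Z ⟶ Y).app U z = (toPoint Z ≫ k).app U z by
    ext U z
    exact H U z
  intro U z
  exact (NatTrans.naturality_apply k _ _).symm.trans (congrArg (k.app U) (Subsingleton.elim _ _))

lemma uncurry_const_homVertex (h : A ⟶ Y) :
    uncurry (SSet.const (homVertex h) : Z ⟶ (ihom A).obj Y) = fst A Z ≫ h := by
  rw [homVertex, const_yonedaEquiv, ← curry_natural_left, uncurry_curry, ← Category.assoc,
    whiskerLeft_fst]

lemma mem_ofSimplex_iff (y : Y _⦋0⦌) {U : SimplexCategoryᵒᵖ} (x : Y.obj U) :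
    x ∈ (SSet.Subcomplex.ofSimplex y).obj U ↔ x = (SSet.const y : Y ⟶ Y).app U x := by
  rw [SSet.Subcomplex.mem_ofSimplex_obj_iff]
  constructor
  · rintro ⟨f, rfl⟩
    exact congrArg (fun g => Y.map (Quiver.Hom.op g) y) (Subsingleton.elim _ _)
  · intro h
    exact ⟨_, h.symm⟩

/-- The maps to the fibre over a vertex of an internal hom. -/
lemma mem_fiberOver_homVertex_iff (f : X ⟶ (ihom A).obj Y) (h : A ⟶ Y) (ψ : Z ⟶ X) :
    (∀ (U : SimplexCategoryᵒᵖ) (z : Z.obj U), ψ.app U z ∈ (fiberOver f (homVertex h)).obj U) ↔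
      uncurry (ψ ≫ f) = fst A Z ≫ h := by
  rw [← uncurry_const_homVertex, uncurry_injective.eq_iff]
  constructor
  · intro H
    suffices H' : ∀ U z, (ψ ≫ f).app U z = (SSet.const (homVertex h) : Z ⟶ _).app U z by
      ext U z
      exact H' U z
    intro U z
    exact (mem_ofSimplex_iff _ _).1 (H U z)
  · intro H U z
    exact (mem_ofSimplex_iff _ _).2 (congrArg (fun φ => φ.app U z) H)

/-- The maps to the simplicial set of induced maps. -/
lemma mem_inducedMaps_iff {F : K ⟶ K} (p : J ⟶ LaxAlg F) (c : rightCone J ⟶ Arr K)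
    (ψ : Z ⟶ (ihom (rightCone J)).obj (Arr K)) :
    (∀ (U : SimplexCategoryᵒᵖ) (z : Z.obj U), ψ.app U z ∈ (inducedMaps F p c).obj U) ↔
      coneIncl J ▷ Z ≫ uncurry ψ = fst _ _ ≫ p ≫ resolution F ∧
      uncurry ψ ≫ source K = fst _ _ ≫ c ≫ source K ∧
      uncurry ψ ≫ target K = fst _ _ ≫ c ≫ target K ≫ F := by
  rw [← uncurry_pre_app, ← uncurry_natural_right, ← uncurry_natural_right,
    ← mem_fiberOver_homVertex_iff, ← mem_fiberOver_homVertex_iff, ← mem_fiberOver_homVertex_iff]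
  exact ⟨fun H => ⟨fun U z => (H U z).1.1, fun U z => (H U z).1.2, fun U z => (H U z).2⟩,
    fun H U z => ⟨⟨H.1 U z, H.2.1 U z⟩, H.2.2 U z⟩⟩

/-- A sphere in the space of induced maps is a map on `J^▷ ⊗ ∂Δ[n]`. It glues with the constant
family of resolutions on `J ⊗ Δ[n]`, and filling it means extending over `J^▷ ⊗ Δ[n]` with constant
source and target. The source is the colimit cone, so `exists_prism_extension` applies. -/
theorem isContractible_inducedMaps [SSet.Quasicategory K] (F : K ⟶ K) (p : J ⟶ LaxAlg F)
    (c : rightCone J ⟶ Arr K) (hpc : coneIncl J ≫ c = p ≫ forget F)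
    (hc : IsColimitCone (c ≫ source K)) : IsContractible (inducedMaps F p c : SSet.{u}) := by
  intro n σ
  obtain ⟨h₁, h₂, h₃⟩ := (mem_inducedMaps_iff p c (σ ≫ (inducedMaps F p c).ι)).1
    fun U z => (σ.app U z).2
  let s := uncurry (σ ≫ (inducedMaps F p c).ι)
  let CJ : (rightCone J ⊗ Δ[n]).Subcomplex := (cutFiber (joinCut J Δ[0]) 0).prod ⊤
  let CB : (rightCone J ⊗ Δ[n]).Subcomplex := (⊤ : (rightCone J).Subcomplex).prod ∂Δ[n]
  let a : (CJ : SSet.{u}) ⟶ J :=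
    SSet.Subcomplex.lift (CJ.ι ≫ fst _ _) (by
      rintro U _ ⟨z, rfl⟩
      exact z.2.1) ≫ joinLeft J Δ[0]
  let b : (CB : SSet.{u}) ⟶ rightCone J ⊗ (∂Δ[n] : SSet.{u}) :=
    lift (CB.ι ≫ fst _ _) (SSet.Subcomplex.lift (CB.ι ≫ snd _ _) (by
      rintro U _ ⟨z, rfl⟩
      exact z.2.2))
  have ha : a ≫ coneIncl J = CJ.ι ≫ fst _ _ := by
    suffices H : ∀ U z, (a ≫ coneIncl J).app U z = (CJ.ι ≫ fst _ _).app U z by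
      ext U z
      exact H U z
    exact fun U z => joinInl_joinLeft z.1.1 z.2.1
  obtain ⟨ρ₀, ha₀, hb₀⟩ := exists_glue_sup CJ CB (a ≫ p ≫ resolution F) (b ≫ s) fun U z hz hz' => by
    have e := joinInl_joinLeft z.1 hz.1
    refine (congrArg (fun φ : J ⊗ (∂Δ[n] : SSet.{u}) ⟶ Arr K =>
      φ.app U ((joinLeft J Δ[0]).app U ⟨_, hz.1⟩, ⟨z.2, hz'.2⟩)) h₁).symm.trans ?_
    exact congrArg (fun y => s.app U (y, ⟨z.2, hz'.2⟩)) e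
  have hom_ext : ∀ {x y : (cylBase J n : SSet.{u}) ⟶ K},
      SSet.Subcomplex.homOfLE (le_sup_left : CJ ≤ CJ ⊔ CB) ≫ x =
        SSet.Subcomplex.homOfLE (le_sup_left : CJ ≤ CJ ⊔ CB) ≫ y →
      SSet.Subcomplex.homOfLE (le_sup_right : CB ≤ CJ ⊔ CB) ≫ x =
        SSet.Subcomplex.homOfLE (le_sup_right : CB ≤ CJ ⊔ CB) ≫ y → x = y := by
    intro x y h h'
    suffices H : ∀ U z, x.app U z = y.app U z by
      ext U z
      exact H U z
    rintro U ⟨z, hz | hz⟩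
    · exact congrArg (fun φ => φ.app U ⟨z, hz⟩) h
    · exact congrArg (fun φ => φ.app U ⟨z, hz⟩) h'
  have hJ : ∀ (q : Arr K ⟶ K) (d : rightCone J ⟶ K), p ≫ resolution F ≫ q = coneIncl J ≫ d →
      (a ≫ p ≫ resolution F) ≫ q = CJ.ι ≫ fst _ _ ≫ d := fun q d h => by
    have e₁ := congrArg (fun φ => a ≫ φ) h
    have e₂ := congrArg (fun φ => φ ≫ d) ha
    exact e₁.trans e₂
  have hps : p ≫ resolution F ≫ source K = coneIncl J ≫ c ≫ source K := by
    rw [← forget_source, ← Category.assoc, ← hpc, Category.assoc]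
  have hpt : p ≫ resolution F ≫ target K = coneIncl J ≫ c ≫ target K ≫ F := by
    rw [resolution_target, ← Category.assoc, ← hpc, Category.assoc]
  obtain ⟨ρ, hρ, hs, ht⟩ := exists_arr_extension (X₀ := cylBase J n) ρ₀
    (fst _ _ ≫ c ≫ source K) (fst _ _ ≫ c ≫ target K ≫ F)
    (hom_ext ((congrArg (fun φ => φ ≫ source K) ha₀).trans (hJ _ _ hps))
      ((congrArg (fun φ => φ ≫ source K) hb₀).trans (congrArg (fun φ => b ≫ φ) h₂)))
    (hom_ext ((congrArg (fun φ => φ ≫ target K) ha₀).trans (hJ _ _ hpt))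
      ((congrArg (fun φ => φ ≫ target K) hb₀).trans (congrArg (fun φ => b ≫ φ) h₃))) fun t ht => exists_prism_extension hc t ht
  have hρm : ∀ (U : SimplexCategoryᵒᵖ) (z : (Δ[n] : SSet.{u}).obj U),
      (curry ρ).app U z ∈ (inducedMaps F p c).obj U := by
    refine (mem_inducedMaps_iff p c (curry ρ)).2 ?_
    rw [uncurry_curry]
    refine ⟨?_, hs, ht⟩
    suffices H : ∀ U (z : (J ⊗ Δ[n]).obj U),
        (coneIncl J ▷ Δ[n] ≫ ρ).app U z = (fst _ _ ≫ p ≫ resolution F).app U z by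
      ext U z
      exact H U z
    intro U z
    have hz : (((coneIncl J).app U z.1, z.2) : (rightCone J ⊗ Δ[n]).obj U) ∈ CJ.obj U :=
      ⟨joinInl_mem z.1, trivial⟩
    refine (congrArg (fun φ => φ.app U ⟨_, Or.inl hz⟩) hρ).trans
      ((congrArg (fun φ => φ.app U ⟨_, hz⟩) ha₀).trans ?_)
    exact congrArg ((p ≫ resolution F).app U) (joinInl_left z.1 (joinInl_mem z.1))
  refine ⟨SSet.Subcomplex.lift (curry ρ) ?_, ?_⟩
  · rintro U _ ⟨z, rfl⟩
    exact hρm U z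
  · rw [← cancel_mono (inducedMaps F p c).ι, ← curry_uncurry (σ ≫ (inducedMaps F p c).ι)]
    change ∂Δ[n].ι ≫ curry ρ = _
    rw [← curry_natural_left]
    refine congrArg curry ?_
    suffices H : ∀ U (z : (rightCone J ⊗ (∂Δ[n] : SSet.{u})).obj U),
        (rightCone J ◁ ∂Δ[n].ι ≫ ρ).app U z = s.app U z by
      ext U z
      exact H U z
    intro U z
    have hz : ((z.1, z.2.1) : (rightCone J ⊗ Δ[n]).obj U) ∈ CB.obj U := ⟨trivial, z.2.2⟩
    exact (congrArg (fun φ => φ.app U ⟨_, Or.inr hz⟩) hρ).trans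
      (congrArg (fun φ => φ.app U ⟨_, hz⟩) hb₀)

end Contractibility

end InftyCat

end

theorem mainTheorem10 (K : SSet.{u}) [SSet.Quasicategory K] (F : K ⟶ K) (J : SSet.{u}) :
    (∀ P : InftyCat.rightCone J ⟶ InftyCat.LaxAlg F,
      InftyCat.IsColimitCone (P ≫ InftyCat.forget F) →
      InftyCat.IsColimitCone (P ≫ InftyCat.forget F ≫ InftyCat.source K) →
      InftyCat.IsColimitCone P) ∧
    (∀ (p : J ⟶ InftyCat.LaxAlg F) (c : InftyCat.rightCone J ⟶ InftyCat.Arr K),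
      InftyCat.coneIncl J ≫ c = p ≫ InftyCat.forget F →
      InftyCat.IsColimitCone c →
      InftyCat.IsColimitCone (c ≫ InftyCat.source K) →
      InftyCat.IsContractible (InftyCat.inducedMaps F p c : SSet.{u}) ∧
      ∀ r : InftyCat.rightCone J ⟶ InftyCat.Arr K,
        InftyCat.coneIncl J ≫ r = p ≫ InftyCat.resolution F →
        r ≫ InftyCat.source K = c ≫ InftyCat.source K →
        r ≫ InftyCat.target K = c ≫ InftyCat.target K ≫ F →
        ∃ P : InftyCat.rightCone J ⟶ InftyCat.LaxAlg F,
          InftyCat.coneIncl J ≫ P = p ∧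
          P ≫ InftyCat.forget F = c ∧
          P ≫ InftyCat.resolution F = r ∧
          (∀ P' : InftyCat.rightCone J ⟶ InftyCat.LaxAlg F,
            P' ≫ InftyCat.forget F = c → P' ≫ InftyCat.resolution F = r → P' = P) ∧
          InftyCat.IsColimitCone P) := by
  refine ⟨InftyCat.isColimitCone_of_forget F, fun p c hpc hc hc' =>
    ⟨InftyCat.isContractible_inducedMaps F p c hpc hc', fun r hr hs ht => ?_⟩⟩
  -- The conditions on `r` are precisely those for `c` and `r` to form a span over `F`; the colimit
  -- property then follows from the first claim.
  obtain ⟨P, hP, hP'⟩ := InftyCat.exists_laxAlg_lift c r hs.symm ht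
  refine ⟨P, InftyCat.laxAlg_hom_ext ?_ ?_, hP, hP', fun P' h h' =>
    InftyCat.laxAlg_hom_ext (h.trans hP.symm) (h'.trans hP'.symm),
    InftyCat.isColimitCone_of_forget F P (hP ▸ hc) ?_⟩
  · rw [Category.assoc, hP, hpc]
  · rw [Category.assoc, hP', hr]
  · rw [← Category.assoc, hP]
    exact hc'
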